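/- **Setting.** Fix $\kappa,\tau>0$. On $\mathbb R^4_2$ let $\langle v,w\rangle=v_1w_1+v_2w_2-v_3w_3-v_4w_4$ and $$J_1=\begin{pmatrix}0&-1&0&0\\1&0&0&0\\0&0&0&-1\\0&0&1&0\end{pmatrix},\quad J_2=\begin{pmatrix}0&0&1&0\\0&0&0&-1\\1&0&0&0\\0&-1&0&0\end{pmatrix},\quad J_3=\begin{pmatrix}0&0&0&1\\0&0&1&0\\0&1&0&0\\1&0&0&0\end{pmatrix}.$$ Let $\mathbb H^3_{1,\tau}=\{q\in\mathbb R^4:\langle q,q\rangle=-4/\kappa\}$ with the Lorentzian metric $g_\tau(X,Y)=\langle X,Y\rangle+(1-\tau^2)\langle X,X_1\rangle\langle Y,X_1\rangle$, where $X_1(q)=\frac{\sqrt\kappa}{2}J_1q$. Put $E_1=\tau^{-1}X_1$, $E_2(q)=\frac{\sqrt\kappa}2J_2q$, $E_3(q)=\frac{\sqrt\kappa}2J_3q$, and let $\wedge$ be the wedge product on tangent vectors determined by $E_1\wedge E_2=E_3$, $E_2\wedge E_3=-E_1$, $E_3\wedge E_1=E_2$. Let $\lambda\in\{1,-1\}$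 and $\nu\neq0$. A *helix surface with constant angle function $\nu$* is a smoothly immersed surface $M$ in $\mathbb H^3_{1,\tau}$ oriented by a smooth unit normal field $N$ with $g_\tau(N,N)=\lambda$ and $\lambda g_\tau(N,E_1)=\nu$ at every point. On it put $T=E_1-\nu N$ and $JT=N\wedge T$, which are tangent to $M$. Assume $$B:=\nu^2(\tau^2-1)-\lambda>0,$$ and set $$\alpha_{1,2}=\frac{\sqrt\kappa}2\Big(|\nu|\sqrt B\pm\frac B\tau\Big),\qquad w_{11}=\frac{4\tau}{\kappa^{3/2}B}\,\alpha_2,\qquad w_{33}=-\frac{4\tau}{\kappa^{3/2}B}\,\alpha_1,$$ $$\gamma(x)=\big(\sqrt{w_{11}}\cos(\alpha_1x),\,-\lambda\sqrt{w_{11}}\sin(\alpha_1x),\,\sqrt{-w_{33}}\cos(\alpha_2x),\,\lambda\sqrt{-w_{33}}\sin(\alpha_2x)\big).$$ For real $\xi,\xi_1,\xi_2,\xi_3$ let $A(\xi,\xi_1,\xi_2,\xi_3)$ be the matrix with rows $\mathbf r_1$, $J_1\mathbf r_1$, $\mathbf r_3$, $J_1\mathbf r_3$, where $$\mathbf r_1=(\cosh\xi_1\cos\xi_2,\,-\cosh\xi_1\sin\xi_2,\,\sinh\xi_1\cos\xi_3,\,-\sinh\xi_1\sin\xi_3),\qquad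 \mathbf r_3=\sin\xi\,J_2\mathbf r_1+\cos\xi\,J_3\mathbf r_1.$$ **Theorem (characterization for $B>0$).** (1) Let $M$ be a helix surface in $\mathbb H^3_{1,\tau}$ with constant angle function $\nu$ (and $B>0$). Then $\gamma$ is a twisted geodesic of the Lorentz torus $\mathbb S^1(\sqrt{w_{11}})\times\mathbb S^1(\sqrt{-w_{33}})\subset\mathbb H^3_{1,\tau}$: both radii are positive, the torus lies in $\mathbb H^3_{1,\tau}$ and the metric induced on it by $g_\tau$ is Lorentzian, and $\gamma$ is a geodesic of it which turns with nonzero speed along both circle factors. Moreover, around every point of $M$ there are local coordinates $(x,y)$, ranging over a product of two open intervals, with $$\partial_x=T,\qquad \partial_y=a\,T+b\,JT,\qquad a=\frac{\lambda\tau}{\sqrt B}\sin\!\big(\eta(y)-\nu\sqrt{\kappa B}\,x\big),\qquad b=\cos\!\big(\eta(y)-\nu\sqrt{\kappa B}\,x\big)$$ for some smooth function $\eta$, in which the position vector of $M$ in $\mathbb R^4_2$ is $$F(x,y)=A(y)\,\gamma(x),\qquad A(y)=A\big(\xi,\xi_1(y),\xi_2(y),\xi_3(y)\big),$$ where the matrices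 $A(y)$ are pseudo-orthogonal and commute with $J_1$, $\xi$ is a constant, and $\xi_1,\xi_2,\xi_3$ are smooth functions with $$\cosh^2(\xi_1(y))\,\xi_2'(y)+\sinh^2(\xi_1(y))\,\xi_3'(y)=0.\qquad(*)$$ (2) Conversely, suppose $\lambda+\nu^2>0$ (and $B>0$). Then $\gamma$ is again a twisted geodesic of the Lorentz torus as in (1). If $\xi$ is a constant and $\xi_1,\xi_2,\xi_3$ are smooth functions satisfying $(*)$ on an open set $J\subset\mathbb R$, then $F(x,y)=A(y)\gamma(x)$, restricted to any open set $\Omega\subset\mathbb R\times J$ on which it is an immersion, defines (with a suitable unit normal field $N$ with $g_\tau(N,N)=\lambda$) a helix surface in $\mathbb H^3_{1,\tau}$ with constant angle function $\nu$. -/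

import Mathlib

open Real Set
open scoped Manifold ContDiff Matrix

noncomputable section

namespace BergerAdS

/-! ### The anti-de Sitter space and its Berger-like metrics -/

/-- The flat metric `dx₁² + dx₂² - dx₃² - dx₄²` of `ℝ⁴₂`. -/
def ip (v w : Fin 4 → ℝ) : ℝ := v 0 * w 0 + v 1 * w 1 - v 2 * w 2 - v 3 * w 3

/-- Left multiplication by the paraquaternionic unit `i`. -/
def J1 : Matrix (Fin 4) (Fin 4) ℝ :=
  !![0, -1, 0, 0; 1, 0, 0, 0; 0, 0, 0, -1; 0, 0, 1, 0]

/-- Left multiplication by the paraquaternionic unit `j`. -/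
def J2 : Matrix (Fin 4) (Fin 4) ℝ :=
  !![0, 0, 1, 0; 0, 0, 0, -1; 1, 0, 0, 0; 0, -1, 0, 0]

/-- Left multiplication by the paraquaternionic unit `k`. -/
def J3 : Matrix (Fin 4) (Fin 4) ℝ :=
  !![0, 0, 0, 1; 0, 0, 1, 0; 0, 1, 0, 0; 1, 0, 0, 0]

/-- The anti-de Sitter space `ℍ³₁(κ/4)`. -/
def AdS (κ : ℝ) : Set (Fin 4 → ℝ) := {q | ip q q = -(4 / κ)}

/-- The hyperbolic Hopf vector field `X₁`. -/
def X1 (κ : ℝ) (q : Fin 4 → ℝ) : Fin 4 → ℝ := (√κ / 2) • (J1 *ᵥ q)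

/-- The Berger-like metric `g_τ` at the point `q`, on vectors tangent to `ℍ³₁(κ/4)` at `q`. -/
def gBerger (κ τ : ℝ) (q v w : Fin 4 → ℝ) : ℝ :=
  ip v w + (1 - τ ^ 2) * ip v (X1 κ q) * ip w (X1 κ q)

/-- The timelike field `E₁ = τ⁻¹ X₁` of the `g_τ`-pseudo-orthonormal frame `E₁, E₂, E₃`. -/
def E1 (κ τ : ℝ) (q : Fin 4 → ℝ) : Fin 4 → ℝ := τ⁻¹ • X1 κ q

/-- The spacelike field `E₂ = X₂` of the frame. -/
def E2 (κ : ℝ) (q : Fin 4 → ℝ) : Fin 4 → ℝ := (√κ / 2) • (J2 *ᵥ q)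

/-- The spacelike field `E₃ = X₃` of the frame. -/
def E3 (κ : ℝ) (q : Fin 4 → ℝ) : Fin 4 → ℝ := (√κ / 2) • (J3 *ᵥ q)

/-- The wedge product of tangent vectors at `q`, determined by
`E₁ ∧ E₂ = E₃`, `E₂ ∧ E₃ = -E₁`, `E₃ ∧ E₁ = E₂`. Here `u₁, u₂, u₃` and `v₁, v₂, v₃` are the
components of `U` and `V` in the frame (recall that `E₁` is timelike). -/
def wedge (κ τ : ℝ) (q U V : Fin 4 → ℝ) : Fin 4 → ℝ :=
  let u₁ := -gBerger κ τ q U (E1 κ τ q)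
  let u₂ := gBerger κ τ q U (E2 κ q)
  let u₃ := gBerger κ τ q U (E3 κ q)
  let v₁ := -gBerger κ τ q V (E1 κ τ q)
  let v₂ := gBerger κ τ q V (E2 κ q)
  let v₃ := gBerger κ τ q V (E3 κ q)
  (-(u₂ * v₃ - u₃ * v₂)) • E1 κ τ q + (u₃ * v₁ - u₁ * v₃) • E2 κ q
    + (u₁ * v₂ - u₂ * v₁) • E3 κ q

/-! ### Helix surfaces -/

/-- `F : M → ℍ³₁(κ/4)` is an immersed surface, oriented by the `g_τ`-unit normal field `N` with
`g_τ(N, N) = lam`, whose angle function `lam * g_τ(N, E₁)` is the constant `ν`.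
Surfaces are modelled on the plane `ℝ × ℝ`. As the normal field is not null, the induced metric
is automatically nondegenerate. -/
structure IsHelixSurface (κ τ lam ν : ℝ) {M : Type*} [TopologicalSpace M]
    [ChartedSpace (ℝ × ℝ) M] (F N : M → Fin 4 → ℝ) : Prop where
  smooth : ContMDiff 𝓘(ℝ, ℝ × ℝ) 𝓘(ℝ, Fin 4 → ℝ) ∞ F
  mem_AdS : ∀ p, F p ∈ AdS κ
  immersion : ∀ p, Function.Injective (mfderiv 𝓘(ℝ, ℝ × ℝ) 𝓘(ℝ, Fin 4 → ℝ) F p)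
  smooth_normal : ContMDiff 𝓘(ℝ, ℝ × ℝ) 𝓘(ℝ, Fin 4 → ℝ) ∞ N
  tangent_AdS : ∀ p, ip (N p) (F p) = 0
  normal : ∀ p (v : TangentSpace 𝓘(ℝ, ℝ × ℝ) p),
    gBerger κ τ (F p) (N p) (mfderiv 𝓘(ℝ, ℝ × ℝ) 𝓘(ℝ, Fin 4 → ℝ) F p v) = 0
  unit : ∀ p, gBerger κ τ (F p) (N p) (N p) = lam
  angle : ∀ p, lam * gBerger κ τ (F p) (N p) (E1 κ τ (F p)) = ν

/-- The tangential part `T = E₁ - ν N` of `E₁`, at a point `q` of a helix surface with unit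
normal `n`. -/
def tanT (κ τ ν : ℝ) (q n : Fin 4 → ℝ) : Fin 4 → ℝ := E1 κ τ q - ν • n

/-- The tangent vector `JT = N ∧ T`. -/
def tanJT (κ τ ν : ℝ) (q n : Fin 4 → ℝ) : Fin 4 → ℝ := wedge κ τ q n (tanT κ τ ν q n)

/-! ### The constants -/

/-- The constant `B`. -/
def B (τ lam ν : ℝ) : ℝ := ν ^ 2 * (τ ^ 2 - 1) - lam

/-- The constant `α₁`. -/
def α₁ (κ τ lam ν : ℝ) : ℝ := √κ / 2 * (|ν| * √(B τ lam ν) + B τ lam ν / τ)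

/-- The constant `α₂`. -/
def α₂ (κ τ lam ν : ℝ) : ℝ := √κ / 2 * (|ν| * √(B τ lam ν) - B τ lam ν / τ)

/-- The constant `w₁₁`. -/
def w₁₁ (κ τ lam ν : ℝ) : ℝ := 4 * τ / (κ ^ (3 / 2 : ℝ) * B τ lam ν) * α₂ κ τ lam ν

/-- The constant `w₃₃`. -/
def w₃₃ (κ τ lam ν : ℝ) : ℝ := -(4 * τ / (κ ^ (3 / 2 : ℝ) * B τ lam ν)) * α₁ κ τ lam ν

/-- The curve `γ`. -/
def γ (κ τ lam ν x : ℝ) : Fin 4 → ℝ :=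
  ![√(w₁₁ κ τ lam ν) * cos (α₁ κ τ lam ν * x),
    -lam * √(w₁₁ κ τ lam ν) * sin (α₁ κ τ lam ν * x),
    √(-w₃₃ κ τ lam ν) * cos (α₂ κ τ lam ν * x),
    lam * √(-w₃₃ κ τ lam ν) * sin (α₂ κ τ lam ν * x)]

/-! ### Lorentz tori and their twisted geodesics -/

/-- The standard parametrization of the torus `𝕊¹(r) × 𝕊¹(R)` by two angles. -/
def torusMap (r R : ℝ) (θ : ℝ × ℝ) : Fin 4 → ℝ :=
  ![r * cos θ.1, r * sin θ.1, R * cos θ.2, R * sin θ.2]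

/-- The metric induced by `g_τ` on the torus `𝕊¹(r) × 𝕊¹(R)`, in the angular coordinates. -/
def torusMetric (κ τ r R : ℝ) (θ v w : ℝ × ℝ) : ℝ :=
  gBerger κ τ (torusMap r R θ) (fderiv ℝ (torusMap r R) θ v) (fderiv ℝ (torusMap r R) θ w)

/-- The curve `c` is a geodesic of the pseudo-Riemannian metric `G` on the plane: it satisfies
`d/dt (G_{ij} ċʲ) = (1/2) ∂ᵢ G_{jk} ċʲ ċᵏ`, the geodesic equation with its index lowered. -/
def IsGeodesic (G : ℝ × ℝ → ℝ × ℝ → ℝ × ℝ → ℝ) (c : ℝ → ℝ × ℝ) : Prop :=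
  ContDiff ℝ ∞ c ∧ ∀ (t : ℝ) (w : ℝ × ℝ),
    deriv (fun s => G (c s) (deriv c s) w) t
      = 1 / 2 * fderiv ℝ (fun θ => G θ (deriv c t) (deriv c t)) (c t) w

/-- `𝕊¹(r) × 𝕊¹(R)` is a torus in `ℍ³₁(κ/4)`, Lorentzian for the metric induced by `g_τ`, and `g`
is a geodesic of it which is twisted, that is, which turns along both circle factors. -/
structure IsTwistedGeodesicOfLorentzTorus (κ τ r R : ℝ) (g : ℝ → Fin 4 → ℝ) : Prop where
  r_pos : 0 < r
  R_pos : 0 < R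
  subset_AdS : {q : Fin 4 → ℝ | q 0 ^ 2 + q 1 ^ 2 = r ^ 2 ∧ q 2 ^ 2 + q 3 ^ 2 = R ^ 2} ⊆ AdS κ
  lorentz : ∀ θ : ℝ × ℝ,
    torusMetric κ τ r R θ (1, 0) (1, 0) * torusMetric κ τ r R θ (0, 1) (0, 1)
      - torusMetric κ τ r R θ (1, 0) (0, 1) ^ 2 < 0
  twisted_geodesic : ∃ c : ℝ → ℝ × ℝ, IsGeodesic (torusMetric κ τ r R) c ∧
    (∀ x, g x = torusMap r R (c x)) ∧ ∀ x, (deriv c x).1 ≠ 0 ∧ (deriv c x).2 ≠ 0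

/-! ### Pseudo-orthogonal matrices commuting with `J₁` -/

/-- The matrix of the metric of `ℝ⁴₂`. -/
def eps : Matrix (Fin 4) (Fin 4) ℝ := Matrix.diagonal ![1, 1, -1, -1]

/-- The pseudo-orthogonal group: `Aᵗ ε A = ε`, equivalently, `A` is invertible and
`Aᵗ = ε A⁻¹ ε`. -/
def IsPseudoOrthogonal (A : Matrix (Fin 4) (Fin 4) ℝ) : Prop := Aᵀ * eps * A = eps

/-- The first row of the matrix `A(ξ, ξ₁, ξ₂, ξ₃)`. -/
def row1 (ξ₁ ξ₂ ξ₃ : ℝ) : Fin 4 → ℝ :=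
  ![cosh ξ₁ * cos ξ₂, -(cosh ξ₁ * sin ξ₂), sinh ξ₁ * cos ξ₃, -(sinh ξ₁ * sin ξ₃)]

/-- The third row of the matrix `A(ξ, ξ₁, ξ₂, ξ₃)`. -/
def row3 (ξ ξ₁ ξ₂ ξ₃ : ℝ) : Fin 4 → ℝ :=
  sin ξ • (J2 *ᵥ row1 ξ₁ ξ₂ ξ₃) + cos ξ • (J3 *ᵥ row1 ξ₁ ξ₂ ξ₃)

/-- The general pseudo-orthogonal matrix `A(ξ, ξ₁, ξ₂, ξ₃)` commuting with `J₁`; its rows are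
`r₁`, `J₁ r₁`, `r₃ = sin ξ J₂ r₁ + cos ξ J₃ r₁` and `J₁ r₃`. -/
def matA (ξ ξ₁ ξ₂ ξ₃ : ℝ) : Matrix (Fin 4) (Fin 4) ℝ :=
  Matrix.of ![row1 ξ₁ ξ₂ ξ₃, J1 *ᵥ row1 ξ₁ ξ₂ ξ₃, row3 ξ ξ₁ ξ₂ ξ₃, J1 *ᵥ row3 ξ ξ₁ ξ₂ ξ₃]

/-- `ξ₁, ξ₂, ξ₃` are smooth on the open set `J` and satisfy
`cosh²(ξ₁) ξ₂' + sinh²(ξ₁) ξ₃' = 0` there. -/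
structure AdmissibleAngles (J : Set ℝ) (ξ₁ ξ₂ ξ₃ : ℝ → ℝ) : Prop where
  smooth₁ : ContDiffOn ℝ ∞ ξ₁ J
  smooth₂ : ContDiffOn ℝ ∞ ξ₂ J
  smooth₃ : ContDiffOn ℝ ∞ ξ₃ J
  eqn : ∀ y ∈ J, cosh (ξ₁ y) ^ 2 * deriv ξ₂ y + sinh (ξ₁ y) ^ 2 * deriv ξ₃ y = 0

/-- The parametrization `F(x, y) = A(y) γ(x)` with constant `ξ`. -/
def paramF (κ τ lam ν ξ : ℝ) (ξ₁ ξ₂ ξ₃ : ℝ → ℝ) (z : ℝ × ℝ) : Fin 4 → ℝ :=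
  matA ξ (ξ₁ z.2) (ξ₂ z.2) (ξ₃ z.2) *ᵥ γ κ τ lam ν z.1

/-! ### The local coordinates -/

/-- The coefficient `a` in `∂_y = a T + b JT`. -/
def coefA (κ τ lam ν : ℝ) (η : ℝ → ℝ) (z : ℝ × ℝ) : ℝ :=
  lam * τ / √(B τ lam ν) * sin (η z.2 - ν * √(κ * B τ lam ν) * z.1)

/-- The coefficient `b` in `∂_y = a T + b JT`. -/
def coefB (κ τ lam ν : ℝ) (η : ℝ → ℝ) (z : ℝ × ℝ) : ℝ :=
  cos (η z.2 - ν * √(κ * B τ lam ν) * z.1)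

/-- The chart `e` of `M`, with coordinates `(x, y)` in the rectangle `I × J`, satisfies
`∂_x = T` and `∂_y = a T + b JT`, where `a` and `b` are given by a smooth function `η` of `y`.
The coordinate fields are read in `ℝ⁴` through the immersion `F`. -/
structure IsAdaptedChart (κ τ lam ν : ℝ) {M : Type*} [TopologicalSpace M]
    [ChartedSpace (ℝ × ℝ) M] (F N : M → Fin 4 → ℝ) (e : OpenPartialHomeomorph M (ℝ × ℝ))
    (I J : Set ℝ) (η : ℝ → ℝ) : Prop where
  mem_atlas : e ∈ IsManifold.maximalAtlas 𝓘(ℝ, ℝ × ℝ) ∞ M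
  target_eq : e.target = I ×ˢ J
  smooth : ContDiffOn ℝ ∞ η J
  deriv_x : ∀ z ∈ e.target, fderiv ℝ (fun z => F (e.symm z)) z (1, 0)
    = tanT κ τ ν (F (e.symm z)) (N (e.symm z))
  deriv_y : ∀ z ∈ e.target, fderiv ℝ (fun z => F (e.symm z)) z (0, 1)
    = coefA κ τ lam ν η z • tanT κ τ ν (F (e.symm z)) (N (e.symm z))
      + coefB κ τ lam ν η z • tanJT κ τ ν (F (e.symm z)) (N (e.symm z))

end BergerAdS

end

/-!
Identify `ℝ⁴₂` with `ℂ²`, so that `J₁` is the multiplication by `i`. Multiplying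
by a matrix `A(0, ξ₁, ξ₂, ξ₃)` is the map `act r`, bilinear in its first row `r` and in the vector;
for `ip r r = 1` it is an isometry of `g_τ` preserving `E₁`. The angle `ξ` adds the rotation `rot ξ`
of the second coordinate.

*From a helix surface to the parametrization.* The component of the normal along `E₁` being
constant, its horizontal part has the constant squared length `λ + ν²` (`normal_horizontal_sq`).
This number is positive, because the planes spanned by `E₂, E₃` are not integrable
(`IsLocalHelix.add_sq_pos`). The integrability condition of `g_τ(N, dF) = 0` shows that the
horizontal part rotates at the constant rate `-λ√κB/τ` along `T` (`IsLocalHelix.rotation_rate`).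
Hence its angle, divided by this rate, serves as the coordinate `x`, and along `T` the position
vector satisfies a linear equation in which only `x` enters. The curve `γ` satisfies the same
equation (`γ_ode`), up to the exchange of `J₂, J₃` caused by `act`. So the vector `r` defined by
`F = act r (γ x)` is constant along `T`, and an entry of `r` completes `x` to coordinates
(`IsLocalHelix.exists_flowBox`), in which `F = act (r y) (γ x)`.

The entries of `A⁻¹A'` are the forms `angSpeed r r'` and `offRe r r'`, `offIm r r'`. The
orthogonality of `N` and `∂_y` says that `angSpeed r r' = 0` (`gBerger_normal_velocity`), which is
the equation `cosh² ξ₁ ξ₂' + sinh² ξ₁ ξ₃' = 0`. The immersion property says that the off-diagonal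
entry does not vanish, so that a change of the coordinate `y` makes its modulus constant
(`exists_isNormalizedCurve`); its argument then gives the function `η`, and the components of `∂_y`
along `T` and `JT` are obtained by pairing with `J₁F` and `J₁T` (`velocity_eq_coef`). Finally `r` is
written as `row1 ξ₁ ξ₂ ξ₃` with smooth angles: where `sinh ξ₁` vanishes, the nonvanishing of the
off-diagonal entry makes the zero simple, and Hadamard's lemma supplies a smooth signed radius
(`exists_row1`).

*The converse.* On the surfaces `A(y) γ(x)` the field `N = (E₁ - ∂ₓF) / ν` is a unit normal with the
right angle; the only condition involving `y` is again `angSpeed r r' = 0`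
(`exists_isHelixSurface_paramF`).

The curve `γ` is a twisted geodesic because the torus metric has constant coefficients in the
angular coordinates, in which `γ` is a straight line (`isTwistedGeodesic_γ`).
-/

open Real Set
open scoped Manifold ContDiff Matrix

noncomputable section

namespace BergerAdS

variable {κ τ lam ν : ℝ}

/-! ### Algebra of `ℝ⁴₂` -/

lemma J1_mulVec (v : Fin 4 → ℝ) : J1 *ᵥ v = ![-v 1, v 0, -v 3, v 2] := by
  ext i; fin_cases i <;> simp [J1, Matrix.mulVec, dotProduct, Fin.sum_univ_four]

lemma J2_mulVec (v : Fin 4 → ℝ) : J2 *ᵥ v = ![v 2, -v 3, v 0, -v 1] := by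
  ext i; fin_cases i <;> simp [J2, Matrix.mulVec, dotProduct, Fin.sum_univ_four]

lemma J3_mulVec (v : Fin 4 → ℝ) : J3 *ᵥ v = ![v 3, v 2, v 1, v 0] := by
  ext i; fin_cases i <;> simp [J3, Matrix.mulVec, dotProduct, Fin.sum_univ_four]

lemma ip_comm (v w : Fin 4 → ℝ) : ip v w = ip w v := by simp only [ip]; ring

lemma ip_add_left (u v w : Fin 4 → ℝ) : ip (u + v) w = ip u w + ip v w := by
  simp only [ip, Pi.add_apply]; ring

lemma ip_sub_left (u v w : Fin 4 → ℝ) : ip (u - v) w = ip u w - ip v w := by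
  simp only [ip, Pi.sub_apply]; ring

lemma ip_smul_left (a : ℝ) (v w : Fin 4 → ℝ) : ip (a • v) w = a * ip v w := by
  simp only [ip, Pi.smul_apply, smul_eq_mul]; ring

lemma ip_neg_left (v w : Fin 4 → ℝ) : ip (-v) w = -ip v w := by
  simp only [ip, Pi.neg_apply]; ring

lemma ip_add_right (u v w : Fin 4 → ℝ) : ip w (u + v) = ip w u + ip w v := by
  simp only [ip, Pi.add_apply]; ring

lemma ip_sub_right (u v w : Fin 4 → ℝ) : ip w (u - v) = ip w u - ip w v := by
  simp only [ip, Pi.sub_apply]; ring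

lemma ip_smul_right (a : ℝ) (v w : Fin 4 → ℝ) : ip w (a • v) = a * ip w v := by
  simp only [ip, Pi.smul_apply, smul_eq_mul]; ring

/-- The vectors `q, J₁q, J₂q, J₃q` are `ip`-orthogonal, so that they expand any vector. -/
lemma ip_smul_expand (q v : Fin 4 → ℝ) :
    ip q q • v = ip v q • q + ip v (J1 *ᵥ q) • (J1 *ᵥ q)
      - ip v (J2 *ᵥ q) • (J2 *ᵥ q) - ip v (J3 *ᵥ q) • (J3 *ᵥ q) := by
  simp only [J1_mulVec, J2_mulVec, J3_mulVec]
  ext i; fin_cases i <;> simp [ip, Matrix.vecHead, Matrix.vecTail] <;> ring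

/-- Parseval identity for the expansion `ip_smul_expand`. -/
lemma ip_mul_expand (q v w : Fin 4 → ℝ) :
    ip q q * ip v w = ip v q * ip w q + ip v (J1 *ᵥ q) * ip w (J1 *ᵥ q)
      - ip v (J2 *ᵥ q) * ip w (J2 *ᵥ q) - ip v (J3 *ᵥ q) * ip w (J3 *ᵥ q) := by
  simp only [J1_mulVec, J2_mulVec, J3_mulVec]
  simp [ip]; ring

lemma ip_J1_self (q : Fin 4 → ℝ) : ip (J1 *ᵥ q) q = 0 := by
  simp [J1_mulVec, ip]; ring

lemma ip_J2_self (q : Fin 4 → ℝ) : ip (J2 *ᵥ q) q = 0 := by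
  simp [J2_mulVec, ip]; ring

lemma ip_J3_self (q : Fin 4 → ℝ) : ip (J3 *ᵥ q) q = 0 := by
  simp [J3_mulVec, ip]; ring

lemma ip_J1_J1 (q v : Fin 4 → ℝ) : ip (J1 *ᵥ q) (J1 *ᵥ v) = ip q v := by
  simp [J1_mulVec, ip]; ring

lemma ip_J2_J2 (q : Fin 4 → ℝ) : ip (J2 *ᵥ q) (J2 *ᵥ q) = -ip q q := by
  simp [J2_mulVec, ip]; ring

lemma ip_J3_J3 (q : Fin 4 → ℝ) : ip (J3 *ᵥ q) (J3 *ᵥ q) = -ip q q := by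
  simp [J3_mulVec, ip]; ring

lemma ip_J1_J2 (q : Fin 4 → ℝ) : ip (J1 *ᵥ q) (J2 *ᵥ q) = 0 := by
  simp [J1_mulVec, J2_mulVec, ip]; ring

lemma ip_J1_J3 (q : Fin 4 → ℝ) : ip (J1 *ᵥ q) (J3 *ᵥ q) = 0 := by
  simp [J1_mulVec, J3_mulVec, ip]; ring

lemma ip_J2_J3 (q : Fin 4 → ℝ) : ip (J2 *ᵥ q) (J3 *ᵥ q) = 0 := by
  simp [J2_mulVec, J3_mulVec, ip]; ring

lemma ip_J1_skew (u v : Fin 4 → ℝ) : ip u (J1 *ᵥ v) = -ip v (J1 *ᵥ u) := by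
  simp [J1_mulVec, ip]; ring

lemma ip_J2_skew (u v : Fin 4 → ℝ) : ip u (J2 *ᵥ v) = -ip v (J2 *ᵥ u) := by
  simp [J2_mulVec, ip]; ring

lemma ip_J3_skew (u v : Fin 4 → ℝ) : ip u (J3 *ᵥ v) = -ip v (J3 *ᵥ u) := by
  simp [J3_mulVec, ip]; ring

lemma J1_J1 (q : Fin 4 → ℝ) : J1 *ᵥ (J1 *ᵥ q) = -q := by
  simp only [J1_mulVec]; ext i; fin_cases i <;> simp

lemma J1_J2 (q : Fin 4 → ℝ) : J1 *ᵥ (J2 *ᵥ q) = J3 *ᵥ q := by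
  simp only [J1_mulVec, J2_mulVec, J3_mulVec]; ext i; fin_cases i <;> simp

lemma J1_J3 (q : Fin 4 → ℝ) : J1 *ᵥ (J3 *ᵥ q) = -(J2 *ᵥ q) := by
  simp only [J1_mulVec, J2_mulVec, J3_mulVec]; ext i; fin_cases i <;> simp

lemma J2_J1 (q : Fin 4 → ℝ) : J2 *ᵥ (J1 *ᵥ q) = -(J3 *ᵥ q) := by
  simp only [J1_mulVec, J2_mulVec, J3_mulVec]; ext i; fin_cases i <;> simp

lemma J2_J2 (q : Fin 4 → ℝ) : J2 *ᵥ (J2 *ᵥ q) = q := by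
  simp only [J2_mulVec]; ext i; fin_cases i <;> simp

lemma J2_J3 (q : Fin 4 → ℝ) : J2 *ᵥ (J3 *ᵥ q) = -(J1 *ᵥ q) := by
  simp only [J1_mulVec, J2_mulVec, J3_mulVec]; ext i; fin_cases i <;> simp

lemma J3_J1 (q : Fin 4 → ℝ) : J3 *ᵥ (J1 *ᵥ q) = J2 *ᵥ q := by
  simp only [J1_mulVec, J2_mulVec, J3_mulVec]; ext i; fin_cases i <;> simp

lemma J3_J2 (q : Fin 4 → ℝ) : J3 *ᵥ (J2 *ᵥ q) = J1 *ᵥ q := by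
  simp only [J1_mulVec, J2_mulVec, J3_mulVec]; ext i; fin_cases i <;> simp

lemma J3_J3 (q : Fin 4 → ℝ) : J3 *ᵥ (J3 *ᵥ q) = q := by
  simp only [J3_mulVec]; ext i; fin_cases i <;> simp

/-! ### Pseudo-unitary maps with a prescribed first row -/

/-- The matrix with rows `r, J₁r, J₃r, -J₂r` applied to `g`. These are the matrices
`A(0, ξ₁, ξ₂, ξ₃)`, with `r` the first row. In the identification `ℝ⁴ = ℂ²` such a matrix is
`(p, q; -i q̄, -i p̄)` with `p = r₀ - i r₁` and `q = r₂ - i r₃`. -/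
def act (r g : Fin 4 → ℝ) : Fin 4 → ℝ :=
  ![r 0 * g 0 + r 1 * g 1 + r 2 * g 2 + r 3 * g 3,
    -r 1 * g 0 + r 0 * g 1 - r 3 * g 2 + r 2 * g 3,
    r 3 * g 0 + r 2 * g 1 + r 1 * g 2 + r 0 * g 3,
    -r 2 * g 0 + r 3 * g 1 - r 0 * g 2 + r 1 * g 3]

/-- The solution `r` of `act r g = v`, multiplied by `ip g g`. -/
def actSolve (v g : Fin 4 → ℝ) : Fin 4 → ℝ :=
  ![v 0 * g 0 + v 1 * g 1 + v 3 * g 2 - v 2 * g 3,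
    v 0 * g 1 - v 1 * g 0 - v 3 * g 3 - v 2 * g 2,
    v 2 * g 1 - v 3 * g 0 - v 0 * g 2 - v 1 * g 3,
    v 1 * g 2 - v 0 * g 3 + v 3 * g 1 + v 2 * g 0]

lemma actSolve_act (r g : Fin 4 → ℝ) : actSolve (act r g) g = ip g g • r := by
  ext i; fin_cases i <;> simp [act, actSolve, ip] <;> ring

lemma act_actSolve (v g : Fin 4 → ℝ) : act (actSolve v g) g = ip g g • v := by
  ext i; fin_cases i <;> simp [act, actSolve, ip] <;> ring

lemma act_add_left (r s g : Fin 4 → ℝ) : act (r + s) g = act r g + act s g := by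
  ext i; fin_cases i <;> simp [act] <;> ring

lemma act_smul_left (a : ℝ) (r g : Fin 4 → ℝ) : act (a • r) g = a • act r g := by
  ext i; fin_cases i <;> simp [act] <;> ring

lemma act_add_right (r g h : Fin 4 → ℝ) : act r (g + h) = act r g + act r h := by
  ext i; fin_cases i <;> simp [act] <;> ring

lemma act_sub_right (r g h : Fin 4 → ℝ) : act r (g - h) = act r g - act r h := by
  ext i; fin_cases i <;> simp [act] <;> ring

lemma act_smul_right (a : ℝ) (r g : Fin 4 → ℝ) : act r (a • g) = a • act r g := by
  ext i; fin_cases i <;> simp [act] <;> ring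

lemma act_J1 (r g : Fin 4 → ℝ) : act r (J1 *ᵥ g) = J1 *ᵥ act r g := by
  simp only [J1_mulVec]; ext i; fin_cases i <;> simp [act] <;> ring

lemma act_J2 (r g : Fin 4 → ℝ) : act r (J2 *ᵥ g) = -(J3 *ᵥ act r g) := by
  simp only [J2_mulVec, J3_mulVec]; ext i; fin_cases i <;> simp [act] <;> ring

lemma act_J3 (r g : Fin 4 → ℝ) : act r (J3 *ᵥ g) = J2 *ᵥ act r g := by
  simp only [J2_mulVec, J3_mulVec]; ext i; fin_cases i <;> simp [act] <;> ring

lemma ip_act_act (r g h : Fin 4 → ℝ) : ip (act r g) (act r h) = ip r r * ip g h := by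
  simp [act, ip]; ring

lemma act_eq_zero_iff {r g : Fin 4 → ℝ} (hg : ip g g ≠ 0) : act r g = 0 ↔ r = 0 := by
  constructor
  · intro h
    have h1 := actSolve_act r g
    rw [h] at h1
    have h2 : actSolve 0 g = 0 := by ext i; fin_cases i <;> simp [actSolve]
    rw [h2] at h1
    simpa [hg] using h1.symm
  · rintro rfl
    ext i; fin_cases i <;> simp [act]

/-- In complex notation, multiplication of the two coordinates by `i s` and `i t`. -/
def twistI (s t : ℝ) (g : Fin 4 → ℝ) : Fin 4 → ℝ := ![-s * g 1, s * g 0, -t * g 3, t * g 2]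

/-- For a curve of matrices with first row `r` and velocity `r'`, the form
`cosh² ξ₁ ξ₂' + sinh² ξ₁ ξ₃'`. -/
def angSpeed (r r' : Fin 4 → ℝ) : ℝ := r 1 * r' 0 - r 0 * r' 1 + r 3 * r' 2 - r 2 * r' 3

/-- Real part of the off-diagonal entry of `A⁻¹ A'`, where `A` is the matrix of `act r`. -/
def offRe (r r' : Fin 4 → ℝ) : ℝ := r 0 * r' 2 + r 1 * r' 3 - r 2 * r' 0 - r 3 * r' 1

/-- Imaginary part of the off-diagonal entry of `A⁻¹ A'`. -/
def offIm (r r' : Fin 4 → ℝ) : ℝ := r 1 * r' 2 - r 0 * r' 3 - r 2 * r' 1 + r 3 * r' 0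

lemma ip_act_twistI (r r' g : Fin 4 → ℝ) (s t : ℝ) :
    ip (act r' g) (act r (twistI s t g)) =
      angSpeed r r' * (s * (g 0 ^ 2 + g 1 ^ 2) + t * (g 2 ^ 2 + g 3 ^ 2))
      + (s + t) * (offRe r r' * (g 3 * g 0 - g 2 * g 1)
        + offIm r r' * (g 2 * g 0 + g 3 * g 1)) := by
  simp [act, ip, twistI, angSpeed, offRe, offIm]; ring

lemma ip_act_J1_twistI (r r' g : Fin 4 → ℝ) (s t : ℝ) :
    ip (act r' g) (act r (J1 *ᵥ twistI s t g)) =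
      - (ip r r' * (s * (g 0 ^ 2 + g 1 ^ 2) - t * (g 2 ^ 2 + g 3 ^ 2))
      + (s - t) * (offRe r r' * (g 2 * g 0 + g 3 * g 1)
        - offIm r r' * (g 3 * g 0 - g 2 * g 1))) := by
  rw [J1_mulVec]
  simp [act, ip, twistI, offRe, offIm]; ring

/-- Up to sign, the four forms `ip r r'`, `angSpeed r r'`, `offRe r r'`, `offIm r r'` are the
coordinates of `r'` in an `ip`-orthonormal basis whose first vector is `r`. -/
lemma velocity_eq_zero {r r' : Fin 4 → ℝ} (hr : ip r r = 1) (h : ip r r' = 0)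
    (ha : angSpeed r r' = 0) (hb : offRe r r' = 0) (hc : offIm r r' = 0) : r' = 0 := by
  simp only [ip, angSpeed, offRe, offIm] at hr h ha hb hc
  ext i
  fin_cases i <;> simp
  · linear_combination (-r' 0) * hr + r 0 * h + r 1 * ha + r 2 * hb - r 3 * hc
  · linear_combination (-r' 1) * hr + r 1 * h - r 0 * ha + r 3 * hb + r 2 * hc
  · linear_combination (-r' 2) * hr + r 2 * h - r 3 * ha + r 0 * hb + r 1 * hc
  · linear_combination (-r' 3) * hr + r 3 * h + r 2 * ha + r 1 * hb - r 0 * hc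

/-- In complex notation, multiplication of the second coordinate by `e^{iξ}`. -/
def rot (ξ : ℝ) (v : Fin 4 → ℝ) : Fin 4 → ℝ :=
  ![v 0, v 1, cos ξ * v 2 - sin ξ * v 3, sin ξ * v 2 + cos ξ * v 3]

lemma ip_rot_rot (ξ : ℝ) (v w : Fin 4 → ℝ) : ip (rot ξ v) (rot ξ w) = ip v w := by
  simp [rot, ip]
  linear_combination (-(v 2 * w 2) - v 3 * w 3) * sin_sq_add_cos_sq ξ

lemma J1_rot (ξ : ℝ) (v : Fin 4 → ℝ) : J1 *ᵥ rot ξ v = rot ξ (J1 *ᵥ v) := by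
  simp only [J1_mulVec]
  ext i; fin_cases i <;> simp [rot] <;> ring

lemma rot_zero (v : Fin 4 → ℝ) : rot 0 v = v := by
  ext i; fin_cases i <;> simp [rot]

lemma matA_mulVec (ξ ξ₁ ξ₂ ξ₃ : ℝ) (g : Fin 4 → ℝ) :
    matA ξ ξ₁ ξ₂ ξ₃ *ᵥ g = rot ξ (act (row1 ξ₁ ξ₂ ξ₃) g) := by
  simp only [matA, row3, J1_mulVec, J2_mulVec, J3_mulVec]
  ext i
  fin_cases i <;>
    simp [act, rot, row1, Matrix.mulVec, dotProduct, Fin.sum_univ_four] <;> ring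

lemma ip_row1 (ξ₁ ξ₂ ξ₃ : ℝ) : ip (row1 ξ₁ ξ₂ ξ₃) (row1 ξ₁ ξ₂ ξ₃) = 1 := by
  simp [ip, row1]
  linear_combination cosh ξ₁ ^ 2 * sin_sq_add_cos_sq ξ₂ - sinh ξ₁ ^ 2 * sin_sq_add_cos_sq ξ₃
    + cosh_sq ξ₁

lemma dotProduct_eps (v w : Fin 4 → ℝ) : v ⬝ᵥ (eps *ᵥ w) = ip v w := by
  simp [eps, Matrix.mulVec_diagonal, dotProduct, Fin.sum_univ_four, ip]; ring

lemma isPseudoOrthogonal_matA (ξ ξ₁ ξ₂ ξ₃ : ℝ) : IsPseudoOrthogonal (matA ξ ξ₁ ξ₂ ξ₃) := by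
  have h : ∀ v w, v ⬝ᵥ (((matA ξ ξ₁ ξ₂ ξ₃)ᵀ * eps * matA ξ ξ₁ ξ₂ ξ₃) *ᵥ w) = v ⬝ᵥ (eps *ᵥ w) := by
    intro v w
    rw [dotProduct_eps, ← Matrix.mulVec_mulVec, ← Matrix.mulVec_mulVec, Matrix.dotProduct_mulVec,
      Matrix.vecMul_transpose, dotProduct_eps, matA_mulVec, matA_mulVec, ip_rot_rot, ip_act_act,
      ip_row1, one_mul]
  unfold IsPseudoOrthogonal
  apply Matrix.ext_of_mulVec_single
  intro i
  ext j
  simpa using h (Pi.single j 1) (Pi.single i 1)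

lemma commute_matA_J1 (ξ ξ₁ ξ₂ ξ₃ : ℝ) : Commute (matA ξ ξ₁ ξ₂ ξ₃) J1 := by
  apply Matrix.ext_of_mulVec_single
  intro i
  rw [← Matrix.mulVec_mulVec, ← Matrix.mulVec_mulVec, matA_mulVec, matA_mulVec, act_J1, J1_rot]

/-! ### The constants and the curve `γ` -/

lemma sq_half_sqrt (hκ : 0 < κ) : (√κ / 2) ^ 2 = κ / 4 := by
  rw [div_pow, sq_sqrt hκ.le]; norm_num

lemma lam_sq (hlam : lam = 1 ∨ lam = -1) : lam ^ 2 = 1 := by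
  rcases hlam with h | h <;> simp [h]

lemma sq_sqrt_B (hB : 0 < B τ lam ν) : √(B τ lam ν) ^ 2 = B τ lam ν := sq_sqrt hB.le

/-- `λ + ν² = (|ν|τ - √B)(|ν|τ + √B)`. -/
lemma add_sq_eq (hB : 0 < B τ lam ν) :
    lam + ν ^ 2 = (|ν| * τ - √(B τ lam ν)) * (|ν| * τ + √(B τ lam ν)) := by
  have h := sq_sqrt_B hB
  have h2 : B τ lam ν = ν ^ 2 * (τ ^ 2 - 1) - lam := rfl
  linear_combination h + h2 - τ ^ 2 * sq_abs ν

lemma sqrt_B_lt (hτ : 0 < τ) (hB : 0 < B τ lam ν) (hc : 0 < lam + ν ^ 2) :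
    √(B τ lam ν) < |ν| * τ := by
  rw [add_sq_eq hB] at hc
  have : 0 ≤ |ν| * τ + √(B τ lam ν) := by positivity
  nlinarith

lemma α₁_eq (hτ : 0 < τ) (hB : 0 < B τ lam ν) :
    α₁ κ τ lam ν = √κ / 2 * √(B τ lam ν) / τ * (|ν| * τ + √(B τ lam ν)) := by
  rw [α₁]
  have h := sq_sqrt_B hB
  field_simp
  linear_combination -√κ * h

lemma α₂_eq (hτ : 0 < τ) (hB : 0 < B τ lam ν) :
    α₂ κ τ lam ν = √κ / 2 * √(B τ lam ν) / τ * (|ν| * τ - √(B τ lam ν)) := by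
  rw [α₂]
  have h := sq_sqrt_B hB
  field_simp
  linear_combination √κ * h

lemma rpow_three_halves (hκ : 0 < κ) : κ ^ (3 / 2 : ℝ) = κ * √κ := by
  rw [show (3 / 2 : ℝ) = 1 + 1 / 2 by norm_num, rpow_add hκ, rpow_one, ← sqrt_eq_rpow]

lemma w₁₁_eq (hκ : 0 < κ) (hτ : 0 < τ) (hB : 0 < B τ lam ν) :
    w₁₁ κ τ lam ν = 2 * (|ν| * τ - √(B τ lam ν)) / (κ * √(B τ lam ν)) := by
  have hb := sqrt_pos.2 hB
  have hk := sqrt_pos.2 hκ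
  rw [w₁₁, α₂_eq hτ hB, rpow_three_halves hκ]
  conv_lhs => rw [← sq_sqrt_B hB, sqrt_sq hb.le]
  field_simp
  norm_num

lemma w₃₃_eq (hκ : 0 < κ) (hτ : 0 < τ) (hB : 0 < B τ lam ν) :
    -w₃₃ κ τ lam ν = 2 * (|ν| * τ + √(B τ lam ν)) / (κ * √(B τ lam ν)) := by
  have hb := sqrt_pos.2 hB
  have hk := sqrt_pos.2 hκ
  rw [w₃₃, α₁_eq hτ hB, rpow_three_halves hκ]
  conv_lhs => rw [← sq_sqrt_B hB, sqrt_sq hb.le]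
  field_simp
  norm_num

lemma w₁₁_pos (hκ : 0 < κ) (hτ : 0 < τ) (hB : 0 < B τ lam ν) (hc : 0 < lam + ν ^ 2) :
    0 < w₁₁ κ τ lam ν := by
  have hb := sqrt_pos.2 hB
  have := sqrt_B_lt hτ hB hc
  rw [w₁₁_eq hκ hτ hB]
  have : 0 < |ν| * τ - √(B τ lam ν) := by linarith
  positivity

lemma neg_w₃₃_pos (hκ : 0 < κ) (hτ : 0 < τ) (hB : 0 < B τ lam ν) :
    0 < -w₃₃ κ τ lam ν := by
  have hb := sqrt_pos.2 hB
  rw [w₃₃_eq hκ hτ hB]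
  positivity

lemma w₁₁_add_w₃₃ (hκ : 0 < κ) (hτ : 0 < τ) (hB : 0 < B τ lam ν) :
    w₁₁ κ τ lam ν - -w₃₃ κ τ lam ν = -(4 / κ) := by
  have hb := sqrt_pos.2 hB
  rw [w₃₃_eq hκ hτ hB, w₁₁_eq hκ hτ hB]
  field_simp
  ring

lemma α₁_mul_w₁₁ : α₁ κ τ lam ν * w₁₁ κ τ lam ν = α₂ κ τ lam ν * -w₃₃ κ τ lam ν := by
  rw [w₁₁, w₃₃]; ring

lemma α₁_sub_α₂ :
    α₁ κ τ lam ν - α₂ κ τ lam ν = √κ * B τ lam ν / τ := by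
  rw [α₁, α₂]; ring

lemma α₁_add_α₂ : α₁ κ τ lam ν + α₂ κ τ lam ν = √κ * |ν| * √(B τ lam ν) := by
  rw [α₁, α₂]; ring

/-- The ratio of the two radii of the torus. -/
lemma radii_ratio (hκ : 0 < κ) (hτ : 0 < τ) (hB : 0 < B τ lam ν) (hc : 0 < lam + ν ^ 2) :
    √(lam + ν ^ 2) * √(-w₃₃ κ τ lam ν)
      = √(w₁₁ κ τ lam ν) * (|ν| * τ + √(B τ lam ν)) := by
  have hb := sqrt_pos.2 hB
  have h1 := sqrt_B_lt hτ hB hc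
  rw [← sqrt_mul hc.le, w₃₃_eq hκ hτ hB, w₁₁_eq hκ hτ hB, add_sq_eq hB]
  have hp : 0 < |ν| * τ + √(B τ lam ν) := by positivity
  conv_rhs => rw [← sqrt_sq hp.le]
  rw [← sqrt_mul (by have : 0 < |ν| * τ - √(B τ lam ν) := by linarith
                     positivity)]
  congr 1
  ring

lemma radii_mul (hκ : 0 < κ) (hτ : 0 < τ) (hB : 0 < B τ lam ν) (hc : 0 < lam + ν ^ 2) :
    √(w₁₁ κ τ lam ν) * √(-w₃₃ κ τ lam ν) = 2 * √(lam + ν ^ 2) / (κ * √(B τ lam ν)) := by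
  have hb := sqrt_pos.2 hB
  have h1 := sqrt_B_lt hτ hB hc
  have hw := w₁₁_pos hκ hτ hB hc
  have h2 := radii_ratio hκ hτ hB hc
  have hcs := sqrt_pos.2 hc
  have h3 : √(lam + ν ^ 2) * (√(w₁₁ κ τ lam ν) * √(-w₃₃ κ τ lam ν)) =
      √(lam + ν ^ 2) * (2 * √(lam + ν ^ 2) / (κ * √(B τ lam ν))) := by
    calc _ = √(w₁₁ κ τ lam ν) * (√(lam + ν ^ 2) * √(-w₃₃ κ τ lam ν)) := by ring
      _ = √(w₁₁ κ τ lam ν) ^ 2 * (|ν| * τ + √(B τ lam ν)) := by rw [h2]; ring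
      _ = 2 * √(lam + ν ^ 2) ^ 2 / (κ * √(B τ lam ν)) := by
        rw [sq_sqrt hw.le, sq_sqrt hc.le, w₁₁_eq hκ hτ hB, add_sq_eq hB]; ring
      _ = _ := by ring
  exact mul_left_cancel₀ hcs.ne' h3

lemma contDiff_γ : ContDiff ℝ ∞ (γ κ τ lam ν) := by
  rw [contDiff_pi]
  intro i
  fin_cases i <;> simp [γ] <;> fun_prop

lemma hasDerivAt_γ (hlam : lam = 1 ∨ lam = -1) (x : ℝ) : HasDerivAt (γ κ τ lam ν)
    (twistI (-lam * α₁ κ τ lam ν) (lam * α₂ κ τ lam ν) (γ κ τ lam ν x)) x := by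
  have hl := lam_sq hlam
  have hc : ∀ a, HasDerivAt (fun x => cos (a * x)) (-sin (a * x) * a) x := fun a => by
    simpa using ((hasDerivAt_id x).const_mul a).cos
  have hs : ∀ a, HasDerivAt (fun x => sin (a * x)) (cos (a * x) * a) x := fun a => by
    simpa using ((hasDerivAt_id x).const_mul a).sin
  rw [hasDerivAt_pi]
  intro i
  fin_cases i
  · refine ((hc (α₁ κ τ lam ν)).const_mul (√(w₁₁ κ τ lam ν))).congr_deriv ?_
    simp [twistI, γ]
    linear_combination (-√(w₁₁ κ τ lam ν) * sin (α₁ κ τ lam ν * x) * α₁ κ τ lam ν) * hl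
  · refine ((hs (α₁ κ τ lam ν)).const_mul (-lam * √(w₁₁ κ τ lam ν))).congr_deriv ?_
    simp [twistI, γ]
    ring
  · refine ((hc (α₂ κ τ lam ν)).const_mul (√(-w₃₃ κ τ lam ν))).congr_deriv ?_
    simp [twistI, γ]
    linear_combination (-√(-w₃₃ κ τ lam ν) * sin (α₂ κ τ lam ν * x) * α₂ κ τ lam ν) * hl
  · refine ((hs (α₂ κ τ lam ν)).const_mul (lam * √(-w₃₃ κ τ lam ν))).congr_deriv ?_
    simp [twistI, γ]
    ring

lemma γ_sq₁ (hlam : lam = 1 ∨ lam = -1) (hw : 0 < w₁₁ κ τ lam ν) (x : ℝ) :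
    γ κ τ lam ν x 0 ^ 2 + γ κ τ lam ν x 1 ^ 2 = w₁₁ κ τ lam ν := by
  have hl := lam_sq hlam
  have h := sq_sqrt hw.le
  simp only [γ, Matrix.cons_val]
  linear_combination h + √(w₁₁ κ τ lam ν) ^ 2 * sin (α₁ κ τ lam ν * x) ^ 2 * hl
    + √(w₁₁ κ τ lam ν) ^ 2 * sin_sq_add_cos_sq (α₁ κ τ lam ν * x)

lemma γ_sq₂ (hlam : lam = 1 ∨ lam = -1) (hw : 0 < -w₃₃ κ τ lam ν) (x : ℝ) :
    γ κ τ lam ν x 2 ^ 2 + γ κ τ lam ν x 3 ^ 2 = -w₃₃ κ τ lam ν := by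
  have hl := lam_sq hlam
  have h := sq_sqrt hw.le
  simp only [γ, Matrix.cons_val]
  linear_combination h + √(-w₃₃ κ τ lam ν) ^ 2 * sin (α₂ κ τ lam ν * x) ^ 2 * hl
    + √(-w₃₃ κ τ lam ν) ^ 2 * sin_sq_add_cos_sq (α₂ κ τ lam ν * x)

lemma ip_γ (hκ : 0 < κ) (hτ : 0 < τ) (hlam : lam = 1 ∨ lam = -1) (hB : 0 < B τ lam ν)
    (hc : 0 < lam + ν ^ 2) (x : ℝ) : ip (γ κ τ lam ν x) (γ κ τ lam ν x) = -(4 / κ) := by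
  have h1 := γ_sq₁ hlam (w₁₁_pos hκ hτ hB hc) x
  have h2 := γ_sq₂ hlam (neg_w₃₃_pos hκ hτ hB) x
  simp only [ip]
  linear_combination h1 - h2 + w₁₁_add_w₃₃ hκ hτ hB

/-- The linear equation satisfied by `γ`, with the angle `φ = -(λ√κB/τ) x`: its velocity in the
frame `E₁, E₂, E₃` has a constant first component, and the other two rotate uniformly. -/
lemma γ_ode (hκ : 0 < κ) (hτ : 0 < τ) (hlam : lam = 1 ∨ lam = -1) (hB : 0 < B τ lam ν)
    (hc : 0 < lam + ν ^ 2) (x : ℝ) :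
    twistI (-lam * α₁ κ τ lam ν) (lam * α₂ κ τ lam ν) (γ κ τ lam ν x) =
      (√κ / 2 * lam * (lam + ν ^ 2) / τ) • (J1 *ᵥ γ κ τ lam ν x)
      - (√κ / 2 * lam * |ν| * √(lam + ν ^ 2)) •
        (-sin (-(lam * √κ * B τ lam ν / τ) * x) • (J2 *ᵥ γ κ τ lam ν x)
          + cos (-(lam * √κ * B τ lam ν / τ) * x) • (J3 *ᵥ γ κ τ lam ν x)) := by
  have hl := lam_sq hlam
  have hb := sqrt_pos.2 hB
  have e1 : -(lam * √κ * B τ lam ν / τ) * x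
      = lam * (α₂ κ τ lam ν * x - α₁ κ τ lam ν * x) := by
    linear_combination lam * x * α₁_sub_α₂ (κ := κ) (τ := τ) (lam := lam) (ν := ν)
  have hsin : sin (-(lam * √κ * B τ lam ν / τ) * x)
      = lam * (sin (α₂ κ τ lam ν * x) * cos (α₁ κ τ lam ν * x)
        - cos (α₂ κ τ lam ν * x) * sin (α₁ κ τ lam ν * x)) := by
    rw [e1, ← sin_sub]
    rcases hlam with h | h
    · rw [h, one_mul, one_mul]
    · rw [h, neg_one_mul, sin_neg, neg_one_mul]
  have hcos : cos (-(lam * √κ * B τ lam ν / τ) * x)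
      = cos (α₂ κ τ lam ν * x) * cos (α₁ κ τ lam ν * x)
        + sin (α₂ κ τ lam ν * x) * sin (α₁ κ τ lam ν * x) := by
    rw [e1, ← cos_sub]
    rcases hlam with h | h
    · rw [h, one_mul]
    · rw [h, neg_one_mul, cos_neg]
  rw [hsin, hcos]
  have hR := radii_ratio hκ hτ hB hc
  have hr : √(lam + ν ^ 2) * √(w₁₁ κ τ lam ν)
      = √(-w₃₃ κ τ lam ν) * (|ν| * τ - √(B τ lam ν)) := by
    have h0 : |ν| * τ + √(B τ lam ν) ≠ 0 := by positivity
    apply mul_right_cancel₀ h0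
    have h3 := sq_sqrt hc.le
    linear_combination -√(lam + ν ^ 2) * hR + √(-w₃₃ κ τ lam ν) * h3
      + √(-w₃₃ κ τ lam ν) * add_sq_eq hB
  have hk1 : α₁ κ τ lam ν + √κ / 2 * (lam + ν ^ 2) / τ
      = √κ / 2 * |ν| * (|ν| * τ + √(B τ lam ν)) := by
    rw [α₁_eq hτ hB, add_sq_eq hB]
    field_simp
    ring
  have hk2 : √κ / 2 * (lam + ν ^ 2) / τ - α₂ κ τ lam ν
      = √κ / 2 * |ν| * (|ν| * τ - √(B τ lam ν)) := by
    rw [α₂_eq hτ hB, add_sq_eq hB]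
    field_simp
    ring
  have e2 : (α₁ κ τ lam ν + √κ / 2 * (lam + ν ^ 2) / τ) * √(w₁₁ κ τ lam ν)
      = √κ / 2 * |ν| * √(lam + ν ^ 2) * √(-w₃₃ κ τ lam ν) := by
    linear_combination √(w₁₁ κ τ lam ν) * hk1 - √κ / 2 * |ν| * hR
  have e3 : (√κ / 2 * (lam + ν ^ 2) / τ - α₂ κ τ lam ν) * √(-w₃₃ κ τ lam ν)
      = √κ / 2 * |ν| * √(lam + ν ^ 2) * √(w₁₁ κ τ lam ν) := by
    linear_combination √(-w₃₃ κ τ lam ν) * hk2 - √κ / 2 * |ν| * hr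
  have sq₁ := sin_sq_add_cos_sq (α₁ κ τ lam ν * x)
  have sq₂ := sin_sq_add_cos_sq (α₂ κ τ lam ν * x)
  rw [show √κ / 2 * lam * |ν| * √(lam + ν ^ 2)
    = lam * (√κ / 2 * |ν| * √(lam + ν ^ 2)) by ring]
  rw [show √κ / 2 * lam * (lam + ν ^ 2) / τ = lam * (√κ / 2 * (lam + ν ^ 2) / τ) by ring]
  simp only [J1_mulVec, J2_mulVec, J3_mulVec]
  generalize √κ / 2 * |ν| * √(lam + ν ^ 2) = Q at *
  generalize √κ / 2 * (lam + ν ^ 2) / τ = D at *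
  simp only [γ]
  clear hsin hcos e1 hR hr hk1 hk2
  generalize sin (α₁ κ τ lam ν * x) = S₁ at *
  generalize sin (α₂ κ τ lam ν * x) = S₂ at *
  generalize cos (α₁ κ τ lam ν * x) = C₁ at *
  generalize cos (α₂ κ τ lam ν * x) = C₂ at *
  generalize √(w₁₁ κ τ lam ν) = r at *
  generalize √(-w₃₃ κ τ lam ν) = R at *
  generalize α₁ κ τ lam ν = a₁ at *
  generalize α₂ κ τ lam ν = a₂ at *
  clear hB hc hb hl
  rcases hlam with rfl | rfl <;> ext i <;> fin_cases i <;> simp [twistI]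
  · linear_combination -S₁ * e2 + Q * R * S₁ * sq₂
  · linear_combination -C₁ * e2 + Q * R * C₁ * sq₂
  · linear_combination S₂ * e3 - Q * r * S₂ * sq₁
  · linear_combination -C₂ * e3 + Q * r * C₂ * sq₁
  · linear_combination -S₁ * e2 + Q * R * S₁ * sq₂
  · linear_combination C₁ * e2 - Q * R * C₁ * sq₂
  · linear_combination S₂ * e3 - Q * r * S₂ * sq₁
  · linear_combination C₂ * e3 - Q * r * C₂ * sq₁

/-! ### The Lorentz torus -/

lemma hasFDerivAt_torusMap (r R : ℝ) (θ : ℝ × ℝ) :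
    ∃ L : ℝ × ℝ →L[ℝ] Fin 4 → ℝ, HasFDerivAt (torusMap r R) L θ ∧ ∀ v,
      L v = twistI v.1 v.2 (torusMap r R θ) := by
  have h1 := (hasFDerivAt_fst (𝕜 := ℝ) (p := θ))
  have h2 := (hasFDerivAt_snd (𝕜 := ℝ) (p := θ))
  refine ⟨ContinuousLinearMap.pi ![r • (-sin θ.1) • ContinuousLinearMap.fst ℝ ℝ ℝ,
    r • cos θ.1 • ContinuousLinearMap.fst ℝ ℝ ℝ,
    R • (-sin θ.2) • ContinuousLinearMap.snd ℝ ℝ ℝ,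
    R • cos θ.2 • ContinuousLinearMap.snd ℝ ℝ ℝ], ?_, ?_⟩
  · rw [hasFDerivAt_pi]
    intro i
    fin_cases i
    · exact h1.cos.const_mul r
    · exact h1.sin.const_mul r
    · exact h2.cos.const_mul R
    · exact h2.sin.const_mul R
  · intro v
    ext i
    fin_cases i <;> simp [twistI, torusMap] <;> ring

/-- In the angular coordinates the torus metric has constant coefficients. -/
lemma torusMetric_eq (hκ : 0 < κ) (r R : ℝ) (θ v w : ℝ × ℝ) :
    torusMetric κ τ r R θ v w = r ^ 2 * v.1 * w.1 - R ^ 2 * v.2 * w.2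
      + (1 - τ ^ 2) * (κ / 4) * (r ^ 2 * v.1 - R ^ 2 * v.2) * (r ^ 2 * w.1 - R ^ 2 * w.2) := by
  obtain ⟨L, hL, hLv⟩ := hasFDerivAt_torusMap r R θ
  have s1 := sin_sq_add_cos_sq θ.1
  have s2 := sin_sq_add_cos_sq θ.2
  have key : ∀ a b : ℝ × ℝ, ip (twistI a.1 a.2 (torusMap r R θ)) (twistI b.1 b.2 (torusMap r R θ))
      = r ^ 2 * a.1 * b.1 - R ^ 2 * a.2 * b.2 := by
    intro a b
    simp [ip, twistI, torusMap]
    linear_combination (r ^ 2 * a.1 * b.1) * s1 - (R ^ 2 * a.2 * b.2) * s2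
  have hX : X1 κ (torusMap r R θ)
      = (√κ / 2) • twistI 1 1 (torusMap r R θ) := by
    rw [X1, J1_mulVec]
    simp [twistI]
  rw [torusMetric, hL.fderiv, hLv, hLv, gBerger, key, hX, ip_smul_right, ip_smul_right,
    key v (1, 1), key w (1, 1), ← sq_half_sqrt hκ]
  ring

/-- `γ` is a twisted geodesic: in the angular coordinates the metric of the torus is constant and
`γ` is a line. -/
theorem isTwistedGeodesic_γ (hκ : 0 < κ) (hτ : 0 < τ) (hlam : lam = 1 ∨ lam = -1)
    (hB : 0 < B τ lam ν) (hc : 0 < lam + ν ^ 2) :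
    IsTwistedGeodesicOfLorentzTorus κ τ (√(w₁₁ κ τ lam ν)) (√(-w₃₃ κ τ lam ν))
      (γ κ τ lam ν) := by
  have hw1 := w₁₁_pos hκ hτ hB hc
  have hw3 := neg_w₃₃_pos hκ hτ hB
  have hsum := w₁₁_add_w₃₃ hκ hτ hB
  have hl0 : lam ≠ 0 := by rcases hlam with h | h <;> simp [h]
  have hb := sqrt_pos.2 hB
  have hk := sqrt_pos.2 hκ
  have ha1 : α₁ κ τ lam ν ≠ 0 := by rw [α₁_eq hτ hB]; positivity
  have ha2 : α₂ κ τ lam ν ≠ 0 := by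
    have := sqrt_B_lt hτ hB hc
    have : 0 < |ν| * τ - √(B τ lam ν) := by linarith
    rw [α₂_eq hτ hB]; positivity
  refine ⟨sqrt_pos.2 hw1, sqrt_pos.2 hw3, ?_, ?_, ?_⟩
  · rintro q ⟨h1, h2⟩
    rw [sq_sqrt hw1.le] at h1
    rw [sq_sqrt hw3.le] at h2
    simp only [AdS, mem_ofPred_eq, ip]
    linear_combination h1 - h2 + hsum
  · intro θ
    simp only [torusMetric_eq hκ, sq_sqrt hw1.le, sq_sqrt hw3.le]
    have : 0 < w₁₁ κ τ lam ν * -w₃₃ κ τ lam ν * τ ^ 2 := by positivity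
    refine lt_of_eq_of_lt ?_ (neg_lt_zero.2 this)
    have h3 : κ / 4 * (w₁₁ κ τ lam ν - -w₃₃ κ τ lam ν) = -1 := by
      rw [hsum]; field_simp
    linear_combination (w₁₁ κ τ lam ν * w₃₃ κ τ lam ν * (1 - τ ^ 2)) * h3
  · refine ⟨fun x => (-lam * α₁ κ τ lam ν * x, lam * α₂ κ τ lam ν * x), ⟨by fun_prop, ?_⟩, ?_, ?_⟩
    · intro t w
      have hd : deriv (fun x : ℝ => (-lam * α₁ κ τ lam ν * x, lam * α₂ κ τ lam ν * x))
          = fun _ => (-lam * α₁ κ τ lam ν, lam * α₂ κ τ lam ν) := by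
        funext s
        apply HasDerivAt.deriv
        apply HasDerivAt.prodMk
        · exact hasDerivAt_const_mul (-lam * α₁ κ τ lam ν)
        · exact hasDerivAt_const_mul (lam * α₂ κ τ lam ν)
      simp only [hd, torusMetric_eq hκ]
      simp
    · intro x
      rw [γ, torusMap]
      rcases hlam with h | h <;> simp [h]
    · intro x
      have hd : HasDerivAt (fun x : ℝ => (-lam * α₁ κ τ lam ν * x, lam * α₂ κ τ lam ν * x))
          (-lam * α₁ κ τ lam ν, lam * α₂ κ τ lam ν) x := by
        apply HasDerivAt.prodMk
        · exact hasDerivAt_const_mul (-lam * α₁ κ τ lam ν)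
        · exact hasDerivAt_const_mul (lam * α₂ κ τ lam ν)
      rw [hd.deriv]
      exact ⟨mul_ne_zero (neg_ne_zero.2 hl0) ha1, mul_ne_zero hl0 ha2⟩

/-! ### Calculus of the bilinear maps -/

/-- `ip` as a continuous bilinear map. -/
def ipL : (Fin 4 → ℝ) →L[ℝ] (Fin 4 → ℝ) →L[ℝ] ℝ :=
  (LinearMap.mk₂ ℝ ip ip_add_left ip_smul_left (fun u v w => ip_add_right v w u)
    (fun a u v => ip_smul_right a v u)).toContinuousBilinearMap

lemma ipL_apply (v w : Fin 4 → ℝ) : ipL v w = ip v w := rfl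

/-- `act` as a continuous bilinear map. -/
def actL : (Fin 4 → ℝ) →L[ℝ] (Fin 4 → ℝ) →L[ℝ] (Fin 4 → ℝ) :=
  (LinearMap.mk₂ ℝ act act_add_left act_smul_left act_add_right
    act_smul_right).toContinuousBilinearMap

lemma actL_apply (v w : Fin 4 → ℝ) : actL v w = act v w := rfl

/-- `rot ξ` as a continuous linear map. -/
def rotL (ξ : ℝ) : (Fin 4 → ℝ) →L[ℝ] (Fin 4 → ℝ) :=
  LinearMap.toContinuousLinearMap
    { toFun := rot ξ
      map_add' := fun v w => by ext i; fin_cases i <;> simp [rot] <;> ring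
      map_smul' := fun a v => by ext i; fin_cases i <;> simp [rot] <;> ring }

lemma rotL_apply (ξ : ℝ) (v : Fin 4 → ℝ) : rotL ξ v = rot ξ v := rfl

/-- Multiplication by a matrix as a continuous linear map. -/
def mulVecL (A : Matrix (Fin 4) (Fin 4) ℝ) : (Fin 4 → ℝ) →L[ℝ] (Fin 4 → ℝ) :=
  LinearMap.toContinuousLinearMap A.mulVecLin

lemma mulVecL_apply (A : Matrix (Fin 4) (Fin 4) ℝ) (v : Fin 4 → ℝ) :
    mulVecL A v = A *ᵥ v := rfl

section calculus

variable {E : Type*} [NormedAddCommGroup E] [NormedSpace ℝ E]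
  {f g : E → Fin 4 → ℝ} {f' g' : E →L[ℝ] Fin 4 → ℝ} {z : E} {s : Set E}

lemma exists_hasFDerivAt_ip (hf : HasFDerivAt f f' z) (hg : HasFDerivAt g g' z) :
    ∃ L : E →L[ℝ] ℝ, HasFDerivAt (fun z => ip (f z) (g z)) L z ∧
      ∀ v, L v = ip (f z) (g' v) + ip (f' v) (g z) :=
  ⟨_, ipL.hasFDerivAt_of_bilinear hf hg, fun v => by simp [ipL_apply]⟩

lemma exists_hasFDerivAt_act (hf : HasFDerivAt f f' z) (hg : HasFDerivAt g g' z) :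
    ∃ L : E →L[ℝ] Fin 4 → ℝ, HasFDerivAt (fun z => act (f z) (g z)) L z ∧
      ∀ v, L v = act (f z) (g' v) + act (f' v) (g z) :=
  ⟨_, actL.hasFDerivAt_of_bilinear hf hg, fun v => by simp [actL_apply]⟩

lemma hasFDerivAt_mulVec (A : Matrix (Fin 4) (Fin 4) ℝ) (hf : HasFDerivAt f f' z) :
    HasFDerivAt (fun z => A *ᵥ f z) ((mulVecL A).comp f') z :=
  (mulVecL A).hasFDerivAt.comp z hf

lemma contDiffOn_ip (hf : ContDiffOn ℝ ∞ f s) (hg : ContDiffOn ℝ ∞ g s) :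
    ContDiffOn ℝ ∞ (fun z => ip (f z) (g z)) s :=
  (ipL.contDiff.comp_contDiffOn hf).clm_apply hg

lemma contDiffOn_act (hf : ContDiffOn ℝ ∞ f s) (hg : ContDiffOn ℝ ∞ g s) :
    ContDiffOn ℝ ∞ (fun z => act (f z) (g z)) s :=
  (actL.contDiff.comp_contDiffOn hf).clm_apply hg

lemma contDiffOn_mulVec (A : Matrix (Fin 4) (Fin 4) ℝ) (hf : ContDiffOn ℝ ∞ f s) :
    ContDiffOn ℝ ∞ (fun z => A *ᵥ f z) s :=
  (mulVecL A).contDiff.comp_contDiffOn hf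

end calculus

/-- The partial derivatives of `A(y) γ(x)`, where `A(y)` has the first row `r(y)`. -/
lemma exists_hasFDerivAt_act_γ (hlam : lam = 1 ∨ lam = -1) {r : ℝ → Fin 4 → ℝ} {r' : Fin 4 → ℝ}
    {z : ℝ × ℝ} (hr : HasDerivAt r r' z.2) :
    ∃ L : ℝ × ℝ →L[ℝ] Fin 4 → ℝ,
      HasFDerivAt (fun z : ℝ × ℝ => act (r z.2) (γ κ τ lam ν z.1)) L z ∧
      ∀ v, L v = v.1 • act (r z.2) (twistI (-lam * α₁ κ τ lam ν) (lam * α₂ κ τ lam ν)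
        (γ κ τ lam ν z.1)) + v.2 • act r' (γ κ τ lam ν z.1) := by
  have h1 : HasFDerivAt (fun z : ℝ × ℝ => r z.2) _ z :=
    hr.hasFDerivAt.comp z (hasFDerivAt_snd (𝕜 := ℝ))
  have h2 : HasFDerivAt (fun z : ℝ × ℝ => γ κ τ lam ν z.1) _ z :=
    (hasDerivAt_γ hlam z.1).hasFDerivAt.comp z (hasFDerivAt_fst (𝕜 := ℝ))
  obtain ⟨L, hL, hLv⟩ := exists_hasFDerivAt_act h1 h2
  refine ⟨L, hL, fun v => ?_⟩
  rw [hLv]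
  simp [act_smul_left, act_smul_right]

/-! ### The metric along the surfaces `A(y) γ(x)` -/

lemma gBerger_E1 (hκ : 0 < κ) (hτ : 0 < τ) {q : Fin 4 → ℝ} (hq : q ∈ AdS κ) (v : Fin 4 → ℝ) :
    gBerger κ τ q v (E1 κ τ q) = τ * (√κ / 2) * ip v (J1 *ᵥ q) := by
  have h1 : ip q q = -(4 / κ) := hq
  have h2 : (√κ / 2) ^ 2 * ip q q = -1 := by rw [sq_half_sqrt hκ, h1]; field_simp
  simp only [gBerger, E1, X1, ip_smul_left, ip_smul_right, ip_J1_J1]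
  field_simp at h2 ⊢
  linear_combination ip v (J1 *ᵥ q) * (1 - τ ^ 2) * h2

lemma gBerger_comm (q v w : Fin 4 → ℝ) : gBerger κ τ q v w = gBerger κ τ q w v := by
  simp only [gBerger, ip_comm v w]; ring

lemma gBerger_smul_left (q v w : Fin 4 → ℝ) (a : ℝ) :
    gBerger κ τ q (a • v) w = a * gBerger κ τ q v w := by
  simp only [gBerger, ip_smul_left]; ring

lemma gBerger_sub_left (q u v w : Fin 4 → ℝ) :
    gBerger κ τ q (u - v) w = gBerger κ τ q u w - gBerger κ τ q v w := by
  simp only [gBerger, ip_sub_left]; ring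

lemma gBerger_smul_right (q v w : Fin 4 → ℝ) (a : ℝ) :
    gBerger κ τ q v (a • w) = a * gBerger κ τ q v w := by
  simp only [gBerger, ip_smul_right]; simp only [ip_smul_left]; ring

lemma gBerger_sub_right (q u v w : Fin 4 → ℝ) :
    gBerger κ τ q w (u - v) = gBerger κ τ q w u - gBerger κ τ q w v := by
  simp only [gBerger, ip_sub_right]; simp only [ip_sub_left]; ring

lemma gBerger_add_right (q u v w : Fin 4 → ℝ) :
    gBerger κ τ q w (u + v) = gBerger κ τ q w u + gBerger κ τ q w v := by
  simp only [gBerger, ip_add_right]; simp only [ip_add_left]; ring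

lemma gBerger_rot (ξ : ℝ) (q v w : Fin 4 → ℝ) :
    gBerger κ τ (rot ξ q) (rot ξ v) (rot ξ w) = gBerger κ τ q v w := by
  simp only [gBerger, X1, J1_rot, ip_smul_right, ip_rot_rot]

lemma gBerger_act {r : Fin 4 → ℝ} (hr : ip r r = 1) (q v w : Fin 4 → ℝ) :
    gBerger κ τ (act r q) (act r v) (act r w) = gBerger κ τ q v w := by
  simp only [gBerger, X1, ← act_J1, ip_smul_right, ip_act_act, hr, one_mul]

lemma E1_rot (ξ : ℝ) (q : Fin 4 → ℝ) : E1 κ τ (rot ξ q) = rot ξ (E1 κ τ q) := by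
  simp only [E1, X1, J1_rot]
  simp only [← rotL_apply, map_smul]

lemma E1_act (r q : Fin 4 → ℝ) : E1 κ τ (act r q) = act r (E1 κ τ q) := by
  simp only [E1, X1, ← act_J1, act_smul_right]

section velocity

variable (hκ : 0 < κ) (hτ : 0 < τ) (hlam : lam = 1 ∨ lam = -1) (hB : 0 < B τ lam ν)
  (hc : 0 < lam + ν ^ 2)

include hκ hτ hlam hB hc

lemma γ_mem_AdS (x : ℝ) : γ κ τ lam ν x ∈ AdS κ := ip_γ hκ hτ hlam hB hc x

lemma ip_twist_J1_γ (x : ℝ) :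
    √κ / 2 * ip (twistI (-lam * α₁ κ τ lam ν) (lam * α₂ κ τ lam ν) (γ κ τ lam ν x))
      (J1 *ᵥ γ κ τ lam ν x) = -(lam * (lam + ν ^ 2) / τ) := by
  have h2 : (√κ / 2) ^ 2 * ip (γ κ τ lam ν x) (γ κ τ lam ν x) = -1 := by
    rw [sq_half_sqrt hκ, ip_γ hκ hτ hlam hB hc]; field_simp
  rw [γ_ode hκ hτ hlam hB hc]
  simp only [ip_sub_left, ip_smul_left, ip_add_left, ip_J1_J1, ip_comm (J2 *ᵥ _) (J1 *ᵥ _),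
    ip_comm (J3 *ᵥ _) (J1 *ᵥ _), ip_J1_J2, ip_J1_J3]
  linear_combination (lam * (lam + ν ^ 2) / τ) * h2

lemma gBerger_E1_γ (x : ℝ) :
    gBerger κ τ (γ κ τ lam ν x) (E1 κ τ (γ κ τ lam ν x)) (E1 κ τ (γ κ τ lam ν x)) = -1 := by
  have h2 : (√κ / 2) ^ 2 * ip (γ κ τ lam ν x) (γ κ τ lam ν x) = -1 := by
    rw [sq_half_sqrt hκ, ip_γ hκ hτ hlam hB hc]; field_simp
  rw [gBerger_E1 hκ hτ (γ_mem_AdS hκ hτ hlam hB hc x)]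
  simp only [E1, X1, ip_smul_left, ip_J1_J1]
  field_simp at h2 ⊢
  linear_combination h2

lemma gBerger_twist_E1_γ (x : ℝ) :
    gBerger κ τ (γ κ τ lam ν x)
      (twistI (-lam * α₁ κ τ lam ν) (lam * α₂ κ τ lam ν) (γ κ τ lam ν x))
      (E1 κ τ (γ κ τ lam ν x)) = -(lam * (lam + ν ^ 2)) := by
  rw [gBerger_E1 hκ hτ (γ_mem_AdS hκ hτ hlam hB hc x), mul_assoc,
    ip_twist_J1_γ hκ hτ hlam hB hc]
  field_simp

lemma gBerger_twist_twist_γ (x : ℝ) :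
    gBerger κ τ (γ κ τ lam ν x)
      (twistI (-lam * α₁ κ τ lam ν) (lam * α₂ κ τ lam ν) (γ κ τ lam ν x))
      (twistI (-lam * α₁ κ τ lam ν) (lam * α₂ κ τ lam ν) (γ κ τ lam ν x))
      = -(lam * (lam + ν ^ 2)) := by
  have hl := lam_sq hlam
  have h2 : (√κ / 2) ^ 2 * ip (γ κ τ lam ν x) (γ κ τ lam ν x) = -1 := by
    rw [sq_half_sqrt hκ, ip_γ hκ hτ hlam hB hc]; field_simp
  have h3 := ip_twist_J1_γ hκ hτ hlam hB hc x
  rw [gBerger, X1, ip_smul_right, h3, γ_ode hκ hτ hlam hB hc]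
  simp only [ip_sub_left, ip_smul_left, ip_add_left, ip_sub_right, ip_smul_right, ip_add_right,
    ip_J1_J1, ip_J2_J2, ip_J3_J3, ip_comm (J2 *ᵥ _) (J1 *ᵥ _), ip_comm (J3 *ᵥ _) (J1 *ᵥ _),
    ip_comm (J3 *ᵥ _) (J2 *ᵥ _), ip_J1_J2, ip_J1_J3, ip_J2_J3]
  have h4 := sin_sq_add_cos_sq (-(lam * √κ * B τ lam ν / τ) * x)
  have h5 := sq_sqrt hc.le
  have h6 := sq_abs ν
  generalize sin (-(lam * √κ * B τ lam ν / τ) * x) = S at *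
  generalize cos (-(lam * √κ * B τ lam ν / τ) * x) = C at *
  generalize √(lam + ν ^ 2) = c at *
  generalize |ν| = m at *
  generalize ip (γ κ τ lam ν x) (γ κ τ lam ν x) = G at *
  generalize √κ / 2 = k at *
  have h7 : lam ^ 2 * (lam + ν ^ 2) ^ 2 / τ ^ 2 * (k ^ 2 * G)
      - k ^ 2 * G * lam ^ 2 * m ^ 2 * c ^ 2 * (S ^ 2 + C ^ 2)
      + (1 - τ ^ 2) * (lam * (lam + ν ^ 2) / τ) ^ 2 = -(lam * (lam + ν ^ 2)) := by
    rw [h2, h4, h5, h6, hl]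
    rcases hlam with rfl | rfl <;> field_simp <;> ring
  linear_combination h7

/-- The field `E₁ - γ'` pairs with the velocity of the family of matrices to a multiple of the
form `cosh² ξ₁ ξ₂' + sinh² ξ₁ ξ₃'`: the two contributions of the off-diagonal part of `A⁻¹A'`
cancel, because of the choice of the frequencies `α₁, α₂`. -/
lemma gBerger_normal_velocity {r : Fin 4 → ℝ} (hr : ip r r = 1) (r' : Fin 4 → ℝ) (x : ℝ) :
    gBerger κ τ (act r (γ κ τ lam ν x))
      (E1 κ τ (act r (γ κ τ lam ν x))
        - act r (twistI (-lam * α₁ κ τ lam ν) (lam * α₂ κ τ lam ν) (γ κ τ lam ν x)))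
      (act r' (γ κ τ lam ν x))
      = -(√κ / 2 * lam * B τ lam ν / τ) * (w₁₁ κ τ lam ν + -w₃₃ κ τ lam ν) * angSpeed r r' := by
  have hl := lam_sq hlam
  have hq : act r (γ κ τ lam ν x) ∈ AdS κ := by
    simpa [AdS, ip_act_act, hr] using ip_γ hκ hτ hlam hB hc x
  have h3 := ip_twist_J1_γ hκ hτ hlam hB hc x
  have g1 := γ_sq₁ hlam (w₁₁_pos hκ hτ hB hc) x
  have g2 := γ_sq₂ hlam (neg_w₃₃_pos hκ hτ hB) x
  have i1 := ip_act_twistI r r' (γ κ τ lam ν x) (-lam * α₁ κ τ lam ν) (lam * α₂ κ τ lam ν)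
  have i2 := ip_act_twistI r r' (γ κ τ lam ν x) 1 1
  have hJ : twistI 1 1 (γ κ τ lam ν x) = J1 *ᵥ γ κ τ lam ν x := by
    rw [J1_mulVec]; simp [twistI]
  rw [hJ] at i2
  rw [g1, g2] at i1 i2
  have hB' : B τ lam ν = ν ^ 2 * (τ ^ 2 - 1) - lam := rfl
  rw [gBerger_sub_left, gBerger_comm, gBerger_E1 hκ hτ hq, gBerger, X1, ip_smul_right,
    ip_smul_right, ← act_J1, ip_act_act, hr, one_mul, h3, ip_comm _ (act r' _), i1, i2]
  have e1 := α₁_mul_w₁₁ (κ := κ) (τ := τ) (lam := lam) (ν := ν)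
  have e2 := α₁_sub_α₂ (κ := κ) (τ := τ) (lam := lam) (ν := ν)
  generalize offRe r r' * (γ κ τ lam ν x 3 * γ κ τ lam ν x 0 - γ κ τ lam ν x 2 * γ κ τ lam ν x 1)
        + offIm r r' * (γ κ τ lam ν x 2 * γ κ τ lam ν x 0 + γ κ τ lam ν x 3 * γ κ τ lam ν x 1)
        = W
  generalize w₁₁ κ τ lam ν = R₁ at *
  generalize w₃₃ κ τ lam ν = R₃ at *
  have e3 : α₁ κ τ lam ν = α₂ κ τ lam ν + √κ * B τ lam ν / τ := by linear_combination e2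
  generalize α₂ κ τ lam ν = a₂ at *
  have e4 : τ + (1 - τ ^ 2) * (lam * (lam + ν ^ 2) / τ) = -(lam * B τ lam ν / τ) := by
    rw [hB']; field_simp; linear_combination -τ ^ 2 * hl
  linear_combination (√κ / 2 * (angSpeed r r' * (R₁ + -R₃) + 2 * W)) * e4
    + lam * angSpeed r r' * e1 + lam * W * e3

end velocity

/-! ### The surfaces `A(y) γ(x)` are helix surfaces -/

lemma hasDerivAt_row1 {ξ₁ ξ₂ ξ₃ : ℝ → ℝ} {a b c y : ℝ} (h₁ : HasDerivAt ξ₁ a y)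
    (h₂ : HasDerivAt ξ₂ b y) (h₃ : HasDerivAt ξ₃ c y) :
    ∃ r' : Fin 4 → ℝ, HasDerivAt (fun y => row1 (ξ₁ y) (ξ₂ y) (ξ₃ y)) r' y ∧
      angSpeed (row1 (ξ₁ y) (ξ₂ y) (ξ₃ y)) r' = cosh (ξ₁ y) ^ 2 * b + sinh (ξ₁ y) ^ 2 * c := by
  refine ⟨![sinh (ξ₁ y) * a * cos (ξ₂ y) + cosh (ξ₁ y) * (-sin (ξ₂ y) * b),
    -(sinh (ξ₁ y) * a * sin (ξ₂ y) + cosh (ξ₁ y) * (cos (ξ₂ y) * b)),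
    cosh (ξ₁ y) * a * cos (ξ₃ y) + sinh (ξ₁ y) * (-sin (ξ₃ y) * c),
    -(cosh (ξ₁ y) * a * sin (ξ₃ y) + sinh (ξ₁ y) * (cos (ξ₃ y) * c))], ?_, ?_⟩
  · rw [hasDerivAt_pi]
    intro i
    fin_cases i
    · exact h₁.cosh.mul h₂.cos
    · exact (h₁.cosh.mul h₂.sin).neg
    · exact h₁.sinh.mul h₃.cos
    · exact (h₁.sinh.mul h₃.sin).neg
  · simp [angSpeed, row1]
    linear_combination (cosh (ξ₁ y) ^ 2 * b) * sin_sq_add_cos_sq (ξ₂ y)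
      + (sinh (ξ₁ y) ^ 2 * c) * sin_sq_add_cos_sq (ξ₃ y)

lemma contDiffOn_row1 {ξ₁ ξ₂ ξ₃ : ℝ → ℝ} {J : Set ℝ} (h₁ : ContDiffOn ℝ ∞ ξ₁ J)
    (h₂ : ContDiffOn ℝ ∞ ξ₂ J) (h₃ : ContDiffOn ℝ ∞ ξ₃ J) :
    ContDiffOn ℝ ∞ (fun y => row1 (ξ₁ y) (ξ₂ y) (ξ₃ y)) J := by
  rw [contDiffOn_pi]
  intro i
  fin_cases i
  · exact h₁.cosh.mul h₂.cos
  · exact (h₁.cosh.mul h₂.sin).neg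
  · exact h₁.sinh.mul h₃.cos
  · exact (h₁.sinh.mul h₃.sin).neg

section opens

variable {Ω : TopologicalSpace.Opens (ℝ × ℝ)}

lemma contMDiff_restrict_opens {f : ℝ × ℝ → Fin 4 → ℝ} (hf : ContDiffOn ℝ ∞ f Ω) :
    ContMDiff 𝓘(ℝ, ℝ × ℝ) 𝓘(ℝ, Fin 4 → ℝ) ∞ (fun z : Ω => f z) :=
  hf.contMDiffOn.comp_contMDiff contMDiff_subtype_val (fun z => z.2)

/-- The differential of the restriction of a map to an open set of the plane is the differential
of the map composed with an injective map. -/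
lemma exists_mfderiv_restrict_opens {f : ℝ × ℝ → Fin 4 → ℝ} {z : Ω}
    (hf : DifferentiableAt ℝ f z) :
    ∃ L : TangentSpace 𝓘(ℝ, ℝ × ℝ) z → ℝ × ℝ, Function.Injective L ∧
      ∀ v, mfderiv 𝓘(ℝ, ℝ × ℝ) 𝓘(ℝ, Fin 4 → ℝ) (fun z : Ω => f z) z v = fderiv ℝ f z (L v) := by
  classical
  have hv : MDifferentiableAt 𝓘(ℝ, ℝ × ℝ) 𝓘(ℝ, ℝ × ℝ) (Subtype.val : Ω → ℝ × ℝ) z :=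
    (contMDiff_subtype_val (n := ∞) z).mdifferentiableAt (by simp)
  refine ⟨mfderiv 𝓘(ℝ, ℝ × ℝ) 𝓘(ℝ, ℝ × ℝ) (Subtype.val : Ω → ℝ × ℝ) z, ?_, fun v => ?_⟩
  · let g : ℝ × ℝ → Ω := fun y => if h : y ∈ Ω then ⟨y, h⟩ else z
    have hg : ContMDiffAt 𝓘(ℝ, ℝ × ℝ) 𝓘(ℝ, ℝ × ℝ) ∞ g z := by
      rw [← ContMDiffAt.subtypeVal_comp_iff]
      apply contMDiffAt_id.congr_of_eventuallyEq
      filter_upwards [Ω.isOpen.mem_nhds z.2] with y hy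
      have : y ∈ Ω := hy
      simp [g, this]
    have hcomp : g ∘ (Subtype.val : Ω → ℝ × ℝ) = id := by
      funext y
      simp [g, y.2]
    have h1 := mfderiv_comp z (hg.mdifferentiableAt (by simp)) hv
    rw [hcomp, mfderiv_id] at h1
    intro u w huw
    exact (congrArg (fun A => A u) h1).trans
      ((congrArg (mfderiv 𝓘(ℝ, ℝ × ℝ) 𝓘(ℝ, ℝ × ℝ) g z) huw).trans
        (congrArg (fun A => A w) h1).symm)
  · have h1 := mfderiv_comp z (I := 𝓘(ℝ, ℝ × ℝ)) (I' := 𝓘(ℝ, ℝ × ℝ)) (I'' := 𝓘(ℝ, Fin 4 → ℝ))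
      (g := f) hf.mdifferentiableAt hv
    rw [mfderiv_eq_fderiv] at h1
    exact congrArg (fun A => A v) h1

end opens

/-- With the field `N = (E₁ - ∂ₓF) / ν`, the surface `A(y) γ(x)` has constant angle: unit length
and angle are computed on `γ`, as `A(y)` is an isometry which preserves `E₁`, and `N` is orthogonal
to `∂_yF` by `gBerger_normal_velocity` and the equation for the angles. -/
theorem exists_isHelixSurface_paramF (hκ : 0 < κ) (hτ : 0 < τ) (hlam : lam = 1 ∨ lam = -1)
    (hν : ν ≠ 0) (hB : 0 < B τ lam ν) (hc : 0 < lam + ν ^ 2)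
    {J : Set ℝ} {ξ : ℝ} {ξ₁ ξ₂ ξ₃ : ℝ → ℝ} (hJ : IsOpen J) (hξ : AdmissibleAngles J ξ₁ ξ₂ ξ₃)
    {Ω : TopologicalSpace.Opens (ℝ × ℝ)} (hΩ : (Ω : Set (ℝ × ℝ)) ⊆ univ ×ˢ J)
    (himm : ∀ z ∈ Ω, Function.Injective (fderiv ℝ (paramF κ τ lam ν ξ ξ₁ ξ₂ ξ₃) z)) :
    ∃ N : Ω → Fin 4 → ℝ, IsHelixSurface κ τ lam ν
      (fun z : Ω => paramF κ τ lam ν ξ ξ₁ ξ₂ ξ₃ z) N := by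
  set T : ℝ → Fin 4 → ℝ := fun x =>
    twistI (-lam * α₁ κ τ lam ν) (lam * α₂ κ τ lam ν) (γ κ τ lam ν x) with hT
  set r : ℝ → Fin 4 → ℝ := fun y => row1 (ξ₁ y) (ξ₂ y) (ξ₃ y) with hr
  have hrr : ∀ y, ip (r y) (r y) = 1 := fun y => ip_row1 _ _ _
  have hF : paramF κ τ lam ν ξ ξ₁ ξ₂ ξ₃ = fun z => rot ξ (act (r z.2) (γ κ τ lam ν z.1)) := by
    funext z
    rw [paramF, matA_mulVec]
  have hrs : ContDiffOn ℝ ∞ r J := contDiffOn_row1 hξ.smooth₁ hξ.smooth₂ hξ.smooth₃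
  have hmaps : MapsTo (Prod.snd : ℝ × ℝ → ℝ) Ω J := fun z hz => (hΩ hz).2
  have hFs : ContDiffOn ℝ ∞ (paramF κ τ lam ν ξ ξ₁ ξ₂ ξ₃) Ω := by
    rw [hF]
    exact (rotL ξ).contDiff.comp_contDiffOn (contDiffOn_act
      (hrs.comp contDiff_snd.contDiffOn hmaps)
      (contDiff_γ.comp contDiff_fst).contDiffOn)
  set n : ℝ × ℝ → Fin 4 → ℝ := fun z =>
    rot ξ (act (r z.2) (ν⁻¹ • (E1 κ τ (γ κ τ lam ν z.1) - T z.1))) with hn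
  have hns : ContDiffOn ℝ ∞ n Ω := by
    refine (rotL ξ).contDiff.comp_contDiffOn (contDiffOn_act
      (hrs.comp contDiff_snd.contDiffOn hmaps) ?_)
    have hd : deriv (γ κ τ lam ν) = T := funext fun x => (hasDerivAt_γ hlam x).deriv
    have hTs : ContDiff ℝ ∞ T := by
      rw [← hd]
      exact (contDiff_infty_iff_deriv.1 contDiff_γ).2
    have hE : ContDiff ℝ ∞ (fun x => E1 κ τ (γ κ τ lam ν x)) := by
      simp only [E1, X1, ← mulVecL_apply]
      exact (((mulVecL J1).contDiff.comp contDiff_γ).const_smul _).const_smul _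
    exact (((hE.sub hTs).const_smul ν⁻¹).comp contDiff_fst).contDiffOn
  have hdiff : ∀ z : Ω, ∃ r' : Fin 4 → ℝ, angSpeed (r z.1.2) r' = 0 ∧
      ∀ v, fderiv ℝ (paramF κ τ lam ν ξ ξ₁ ξ₂ ξ₃) z v
        = rot ξ (v.1 • act (r z.1.2) (T z.1.1) + v.2 • act r' (γ κ τ lam ν z.1.1)) := by
    intro z
    have hy : z.1.2 ∈ J := hmaps z.2
    have hd : ∀ {f : ℝ → ℝ}, ContDiffOn ℝ ∞ f J → HasDerivAt f (deriv f z.1.2) z.1.2 :=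
      fun hf => ((hf.contDiffAt (hJ.mem_nhds hy)).differentiableAt (by simp)).hasDerivAt
    obtain ⟨r', hr', ha⟩ := hasDerivAt_row1 (hd hξ.smooth₁) (hd hξ.smooth₂) (hd hξ.smooth₃)
    refine ⟨r', by rw [ha, hξ.eqn _ hy], fun v => ?_⟩
    obtain ⟨L, hL, hLv⟩ := exists_hasFDerivAt_act_γ (κ := κ) (τ := τ) (ν := ν) hlam hr'
    have h2 : HasFDerivAt (paramF κ τ lam ν ξ ξ₁ ξ₂ ξ₃) ((rotL ξ).comp L) z.1 := by
      rw [hF]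
      exact (rotL ξ).hasFDerivAt.comp z.1 hL
    rw [h2.fderiv, ContinuousLinearMap.comp_apply, hLv, rotL_apply]
  have hl := lam_sq hlam
  have g1 := gBerger_E1_γ hκ hτ hlam hB hc
  have g2 := gBerger_twist_E1_γ hκ hτ hlam hB hc
  have g3 := gBerger_twist_twist_γ hκ hτ hlam hB hc
  refine ⟨fun z => n z, contMDiff_restrict_opens hFs, fun z => ?_, fun z => ?_,
    contMDiff_restrict_opens hns, fun z => ?_, fun z v => ?_, fun z => ?_, fun z => ?_⟩
  · simp only [hF, AdS, mem_ofPred_eq, ip_rot_rot, ip_act_act, hrr, one_mul]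
    exact ip_γ hκ hτ hlam hB hc _
  · obtain ⟨L, hL, hLv⟩ := exists_mfderiv_restrict_opens
      ((hFs.contDiffAt (Ω.isOpen.mem_nhds z.2)).differentiableAt (by simp))
    intro u w huw
    rw [hLv, hLv] at huw
    exact hL (himm z z.2 huw)
  · simp only [hF, hn, ip_rot_rot, ip_act_act, ip_smul_left, ip_sub_left, E1, X1, ip_J1_self, hT]
    simp [twistI, ip]
    ring_nf
    simp
  · obtain ⟨L, hL, hLv⟩ := exists_mfderiv_restrict_opens
      ((hFs.contDiffAt (Ω.isOpen.mem_nhds z.2)).differentiableAt (by simp))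
    obtain ⟨r', hr0, hr'⟩ := hdiff z
    have h5 := gBerger_normal_velocity hκ hτ hlam hB hc (hrr z.1.2) r' z.1.1
    rw [hr0, mul_zero, E1_act, ← act_sub_right] at h5
    rw [hLv, hr']
    simp only [hF, hn, gBerger_rot, gBerger_add_right, gBerger_smul_right,
      act_smul_right, gBerger_smul_left, gBerger_act (hrr _)]
    rw [h5, gBerger_sub_left, gBerger_comm, g2, g3]
    ring
  · simp only [hF, hn, gBerger_rot, gBerger_act (hrr _), gBerger_smul_left, gBerger_smul_right,
      gBerger_sub_left, gBerger_sub_right]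
    rw [gBerger_comm _ (E1 κ τ _) (T _), g1, g2, g3]
    field_simp
    linear_combination hl
  · simp only [hF, hn, E1_rot, E1_act, gBerger_rot, gBerger_act (hrr _), gBerger_smul_left,
      gBerger_sub_left]
    rw [g1, g2]
    field_simp
    linear_combination (lam + ν ^ 2) * hl

/-! ### Smooth phases, division and local inverses -/

/-- A smooth planar vector which does not vanish at a point has a smooth angle nearby. -/
lemma exists_smooth_angle {E : Type*} [NormedAddCommGroup E] [NormedSpace ℝ E] {a b : E → ℝ}
    {S : Set E} {x₀ : E} (hS : IsOpen S) (hx₀ : x₀ ∈ S) (ha : ContDiffOn ℝ ∞ a S)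
    (hb : ContDiffOn ℝ ∞ b S) (h0 : a x₀ ^ 2 + b x₀ ^ 2 ≠ 0) :
    ∃ (φ : E → ℝ) (S' : Set E), IsOpen S' ∧ x₀ ∈ S' ∧ S' ⊆ S ∧ ContDiffOn ℝ ∞ φ S' ∧
      ∀ x, a x = √(a x ^ 2 + b x ^ 2) * cos (φ x) ∧ b x = √(a x ^ 2 + b x ^ 2) * sin (φ x) := by
  set f : E → ℂ := fun x => ⟨a x, b x⟩ with hf
  have hf0 : f x₀ ≠ 0 := by
    intro h
    have h1 : a x₀ = 0 := congrArg Complex.re h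
    have h2 : b x₀ = 0 := congrArg Complex.im h
    simp [h1, h2] at h0
  have hfs : ContDiffOn ℝ ∞ f S := by
    have : f = fun x => (a x : ℂ) + b x * Complex.I := by
      funext x; exact Complex.mk_eq_add_mul_I _ _
    rw [this]
    exact (Complex.ofRealCLM.contDiff.comp_contDiffOn ha).add
      ((Complex.ofRealCLM.contDiff.comp_contDiffOn hb).mul contDiffOn_const)
  set S' : Set E := S ∩ (fun x => f x / f x₀) ⁻¹' Complex.slitPlane with hS'
  have hfd : ContDiffOn ℝ ∞ (fun x => f x / f x₀) S := hfs.div_const _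
  refine ⟨fun x => Complex.arg (f x₀) + Complex.arg (f x / f x₀), S', ?_, ?_,
    inter_subset_left, ?_, ?_⟩
  · exact hfd.continuousOn.isOpen_inter_preimage hS Complex.isOpen_slitPlane
  · exact ⟨hx₀, by simp [hf0]⟩
  · refine contDiffOn_const.add ?_
    intro x hx
    have h1 : ContDiffAt ℝ ∞ Complex.log (f x / f x₀) :=
      (Complex.contDiffAt_log hx.2).restrict_scalars ℝ
    have h2 : ContDiffAt ℝ ∞ (fun z => (Complex.log z).im) (f x / f x₀) :=
      Complex.imCLM.contDiff.contDiffAt.comp _ h1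
    simp only [Complex.log_im] at h2
    exact h2.comp_contDiffWithinAt x ((hfd x hx.1).mono inter_subset_left)
  · intro x
    have hn : ‖f x‖ = √(a x ^ 2 + b x ^ 2) := by
      rw [Complex.norm_eq_sqrt_sq_add_sq]
    have hkey : f x = ‖f x‖ * Complex.exp
        ((Complex.arg (f x₀) + Complex.arg (f x / f x₀) : ℝ) * Complex.I) := by
      have h1 := Complex.norm_mul_exp_arg_mul_I (f x₀)
      have h2 := Complex.norm_mul_exp_arg_mul_I (f x / f x₀)
      rw [norm_div] at h2
      have h3 : (‖f x₀‖ : ℂ) ≠ 0 := by simpa using hf0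
      generalize Complex.arg (f x / f x₀) = θ at *
      push_cast at h2 ⊢
      rw [add_mul, Complex.exp_add]
      calc f x = f x₀ * (f x / f x₀) := by field_simp
        _ = _ := by
          rw [← h2]
          nth_rewrite 1 [← h1]
          field_simp
    rw [← hn]
    constructor
    · have := congrArg Complex.re hkey
      rw [Complex.re_ofReal_mul, Complex.exp_ofReal_mul_I_re] at this
      exact this
    · have := congrArg Complex.im hkey
      rw [Complex.im_ofReal_mul, Complex.exp_ofReal_mul_I_im] at this
      exact this

/-- The inverse function theorem for smooth maps, with the inverse smooth on the whole target. -/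
lemma exists_smooth_localInverse {E : Type*} [NormedAddCommGroup E] [NormedSpace ℝ E]
    [CompleteSpace E] {Φ : E → E} {S : Set E} {z₀ : E} (hS : IsOpen S) (hz₀ : z₀ ∈ S)
    (hΦ : ContDiffOn ℝ ∞ Φ S) (hbij : Function.Bijective (fderiv ℝ Φ z₀)) :
    ∃ l : OpenPartialHomeomorph E E, z₀ ∈ l.source ∧ l.source ⊆ S ∧ (l : E → E) = Φ ∧
      ContDiffOn ℝ ∞ l.symm l.target := by
  let A : E ≃L[ℝ] E := ContinuousLinearEquiv.ofBijective (fderiv ℝ Φ z₀)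
    (LinearMap.ker_eq_bot.2 hbij.1) (LinearMap.range_eq_top.2 hbij.2)
  have hA : (A : E →L[ℝ] E) = fderiv ℝ Φ z₀ := ContinuousLinearEquiv.coe_ofBijective _ _ _
  have hat : ∀ z ∈ S, ContDiffAt ℝ ∞ Φ z := fun z hz => hΦ.contDiffAt (hS.mem_nhds hz)
  have hder : ∀ z ∈ S, HasFDerivAt Φ (fderiv ℝ Φ z) z := fun z hz =>
    ((hat z hz).differentiableAt (by simp)).hasFDerivAt
  have hder0 : HasFDerivAt Φ (A : E →L[ℝ] E) z₀ := hA ▸ hder z₀ hz₀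
  let l₀ := (hat z₀ hz₀).toOpenPartialHomeomorph Φ hder0 (by simp)
  set V : Set E := S ∩ (fderiv ℝ Φ) ⁻¹' range ((↑) : (E ≃L[ℝ] E) → E →L[ℝ] E) with hV
  have hVo : IsOpen V :=
    (hΦ.continuousOn_fderiv_of_isOpen hS (by simp)).isOpen_inter_preimage hS
      (ContinuousLinearEquiv.isOpen)
  refine ⟨l₀.restrOpen V hVo, ?_, ?_, rfl, ?_⟩
  · rw [OpenPartialHomeomorph.restrOpen_source]
    exact ⟨(hat z₀ hz₀).mem_toOpenPartialHomeomorph_source hder0 (by simp), hz₀, A, hA⟩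
  · rw [OpenPartialHomeomorph.restrOpen_source]
    exact fun z hz => hz.2.1
  · intro w hw
    have h1 := (l₀.restrOpen V hVo).map_target hw
    rw [OpenPartialHomeomorph.restrOpen_source] at h1
    obtain ⟨C, hC⟩ := h1.2.2
    have h2 := hder _ h1.2.1
    rw [← hC] at h2
    exact ((l₀.restrOpen V hVo).contDiffAt_symm hw h2 (hat _ h1.2.1)).contDiffWithinAt

section division

open MeasureTheory

variable {y₀ δ : ℝ}

lemma add_mul_sub_mem_Ioo {y t : ℝ} (hy : y ∈ Ioo (y₀ - δ) (y₀ + δ)) (ht : t ∈ Icc (0 : ℝ) 1) :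
    y₀ + t * (y - y₀) ∈ Ioo (y₀ - δ) (y₀ + δ) := by
  obtain ⟨h1, h2⟩ := hy
  obtain ⟨h3, h4⟩ := ht
  have : |t * (y - y₀)| ≤ |y - y₀| := by
    rw [abs_mul, abs_of_nonneg h3]
    nlinarith [abs_nonneg (y - y₀)]
  have h5 : |y - y₀| < δ := abs_lt.2 ⟨by linarith, by linarith⟩
  have h6 := abs_lt.1 (this.trans_lt h5)
  exact ⟨by linarith, by linarith⟩

/-- Differentiation under the integral sign. The factor `t ^ n` makes the statement stable under
iteration. -/
lemma hasDerivAt_integral_pow_mul {f : ℝ → ℝ} (hf : ContDiffOn ℝ ∞ f (Ioo (y₀ - δ) (y₀ + δ)))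
    (n : ℕ) {y : ℝ} (hy : y ∈ Ioo (y₀ - δ) (y₀ + δ)) :
    HasDerivAt (fun y => ∫ t in (0 : ℝ)..1, t ^ n * f (y₀ + t * (y - y₀)))
      (∫ t in (0 : ℝ)..1, t ^ (n + 1) * deriv f (y₀ + t * (y - y₀))) y := by
  have hd := ((contDiffOn_infty_iff_deriv_of_isOpen isOpen_Ioo).1 hf)
  have hcont : ∀ {g : ℝ → ℝ}, ContinuousOn g (Ioo (y₀ - δ) (y₀ + δ)) → ∀ (m : ℕ) (y : ℝ),
      y ∈ Ioo (y₀ - δ) (y₀ + δ) →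
      ContinuousOn (fun t => t ^ m * g (y₀ + t * (y - y₀))) (Icc 0 1) := by
    intro g hg m y hy
    refine (continuousOn_id.pow m).mul (hg.comp (by fun_prop) ?_)
    intro t ht
    exact add_mul_sub_mem_Ioo hy ht
  -- a closed ball around `y` inside the interval, on whose cone the derivative is bounded
  obtain ⟨ε, hε, hball⟩ := Metric.nhds_basis_closedBall.mem_iff.1 (isOpen_Ioo.mem_nhds hy)
  have hK : IsCompact ((fun p : ℝ × ℝ => y₀ + p.1 * (p.2 - y₀)) ''
      (Icc (0 : ℝ) 1 ×ˢ Metric.closedBall y ε)) :=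
    (isCompact_Icc.prod (isCompact_closedBall y ε)).image (by fun_prop)
  have hKs : ((fun p : ℝ × ℝ => y₀ + p.1 * (p.2 - y₀)) ''
      (Icc (0 : ℝ) 1 ×ˢ Metric.closedBall y ε)) ⊆ Ioo (y₀ - δ) (y₀ + δ) := by
    rintro _ ⟨p, ⟨hp1, hp2⟩, rfl⟩
    exact add_mul_sub_mem_Ioo (hball hp2) hp1
  obtain ⟨C, hC⟩ := hK.exists_bound_of_continuousOn (hd.2.continuousOn.mono hKs)
  have hioc : ∀ {t : ℝ}, t ∈ uIoc (0 : ℝ) 1 → t ∈ Icc (0 : ℝ) 1 := fun ht => by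
    rw [uIoc_of_le zero_le_one] at ht
    exact Ioc_subset_Icc_self ht
  have hint : ∀ {g : ℝ → ℝ}, ContinuousOn g (Icc 0 1) → IntervalIntegrable g volume 0 1 :=
    fun hg => by
      apply ContinuousOn.intervalIntegrable
      rwa [uIcc_of_le zero_le_one]
  refine (intervalIntegral.hasDerivAt_integral_of_dominated_loc_of_deriv_le
    (bound := fun _ => C) (s := Metric.closedBall y ε) (Metric.closedBall_mem_nhds y hε)
    (F' := fun y t => t ^ (n + 1) * deriv f (y₀ + t * (y - y₀))) ?_ ?_ ?_ ?_ ?_ ?_).2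
  · filter_upwards [isOpen_Ioo.mem_nhds hy] with w hw
    exact (hint (hcont hf.continuousOn n w hw)).def'.aestronglyMeasurable
  · exact hint (hcont hf.continuousOn n y hy)
  · exact (hint (hcont hd.2.continuousOn (n + 1) y hy)).def'.aestronglyMeasurable
  · refine ae_of_all _ fun t ht w hw => ?_
    have h1 := hioc ht
    have h2 := hC (y₀ + t * (w - y₀)) ⟨(t, w), ⟨h1, hw⟩, rfl⟩
    rw [norm_mul]
    have h3 : ‖t ^ (n + 1)‖ ≤ 1 := by
      rw [norm_pow]
      apply pow_le_one₀ (norm_nonneg _)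
      rw [Real.norm_eq_abs, abs_of_nonneg h1.1]
      exact h1.2
    nlinarith [norm_nonneg (deriv f (y₀ + t * (w - y₀)))]
  · exact intervalIntegrable_const
  · refine ae_of_all _ fun t ht w hw => ?_
    have h1 := add_mul_sub_mem_Ioo (hball hw) (hioc ht)
    have h2 : HasDerivAt f (deriv f (y₀ + t * (w - y₀))) (y₀ + t * (w - y₀)) :=
      ((hf.contDiffAt (isOpen_Ioo.mem_nhds h1)).differentiableAt (by simp)).hasDerivAt
    have h3 : HasDerivAt (fun w => y₀ + t * (w - y₀)) t w := by
      simpa using (((hasDerivAt_id w).sub_const y₀).const_mul t).const_add y₀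
    refine ((h2.comp w h3).const_mul (t ^ n)).congr_deriv ?_
    ring

lemma contDiffOn_integral_pow_mul (m : ℕ) : ∀ (n : ℕ) (f : ℝ → ℝ),
    ContDiffOn ℝ ∞ f (Ioo (y₀ - δ) (y₀ + δ)) →
    ContDiffOn ℝ m (fun y => ∫ t in (0 : ℝ)..1, t ^ n * f (y₀ + t * (y - y₀)))
      (Ioo (y₀ - δ) (y₀ + δ)) := by
  induction m with
  | zero =>
    intro n f hf
    exact contDiffOn_zero.2 fun y hy =>
      (hasDerivAt_integral_pow_mul hf n hy).continuousAt.continuousWithinAt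
  | succ m ih =>
    intro n f hf
    push_cast
    rw [contDiffOn_succ_iff_deriv_of_isOpen isOpen_Ioo]
    refine ⟨fun y hy =>
      (hasDerivAt_integral_pow_mul hf n hy).differentiableAt.differentiableWithinAt,
      by simp, ?_⟩
    refine (ih (n + 1) (deriv f)
      ((contDiffOn_infty_iff_deriv_of_isOpen isOpen_Ioo).1 hf).2).congr fun y hy => ?_
    exact (hasDerivAt_integral_pow_mul hf n hy).deriv

/-- Hadamard's lemma: a smooth function which vanishes at `y₀` is smoothly divisible by
`y - y₀`. -/
lemma exists_smooth_div {f : ℝ → ℝ}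
    (hf : ContDiffOn ℝ ∞ f (Ioo (y₀ - δ) (y₀ + δ))) (h0 : f y₀ = 0) :
    ∃ h : ℝ → ℝ, ContDiffOn ℝ ∞ h (Ioo (y₀ - δ) (y₀ + δ)) ∧ h y₀ = deriv f y₀ ∧
      ∀ y ∈ Ioo (y₀ - δ) (y₀ + δ), f y = (y - y₀) * h y := by
  have hd := ((contDiffOn_infty_iff_deriv_of_isOpen isOpen_Ioo).1 hf)
  refine ⟨fun y => ∫ t in (0 : ℝ)..1, t ^ 0 * deriv f (y₀ + t * (y - y₀)), ?_, by simp, ?_⟩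
  · exact contDiffOn_infty.2 fun m => contDiffOn_integral_pow_mul m 0 _ hd.2
  · intro y hy
    have hderiv : ∀ t ∈ uIcc (0 : ℝ) 1, HasDerivAt (fun t => f (y₀ + t * (y - y₀)))
        ((y - y₀) * (t ^ 0 * deriv f (y₀ + t * (y - y₀)))) t := by
      intro t ht
      rw [uIcc_of_le zero_le_one] at ht
      have h1 := add_mul_sub_mem_Ioo hy ht
      have h2 : HasDerivAt f (deriv f (y₀ + t * (y - y₀))) (y₀ + t * (y - y₀)) :=
        ((hf.contDiffAt (isOpen_Ioo.mem_nhds h1)).differentiableAt (by simp)).hasDerivAt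
      have h3 : HasDerivAt (fun t => y₀ + t * (y - y₀)) (y - y₀) t := by
        simpa using ((hasDerivAt_id t).mul_const (y - y₀)).const_add y₀
      refine (h2.comp t h3).congr_deriv ?_
      ring
    have hcont : ContinuousOn (fun t => (y - y₀) * (t ^ 0 * deriv f (y₀ + t * (y - y₀))))
        (uIcc 0 1) := by
      rw [uIcc_of_le zero_le_one]
      refine continuousOn_const.mul ((continuousOn_id.pow 0).mul
        (hd.2.continuousOn.comp (by fun_prop) ?_))
      intro t ht
      exact add_mul_sub_mem_Ioo hy ht
    have h4 := intervalIntegral.integral_eq_sub_of_hasDerivAt hderiv hcont.intervalIntegrable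
    rw [intervalIntegral.integral_const_mul] at h4
    rw [h4]
    simp [h0]

end division

/-! ### Polar coordinates for the matrices -/

/-- Smooth polar coordinates for a curve of first rows, given a factorization of its last two
entries by a function `s` which is allowed to vanish and to change sign. -/
lemma exists_row1_of_factor {r : ℝ → Fin 4 → ℝ} {J : Set ℝ} {y₀ : ℝ} (hJ : IsOpen J)
    (hy₀ : y₀ ∈ J) (hr : ContDiffOn ℝ ∞ r J) (hrr : ∀ y ∈ J, ip (r y) (r y) = 1)
    {s a b : ℝ → ℝ} (hs : ContDiffOn ℝ ∞ s J) (ha : ContDiffOn ℝ ∞ a J) (hb : ContDiffOn ℝ ∞ b J)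
    (h2 : ∀ y ∈ J, r y 2 = s y * a y) (h3 : ∀ y ∈ J, r y 3 = s y * b y)
    (hab : a y₀ ^ 2 + b y₀ ^ 2 ≠ 0) :
    ∃ (ξ₁ ξ₂ ξ₃ : ℝ → ℝ) (J' : Set ℝ), IsOpen J' ∧ y₀ ∈ J' ∧ J' ⊆ J ∧ ContDiffOn ℝ ∞ ξ₁ J' ∧
      ContDiffOn ℝ ∞ ξ₂ J' ∧ ContDiffOn ℝ ∞ ξ₃ J' ∧
      ∀ y ∈ J', r y = row1 (ξ₁ y) (ξ₂ y) (ξ₃ y) := by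
  have hri : ∀ i, ContDiffOn ℝ ∞ (fun y => r y i) J := fun i => contDiffOn_pi.1 hr i
  have hnorm : ∀ y ∈ J, r y 0 ^ 2 + (-r y 1) ^ 2 = 1 + (r y 2 ^ 2 + r y 3 ^ 2) := fun y hy => by
    have := hrr y hy
    simp only [ip] at this
    linear_combination this
  obtain ⟨ξ₂, J₂, hJ₂, hy₂, hJ₂J, hξ₂, hc₂⟩ := exists_smooth_angle hJ hy₀ (hri 0) (hri 1).neg
    (by have := hnorm y₀ hy₀
        have : 0 < r y₀ 0 ^ 2 + (-r y₀ 1) ^ 2 := by rw [this]; positivity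
        exact this.ne')
  obtain ⟨ξ₃, J₃, hJ₃, hy₃, hJ₃J, hξ₃, hc₃⟩ := exists_smooth_angle hJ hy₀ ha hb.neg
    (by simpa using hab)
  have hρ : ContDiffOn ℝ ∞ (fun y => a y ^ 2 + b y ^ 2) J := (ha.pow 2).add (hb.pow 2)
  set J' : Set ℝ := (J₂ ∩ J₃) ∩ (J ∩ (fun y => a y ^ 2 + b y ^ 2) ⁻¹' {0}ᶜ) with hJ'
  have hJ'J : J' ⊆ J := fun y hy => hy.2.1
  have hsq : ContDiffOn ℝ ∞ (fun y => √(a y ^ 2 + b y ^ 2)) J' :=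
    (hρ.mono hJ'J).sqrt fun y hy => hy.2.2
  refine ⟨fun y => arsinh (s y * √(a y ^ 2 + b y ^ 2)), ξ₂, ξ₃, J', ?_, ⟨⟨hy₂, hy₃⟩, hy₀, hab⟩,
    hJ'J, ?_, hξ₂.mono fun y hy => hy.1.1, hξ₃.mono fun y hy => hy.1.2, ?_⟩
  · exact (hJ₂.inter hJ₃).inter
      (hρ.continuousOn.isOpen_inter_preimage hJ isOpen_compl_singleton)
  · exact contDiff_arsinh.comp_contDiffOn ((hs.mono hJ'J).mul hsq)
  · intro y hy
    have hyJ := hJ'J hy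
    have hcosh : cosh (arsinh (s y * √(a y ^ 2 + b y ^ 2)))
        = √(r y 0 ^ 2 + (-r y 1) ^ 2) := by
      rw [cosh_arsinh, hnorm y hyJ, mul_pow, sq_sqrt (by positivity), h2 y hyJ, h3 y hyJ]
      ring_nf
    have e0 := (hc₂ y).1
    have e1 := (hc₂ y).2
    have e2 := (hc₃ y).1
    have e3 := (hc₃ y).2
    simp only [neg_sq] at e0 e1 e2 e3 hcosh
    ext i
    fin_cases i
    · simpa [row1, hcosh] using e0
    · simp only [row1, hcosh]
      simpa using (neg_eq_iff_eq_neg.1 e1)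
    · simp only [row1, sinh_arsinh]
      simp only [Fin.reduceFinMk, Matrix.cons_val]
      rw [h2 y hyJ, mul_assoc, ← e2]
    · simp only [row1, sinh_arsinh]
      simp only [Fin.reduceFinMk, Matrix.cons_val]
      rw [h3 y hyJ, mul_assoc, ← e3]
      ring

/-- A curve of first rows can be written smoothly as `row1 ξ₁ ξ₂ ξ₃` around `y₀`. Where
`sinh ξ₁` vanishes, polar coordinates are singular; there the hypothesis that the zero is simple
makes it possible to split off a smooth signed radius. -/
lemma exists_row1 {r : ℝ → Fin 4 → ℝ} {J : Set ℝ} {y₀ : ℝ} (hJ : IsOpen J)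
    (hy₀ : y₀ ∈ J) (hr : ContDiffOn ℝ ∞ r J) (hrr : ∀ y ∈ J, ip (r y) (r y) = 1)
    (hsimple : r y₀ 2 = 0 → r y₀ 3 = 0 → deriv r y₀ 2 ^ 2 + deriv r y₀ 3 ^ 2 ≠ 0) :
    ∃ (ξ₁ ξ₂ ξ₃ : ℝ → ℝ) (J' : Set ℝ), IsOpen J' ∧ y₀ ∈ J' ∧ J' ⊆ J ∧ ContDiffOn ℝ ∞ ξ₁ J' ∧
      ContDiffOn ℝ ∞ ξ₂ J' ∧ ContDiffOn ℝ ∞ ξ₃ J' ∧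
      ∀ y ∈ J', r y = row1 (ξ₁ y) (ξ₂ y) (ξ₃ y) := by
  have hri : ∀ i, ContDiffOn ℝ ∞ (fun y => r y i) J := fun i => contDiffOn_pi.1 hr i
  by_cases h : r y₀ 2 ^ 2 + r y₀ 3 ^ 2 = 0
  · have hr2 : r y₀ 2 = 0 := by nlinarith [sq_nonneg (r y₀ 2), sq_nonneg (r y₀ 3)]
    have hr3 : r y₀ 3 = 0 := by nlinarith [sq_nonneg (r y₀ 2), sq_nonneg (r y₀ 3)]
    obtain ⟨δ, hδ, hball⟩ := Metric.isOpen_iff.1 hJ y₀ hy₀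
    rw [Real.ball_eq_Ioo] at hball
    obtain ⟨a, ha, ha0, ha'⟩ := exists_smooth_div ((hri 2).mono hball) hr2
    obtain ⟨b, hb, hb0, hb'⟩ := exists_smooth_div ((hri 3).mono hball) hr3
    have hdr : ∀ i, deriv (fun y => r y i) y₀ = deriv r y₀ i := fun i => by
      have h1 : HasDerivAt r (deriv r y₀) y₀ :=
        ((hr.contDiffAt (hJ.mem_nhds hy₀)).differentiableAt (by simp)).hasDerivAt
      exact (hasDerivAt_pi.1 h1 i).deriv
    obtain ⟨ξ₁, ξ₂, ξ₃, J', h1, h2, h3, h4⟩ := exists_row1_of_factor isOpen_Ioo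
      (s := fun y => y - y₀) (a := a) (b := b) (y₀ := y₀) ⟨by linarith, by linarith⟩
      (hr.mono hball) (fun y hy => hrr y (hball hy))
      (by fun_prop) ha hb ha' hb' (by rw [ha0, hb0, hdr, hdr]; exact hsimple hr2 hr3)
    exact ⟨ξ₁, ξ₂, ξ₃, J', h1, h2, h3.trans hball, h4⟩
  · exact exists_row1_of_factor hJ hy₀ hr hrr (s := fun _ => 1) contDiffOn_const (hri 2) (hri 3)
      (fun y _ => by ring) (fun y _ => by ring) h

/-! ### The frame `T, JT` of a helix surface -/

section frame

variable {q n : Fin 4 → ℝ} (hκ : 0 < κ) (hτ : 0 < τ) (hlam : lam = 1 ∨ lam = -1)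
  (hq : q ∈ AdS κ) (hnq : ip n q = 0)
  (hunit : gBerger κ τ q n n = lam) (hangle : lam * gBerger κ τ q n (E1 κ τ q) = ν)

include hκ hq in
lemma half_sq_mul_ip_self : (√κ / 2) ^ 2 * ip q q = -1 := by
  have h1 : ip q q = -(4 / κ) := hq
  rw [sq_half_sqrt hκ, h1]; field_simp

include hκ hq in
/-- Expansion of a vector tangent to `ℍ³₁(κ/4)` in the frame `X₁, X₂, X₃`. -/
lemma expand_tangent {u : Fin 4 → ℝ} (hu : ip u q = 0) :
    u = (√κ / 2) • (-(√κ / 2 * ip u (J1 *ᵥ q)) • (J1 *ᵥ q)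
      + (√κ / 2 * ip u (J2 *ᵥ q)) • (J2 *ᵥ q) + (√κ / 2 * ip u (J3 *ᵥ q)) • (J3 *ᵥ q)) := by
  have h1 := half_sq_mul_ip_self hκ hq
  have h2 := congrArg (fun v => (-(√κ / 2) ^ 2) • v) (ip_smul_expand q u)
  simp only [smul_smul] at h2
  rw [show -(√κ / 2) ^ 2 * ip q q = 1 by linear_combination -h1, one_smul, hu] at h2
  refine h2.trans ?_
  module

include hκ hτ hlam hq hangle in
lemma half_mul_ip_normal_J1 : √κ / 2 * ip n (J1 *ᵥ q) = lam * ν / τ := by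
  have hl := lam_sq hlam
  rw [gBerger_E1 hκ hτ hq] at hangle
  rw [← hangle]
  field_simp
  linear_combination (-ip n (J1 *ᵥ q)) * hl

include hκ hτ hlam hq hnq hangle in
lemma normal_eq : n = (√κ / 2) • (-(lam * ν / τ) • (J1 *ᵥ q)
      + (√κ / 2 * ip n (J2 *ᵥ q)) • (J2 *ᵥ q) + (√κ / 2 * ip n (J3 *ᵥ q)) • (J3 *ᵥ q)) := by
  rw [← half_mul_ip_normal_J1 hκ hτ hlam hq hangle]
  exact expand_tangent hκ hq hnq

include hκ hτ hlam hq hnq hunit hangle in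
/-- The horizontal part of the unit normal has constant length. -/
lemma normal_horizontal_sq :
    (√κ / 2 * ip n (J2 *ᵥ q)) ^ 2 + (√κ / 2 * ip n (J3 *ᵥ q)) ^ 2 = lam + ν ^ 2 := by
  have hl := lam_sq hlam
  have h1 := half_mul_ip_normal_J1 hκ hτ hlam hq hangle
  have h2 := half_sq_mul_ip_self hκ hq
  have h3 := ip_mul_expand q n n
  rw [hnq] at h3
  rw [gBerger, X1, ip_smul_right, h1] at hunit
  have h4 : lam * ν / τ * τ = lam * ν := by field_simp
  generalize lam * ν / τ = a at *
  generalize √κ / 2 = k at *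
  linear_combination k ^ 2 * h3 + hunit - ip n n * h2 + (a * τ + lam * ν) * h4
    + (k * ip n (J1 *ᵥ q) + a) * h1 + ν ^ 2 * hl

include hκ hτ hlam hq hnq hangle in
lemma gBerger_normal_left (u : Fin 4 → ℝ) :
    gBerger κ τ q n u = √κ / 2 * ip ((-(τ * lam * ν)) • (J1 *ᵥ q)
      + (√κ / 2 * ip n (J2 *ᵥ q)) • (J2 *ᵥ q) + (√κ / 2 * ip n (J3 *ᵥ q)) • (J3 *ᵥ q)) u := by
  have h1 := half_mul_ip_normal_J1 hκ hτ hlam hq hangle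
  have h2 := congrArg (fun v => ip v u) (normal_eq hκ hτ hlam hq hnq hangle)
  simp only [ip_smul_left, ip_add_left] at h2
  have h4 : lam * ν / τ * τ ^ 2 = τ * lam * ν := by field_simp
  rw [gBerger, X1, ip_smul_right, h1, ip_smul_right, h2]
  simp only [ip_smul_left, ip_add_left, ip_comm u]
  linear_combination (-(√κ / 2 * ip (J1 *ᵥ q) u)) * h4

include hκ hτ hlam hq hnq hangle in
lemma tanT_eq : tanT κ τ ν q n = (√κ / 2) • ((lam * (lam + ν ^ 2) / τ) • (J1 *ᵥ q)
      - ν • ((√κ / 2 * ip n (J2 *ᵥ q)) • (J2 *ᵥ q)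
        + (√κ / 2 * ip n (J3 *ᵥ q)) • (J3 *ᵥ q))) := by
  have hl := lam_sq hlam
  have h2 := normal_eq hκ hτ hlam hq hnq hangle
  generalize √κ / 2 * ip n (J2 *ᵥ q) = n₂ at *
  generalize √κ / 2 * ip n (J3 *ᵥ q) = n₃ at *
  rw [tanT, h2, E1, X1, show lam * (lam + ν ^ 2) / τ = τ⁻¹ + ν * (lam * ν / τ) by
    field_simp; linear_combination hl]
  module

include hκ hτ hlam hq hnq hangle in
lemma tanJT_eq : tanJT κ τ ν q n = (√κ / 2) • ((√κ / 2 * ip n (J3 *ᵥ q)) • (J2 *ᵥ q)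
        - (√κ / 2 * ip n (J2 *ᵥ q)) • (J3 *ᵥ q)) := by
  have hl := lam_sq hlam
  have hg := half_sq_mul_ip_self hκ hq
  have h1 := half_mul_ip_normal_J1 hκ hτ hlam hq hangle
  have hT := tanT_eq hκ hτ hlam hq hnq hangle
  have e2 : ∀ v, gBerger κ τ q v (E2 κ q) = √κ / 2 * ip v (J2 *ᵥ q) := fun v => by
    simp only [gBerger, E2, X1, ip_smul_right, ip_smul_left, ip_comm (J2 *ᵥ q) (J1 *ᵥ q),
      ip_J1_J2]
    ring
  have e3 : ∀ v, gBerger κ τ q v (E3 κ q) = √κ / 2 * ip v (J3 *ᵥ q) := fun v => by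
    simp only [gBerger, E3, X1, ip_smul_right, ip_smul_left, ip_comm (J3 *ᵥ q) (J1 *ᵥ q),
      ip_J1_J3]
    ring
  have hn1 : gBerger κ τ q n (E1 κ τ q) = lam * ν := by
    rw [gBerger_E1 hκ hτ hq, mul_assoc, h1]; field_simp
  have hT1 : gBerger κ τ q (tanT κ τ ν q n) (E1 κ τ q) = -(lam * (lam + ν ^ 2)) := by
    rw [gBerger_E1 hκ hτ hq, hT]
    simp only [ip_smul_left, ip_sub_left, ip_add_left, ip_J1_J1, ip_comm (J2 *ᵥ q) (J1 *ᵥ q),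
      ip_comm (J3 *ᵥ q) (J1 *ᵥ q), ip_J1_J2, ip_J1_J3]
    field_simp at hg ⊢
    linear_combination (2 * (lam * (lam + ν ^ 2))) * hg
  have hT2 : gBerger κ τ q (tanT κ τ ν q n) (E2 κ q) = -(ν * (√κ / 2 * ip n (J2 *ᵥ q))) := by
    rw [e2, hT]
    simp only [ip_smul_left, ip_sub_left, ip_add_left, ip_J2_J2,
      ip_comm (J3 *ᵥ q) (J2 *ᵥ q), ip_J1_J2, ip_J2_J3]
    linear_combination (ν * (√κ / 2 * ip n (J2 *ᵥ q))) * hg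
  have hT3 : gBerger κ τ q (tanT κ τ ν q n) (E3 κ q) = -(ν * (√κ / 2 * ip n (J3 *ᵥ q))) := by
    rw [e3, hT]
    simp only [ip_smul_left, ip_sub_left, ip_add_left, ip_J3_J3, ip_J1_J3, ip_J2_J3]
    linear_combination (ν * (√κ / 2 * ip n (J3 *ᵥ q))) * hg
  simp only [tanJT, wedge, hn1, hT1, hT2, hT3, e2 n, e3 n]
  simp only [E1, E2, E3, X1]
  generalize √κ / 2 * ip n (J2 *ᵥ q) = n₂ at *
  generalize √κ / 2 * ip n (J3 *ᵥ q) = n₃ at *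
  rw [show -(n₂ * -(ν * n₃) - n₃ * -(ν * n₂)) = 0 by ring,
    show n₃ * -(-(lam * (lam + ν ^ 2))) - -(lam * ν) * -(ν * n₃) = n₃ by
      linear_combination n₃ * hl,
    show -(lam * ν) * -(ν * n₂) - n₂ * -(-(lam * (lam + ν ^ 2))) = -n₂ by
      linear_combination (-n₂) * hl]
  module

include hκ hτ hlam hq hnq hunit hangle in
/-- A vector tangent to the surface is determined by its components along `T` and `JT`. -/
lemma tangent_eq (hc : 0 < lam + ν ^ 2) {u : Fin 4 → ℝ} (hu : ip u q = 0)
    (hun : gBerger κ τ q n u = 0) :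
    u = (-(√κ / 2 * τ * lam / (lam + ν ^ 2) * ip u (J1 *ᵥ q))) • tanT κ τ ν q n
      + (√κ / 2 * (√κ / 2 * ip n (J3 *ᵥ q) * ip u (J2 *ᵥ q)
        - √κ / 2 * ip n (J2 *ᵥ q) * ip u (J3 *ᵥ q)) / (lam + ν ^ 2)) • tanJT κ τ ν q n := by
  have hl := lam_sq hlam
  have hk : (0 : ℝ) < √κ / 2 := by have := sqrt_pos.2 hκ; positivity
  have hsq := normal_horizontal_sq hκ hτ hlam hq hnq hunit hangle
  rw [gBerger_normal_left hκ hτ hlam hq hnq hangle] at hun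
  have hun' := (mul_eq_zero.1 hun).resolve_left hk.ne'
  rw [ip_comm] at hun'
  simp only [ip_add_right, ip_smul_right] at hun'
  rw [tanT_eq hκ hτ hlam hq hnq hangle, tanJT_eq hκ hτ hlam hq hnq hangle]
  conv_lhs => rw [expand_tangent hκ hq hu]
  generalize √κ / 2 * ip n (J2 *ᵥ q) = n₂ at *
  generalize √κ / 2 * ip n (J3 *ᵥ q) = n₃ at *
  generalize √κ / 2 = k at *
  generalize ip u (J1 *ᵥ q) = u₁ at *
  generalize ip u (J2 *ᵥ q) = u₂ at *
  generalize ip u (J3 *ᵥ q) = u₃ at *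
  have e1 : -(k * u₁) = -(k * τ * lam / (lam + ν ^ 2) * u₁) * (lam * (lam + ν ^ 2) / τ) := by
    field_simp
    linear_combination u₁ * hl
  have e2 : k * u₂ = k * τ * lam / (lam + ν ^ 2) * u₁ * ν * n₂
      + k * (n₃ * u₂ - n₂ * u₃) / (lam + ν ^ 2) * n₃ := by
    field_simp
    linear_combination (-u₂) * hsq + n₂ * hun'
  have e3 : k * u₃ = k * τ * lam / (lam + ν ^ 2) * u₁ * ν * n₃
      - k * (n₃ * u₂ - n₂ * u₃) / (lam + ν ^ 2) * n₂ := by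
    field_simp
    linear_combination (-u₃) * hsq + n₃ * hun'
  rw [e1, e2, e3]
  module

end frame

/-! ### Local parametrizations of helix surfaces -/

/-- A helix surface given by a parametrization `f` over an open set `U` of the plane, with the
unit normal `n`. -/
structure IsLocalHelix (κ τ lam ν : ℝ) (U : Set (ℝ × ℝ)) (f n : ℝ × ℝ → Fin 4 → ℝ) : Prop where
  isOpen : IsOpen U
  smooth : ContDiffOn ℝ ∞ f U
  mem_AdS : ∀ z ∈ U, f z ∈ AdS κ
  immersion : ∀ z ∈ U, Function.Injective (fderiv ℝ f z)
  smooth_normal : ContDiffOn ℝ ∞ n U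
  tangent_AdS : ∀ z ∈ U, ip (n z) (f z) = 0
  normal : ∀ z ∈ U, ∀ v, gBerger κ τ (f z) (n z) (fderiv ℝ f z v) = 0
  unit : ∀ z ∈ U, gBerger κ τ (f z) (n z) (n z) = lam
  angle : ∀ z ∈ U, lam * gBerger κ τ (f z) (n z) (E1 κ τ (f z)) = ν

/-- Two linear functionals which separate the image of an injective linear map from the plane
take arbitrary values on it. -/
lemma exists_preimage_plane {D : ℝ × ℝ →L[ℝ] Fin 4 → ℝ} (hD : Function.Injective D)
    (a b : (Fin 4 → ℝ) →L[ℝ] ℝ) (h : ∀ v, a (D v) = 0 → b (D v) = 0 → D v = 0) (s t : ℝ) :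
    ∃ v, a (D v) = s ∧ b (D v) = t := by
  let Φ : ℝ × ℝ →ₗ[ℝ] ℝ × ℝ := ((a.comp D).prod (b.comp D)).toLinearMap
  have hΦ : Function.Injective Φ := by
    rw [← LinearMap.ker_eq_bot, LinearMap.ker_eq_bot']
    intro v hv
    have h1 : a (D v) = 0 := congrArg Prod.fst hv
    have h2 : b (D v) = 0 := congrArg Prod.snd hv
    exact hD ((h v h1 h2).trans (map_zero D).symm)
  obtain ⟨v, hv⟩ := LinearMap.injective_iff_surjective.1 hΦ (s, t)
  exact ⟨v, congrArg Prod.fst hv, congrArg Prod.snd hv⟩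

namespace IsLocalHelix

variable {U : Set (ℝ × ℝ)} {f n : ℝ × ℝ → Fin 4 → ℝ} (h : IsLocalHelix κ τ lam ν U f n)
  {z : ℝ × ℝ}

include h

lemma hasFDerivAt (hz : z ∈ U) : HasFDerivAt f (fderiv ℝ f z) z :=
  ((h.smooth.contDiffAt (h.isOpen.mem_nhds hz)).differentiableAt (by simp)).hasFDerivAt

lemma hasFDerivAt_normal (hz : z ∈ U) : HasFDerivAt n (fderiv ℝ n z) z :=
  ((h.smooth_normal.contDiffAt (h.isOpen.mem_nhds hz)).differentiableAt (by simp)).hasFDerivAt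

lemma ip_fderiv (hz : z ∈ U) (v : ℝ × ℝ) : ip (fderiv ℝ f z v) (f z) = 0 := by
  obtain ⟨L, hL, hLv⟩ := exists_hasFDerivAt_ip (h.hasFDerivAt hz) (h.hasFDerivAt hz)
  have h1 : (fun z => ip (f z) (f z)) =ᶠ[nhds z] fun _ => -(4 / κ) := by
    filter_upwards [h.isOpen.mem_nhds hz] with w hw using h.mem_AdS w hw
  have h2 : L = 0 := hL.unique ((hasFDerivAt_const _ _).congr_of_eventuallyEq h1)
  have h3 := hLv v
  rw [h2, ip_comm (f z)] at h3
  simp at h3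
  linarith

/-- The integrability condition: the derivative of the equation `g_τ(N, df) = 0`, made
skew-symmetric. -/
lemma integrability (hκ : 0 < κ) (hτ : 0 < τ) (hlam : lam = 1 ∨ lam = -1) (hz : z ∈ U) :
    ∃ L₂ L₃ : ℝ × ℝ →L[ℝ] ℝ,
      HasFDerivAt (fun z => √κ / 2 * ip (n z) (J2 *ᵥ f z)) L₂ z ∧
      HasFDerivAt (fun z => √κ / 2 * ip (n z) (J3 *ᵥ f z)) L₃ z ∧
      ∀ v w, -(2 * τ * lam * ν) * ip (J1 *ᵥ fderiv ℝ f z w) (fderiv ℝ f z v)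
        + 2 * (√κ / 2 * ip (n z) (J2 *ᵥ f z)) * ip (J2 *ᵥ fderiv ℝ f z w) (fderiv ℝ f z v)
        + 2 * (√κ / 2 * ip (n z) (J3 *ᵥ f z)) * ip (J3 *ᵥ fderiv ℝ f z w) (fderiv ℝ f z v)
        + (L₂ w * ip (J2 *ᵥ f z) (fderiv ℝ f z v) - L₂ v * ip (J2 *ᵥ f z) (fderiv ℝ f z w))
        + (L₃ w * ip (J3 *ᵥ f z) (fderiv ℝ f z v) - L₃ v * ip (J3 *ᵥ f z) (fderiv ℝ f z w))
        = 0 := by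
  have hk : (0 : ℝ) < √κ / 2 := by have := sqrt_pos.2 hκ; positivity
  have hf := h.hasFDerivAt hz
  obtain ⟨L₂, hL₂, -⟩ := exists_hasFDerivAt_ip (h.hasFDerivAt_normal hz)
    (hasFDerivAt_mulVec J2 hf)
  obtain ⟨L₃, hL₃, -⟩ := exists_hasFDerivAt_ip (h.hasFDerivAt_normal hz)
    (hasFDerivAt_mulVec J3 hf)
  replace hL₂ := hL₂.const_mul (√κ / 2)
  replace hL₃ := hL₃.const_mul (√κ / 2)
  refine ⟨_, _, hL₂, hL₃, ?_⟩
  have hm := (((hasFDerivAt_mulVec J1 hf).const_smul (-(τ * lam * ν))).add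
    (hL₂.smul (hasFDerivAt_mulVec J2 hf))).add (hL₃.smul (hasFDerivAt_mulVec J3 hf))
  have hf2 : HasFDerivAt (fderiv ℝ f) (fderiv ℝ (fderiv ℝ f) z) z := by
    have h1 := ((contDiffOn_infty_iff_fderiv_of_isOpen h.isOpen).1 h.smooth).2
    exact ((h1.contDiffAt (h.isOpen.mem_nhds hz)).differentiableAt (by simp)).hasFDerivAt
  have hsymm : ∀ v w, fderiv ℝ (fderiv ℝ f) z v w = fderiv ℝ (fderiv ℝ f) z w v := fun v w =>
    ((h.smooth.contDiffAt (h.isOpen.mem_nhds hz)).isSymmSndFDerivAt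
      (by rw [minSmoothness_of_isRCLikeNormedField]; exact ENat.LEInfty.out)).eq v w
  -- the derivative of `g_τ(N, df v) = 0` in the direction `w`
  have key : ∀ v w, ip (_ : Fin 4 → ℝ) (fderiv ℝ (fderiv ℝ f) z w v)
      + ip ((_ : ℝ × ℝ →L[ℝ] Fin 4 → ℝ) w) (fderiv ℝ f z v) = 0 := fun v w => by
    have hv : HasFDerivAt (fun z => fderiv ℝ f z v)
        ((ContinuousLinearMap.apply ℝ _ v).comp (fderiv ℝ (fderiv ℝ f) z)) z :=
      (ContinuousLinearMap.apply ℝ (Fin 4 → ℝ) v).hasFDerivAt.comp z hf2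
    obtain ⟨L, hL, hLv⟩ := exists_hasFDerivAt_ip hm hv
    have h0 : L = 0 := by
      refine hL.unique ((hasFDerivAt_const (0 : ℝ) z).congr_of_eventuallyEq ?_)
      filter_upwards [h.isOpen.mem_nhds hz] with y hy
      have h1 := h.normal y hy v
      rw [gBerger_normal_left hκ hτ hlam (h.mem_AdS y hy) (h.tangent_AdS y hy) (h.angle y hy)]
        at h1
      exact (mul_eq_zero.1 h1).resolve_left hk.ne'
    have h2 := hLv w
    rw [h0] at h2
    exact h2.symm
  intro v w
  have k1 := key v w
  have k2 := key w v
  rw [hsymm v w] at k2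
  simp only [add_apply, smul_apply,
    ContinuousLinearMap.comp_apply, ContinuousLinearMap.smulRight_apply, mulVecL_apply,
    ip_add_left, ip_smul_left] at k1 k2 ⊢
  have s1 := ip_J1_skew (fderiv ℝ f z w) (fderiv ℝ f z v)
  have s2 := ip_J2_skew (fderiv ℝ f z w) (fderiv ℝ f z v)
  have s3 := ip_J3_skew (fderiv ℝ f z w) (fderiv ℝ f z v)
  rw [ip_comm (fderiv ℝ f z w), ip_comm (fderiv ℝ f z v)] at s1 s2 s3
  simp only [smul_eq_mul] at k1 k2 ⊢
  linear_combination k1 - k2 - (τ * lam * ν) * s1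
    + (√κ / 2 * ip (n z) (J2 *ᵥ f z)) * s2 + (√κ / 2 * ip (n z) (J3 *ᵥ f z)) * s3

/-- The angle function of a helix surface satisfies `λ + ν² > 0`: in the remaining case the
surface would be orthogonal to `E₁`, but the planes spanned by `E₂, E₃` are not integrable. -/
lemma add_sq_pos (hκ : 0 < κ) (hτ : 0 < τ) (hlam : lam = 1 ∨ lam = -1) (hν : ν ≠ 0)
    (hz : z ∈ U) : 0 < lam + ν ^ 2 := by
  have hk : (0 : ℝ) < √κ / 2 := by have := sqrt_pos.2 hκ; positivity
  have hl0 : lam ≠ 0 := by rcases hlam with h | h <;> simp [h]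
  have hsq : ∀ y ∈ U, _ := fun y hy => normal_horizontal_sq hκ hτ hlam (h.mem_AdS y hy)
    (h.tangent_AdS y hy) (h.unit y hy) (h.angle y hy)
  have hnn : 0 ≤ lam + ν ^ 2 := by rw [← hsq z hz]; positivity
  refine lt_of_le_of_ne hnn fun h0 => ?_
  obtain ⟨L₂, L₃, hL₂, hL₃, hint⟩ := h.integrability hκ hτ hlam hz
  have hzero : ∀ y ∈ U, √κ / 2 * ip (n y) (J2 *ᵥ f y) = 0 ∧ √κ / 2 * ip (n y) (J3 *ᵥ f y) = 0 :=
    fun y hy => by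
      have h1 := hsq y hy
      rw [← h0] at h1
      constructor <;> nlinarith [sq_nonneg (√κ / 2 * ip (n y) (J2 *ᵥ f y)),
        sq_nonneg (√κ / 2 * ip (n y) (J3 *ᵥ f y))]
  have hL₂0 : L₂ = 0 := hL₂.unique ((hasFDerivAt_const (0 : ℝ) z).congr_of_eventuallyEq (by
    filter_upwards [h.isOpen.mem_nhds hz] with y hy using (hzero y hy).1))
  have hL₃0 : L₃ = 0 := hL₃.unique ((hasFDerivAt_const (0 : ℝ) z).congr_of_eventuallyEq (by
    filter_upwards [h.isOpen.mem_nhds hz] with y hy using (hzero y hy).2))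
  have hq := h.mem_AdS z hz
  have hJ1 : ∀ v, ip (fderiv ℝ f z v) (J1 *ᵥ f z) = 0 := fun v => by
    have h1 := h.normal z hz v
    rw [gBerger_normal_left hκ hτ hlam hq (h.tangent_AdS z hz) (h.angle z hz), (hzero z hz).1,
      (hzero z hz).2] at h1
    simp only [zero_smul, add_zero, ip_smul_left, ip_comm (J1 *ᵥ f z)] at h1
    have h2 : √κ / 2 * (τ * lam * ν) ≠ 0 := by positivity
    have h3 : √κ / 2 * (τ * lam * ν) * ip (fderiv ℝ f z v) (J1 *ᵥ f z) = 0 := by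
      linear_combination -h1
    exact (mul_eq_zero.1 h3).resolve_left h2
  have hex : ∀ v, fderiv ℝ f z v = (√κ / 2) •
      ((√κ / 2 * ip (fderiv ℝ f z v) (J2 *ᵥ f z)) • (J2 *ᵥ f z)
        + (√κ / 2 * ip (fderiv ℝ f z v) (J3 *ᵥ f z)) • (J3 *ᵥ f z)) := fun v => by
    have h1 := expand_tangent hκ hq (h.ip_fderiv hz v)
    rw [hJ1 v] at h1
    simpa using h1
  have hsurj := exists_preimage_plane (h.immersion z hz)
    (ipL.flip (J2 *ᵥ f z)) (ipL.flip (J3 *ᵥ f z)) (fun v h2 h3 => by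
      have h2' : ip (fderiv ℝ f z v) (J2 *ᵥ f z) = 0 := h2
      have h3' : ip (fderiv ℝ f z v) (J3 *ᵥ f z) = 0 := h3
      rw [hex v, h2', h3']
      simp)
  obtain ⟨w, hw2, hw3⟩ := hsurj 1 0
  obtain ⟨v, hv2, hv3⟩ := hsurj 0 1
  have hw2' : ip (fderiv ℝ f z w) (J2 *ᵥ f z) = 1 := hw2
  have hw3' : ip (fderiv ℝ f z w) (J3 *ᵥ f z) = 0 := hw3
  have h1 := hint v w
  rw [hL₂0, hL₃0, (hzero z hz).1, (hzero z hz).2] at h1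
  have h2 : ip (J1 *ᵥ fderiv ℝ f z w) (fderiv ℝ f z v) = (√κ / 2) ^ 2 := by
    have h3 := hex w
    rw [hw2', hw3'] at h3
    rw [h3]
    have hv3' : ip (fderiv ℝ f z v) (J3 *ᵥ f z) = 1 := hv3
    simp only [mul_one, mul_zero, zero_smul, add_zero, Matrix.mulVec_smul, J1_J2, ip_smul_left,
      ip_comm (J3 *ᵥ f z), hv3']
    ring
  rw [h2] at h1
  have h3 : 2 * τ * lam * ν * (√κ / 2) ^ 2 ≠ 0 := by positivity
  apply h3
  simp at h1 ⊢
  tauto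

/-- The differential of the parametrization attains every combination of `T` and `JT`. -/
lemma exists_fderiv_eq (hκ : 0 < κ) (hτ : 0 < τ) (hlam : lam = 1 ∨ lam = -1)
    (hc : 0 < lam + ν ^ 2) (hz : z ∈ U) :
    (∃ v, fderiv ℝ f z v = tanT κ τ ν (f z) (n z)) ∧
      ∃ v, fderiv ℝ f z v = tanJT κ τ ν (f z) (n z) := by
  have hdec : ∀ v, _ := fun v => tangent_eq hκ hτ hlam (h.mem_AdS z hz) (h.tangent_AdS z hz)
    (h.unit z hz) (h.angle z hz) hc (h.ip_fderiv hz v) (h.normal z hz v)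
  have hsurj := exists_preimage_plane (h.immersion z hz)
    ((-(√κ / 2 * τ * lam / (lam + ν ^ 2))) • ipL.flip (J1 *ᵥ f z))
    ((√κ / 2 / (lam + ν ^ 2)) • ((√κ / 2 * ip (n z) (J3 *ᵥ f z)) • ipL.flip (J2 *ᵥ f z)
      - (√κ / 2 * ip (n z) (J2 *ᵥ f z)) • ipL.flip (J3 *ᵥ f z)))
  have happ : ∀ u, ((-(√κ / 2 * τ * lam / (lam + ν ^ 2))) • ipL.flip (J1 *ᵥ f z)) u
      = -(√κ / 2 * τ * lam / (lam + ν ^ 2) * ip u (J1 *ᵥ f z)) := fun u => by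
    simp [ipL_apply]
  have happ' : ∀ u, ((√κ / 2 / (lam + ν ^ 2)) •
      ((√κ / 2 * ip (n z) (J3 *ᵥ f z)) • ipL.flip (J2 *ᵥ f z)
      - (√κ / 2 * ip (n z) (J2 *ᵥ f z)) • ipL.flip (J3 *ᵥ f z))) u
      = √κ / 2 * (√κ / 2 * ip (n z) (J3 *ᵥ f z) * ip u (J2 *ᵥ f z)
        - √κ / 2 * ip (n z) (J2 *ᵥ f z) * ip u (J3 *ᵥ f z)) / (lam + ν ^ 2) := fun u => by
    simp [ipL_apply]; ring
  simp only [happ, happ'] at hsurj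
  have hsurj' := hsurj (fun v h1 h2 => by rw [hdec v, h1, h2]; simp)
  constructor
  · obtain ⟨v, h1, h2⟩ := hsurj' 1 0
    exact ⟨v, by rw [hdec v, h1, h2]; simp⟩
  · obtain ⟨v, h1, h2⟩ := hsurj' 0 1
    exact ⟨v, by rw [hdec v, h1, h2]; simp⟩

/-- The horizontal part of the unit normal rotates at a constant rate along `T`. -/
lemma rotation_rate (hκ : 0 < κ) (hτ : 0 < τ) (hlam : lam = 1 ∨ lam = -1)
    (hc : 0 < lam + ν ^ 2) (hz : z ∈ U) {L₂ L₃ : ℝ × ℝ →L[ℝ] ℝ}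
    (hL₂ : HasFDerivAt (fun z => √κ / 2 * ip (n z) (J2 *ᵥ f z)) L₂ z)
    (hL₃ : HasFDerivAt (fun z => √κ / 2 * ip (n z) (J3 *ᵥ f z)) L₃ z)
    {v : ℝ × ℝ} (hv : fderiv ℝ f z v = tanT κ τ ν (f z) (n z)) :
    √κ / 2 * ip (n z) (J2 *ᵥ f z) * L₃ v - √κ / 2 * ip (n z) (J3 *ᵥ f z) * L₂ v
      = (lam + ν ^ 2) * -(lam * √κ * B τ lam ν / τ) := by
  have hq := h.mem_AdS z hz
  obtain ⟨M₂, M₃, hM₂, hM₃, hint⟩ := h.integrability hκ hτ hlam hz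
  rw [hM₂.unique hL₂, hM₃.unique hL₃] at hint
  obtain ⟨-, w, hw⟩ := h.exists_fderiv_eq hκ hτ hlam hc hz
  have hsq : ∀ y ∈ U, _ := fun y hy => normal_horizontal_sq hκ hτ hlam (h.mem_AdS y hy)
    (h.tangent_AdS y hy) (h.unit y hy) (h.angle y hy)
  -- the horizontal part has constant length
  have hconst : √κ / 2 * ip (n z) (J2 *ᵥ f z) * L₂ w
      + √κ / 2 * ip (n z) (J3 *ᵥ f z) * L₃ w = 0 := by
    have h1 := (hL₂.pow 2).add (hL₃.pow 2)
    have h2 := h1.unique ((hasFDerivAt_const (lam + ν ^ 2) z).congr_of_eventuallyEq (by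
      filter_upwards [h.isOpen.mem_nhds hz] with y hy using hsq y hy))
    have h3 := congrArg (fun L => L w) h2
    simp at h3
    linear_combination h3 / 2
  have hg := half_sq_mul_ip_self hκ hq
  have hsqz := hsq z hz
  have h1 := hint w v
  rw [hv, hw, tanT_eq hκ hτ hlam hq (h.tangent_AdS z hz) (h.angle z hz),
    tanJT_eq hκ hτ hlam hq (h.tangent_AdS z hz) (h.angle z hz)] at h1
  simp only [Matrix.mulVec_smul, Matrix.mulVec_sub, Matrix.mulVec_add, J1_J1, J1_J2, J1_J3,
    J2_J1, J2_J2, J2_J3, J3_J1, J3_J2, J3_J3, ip_smul_left, ip_sub_left, ip_add_left,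
    ip_smul_right, ip_sub_right, ip_add_right, ip_neg_left, ip_J2_J2, ip_J3_J3, ip_J2_J3,
    ip_J1_J2, ip_J1_J3, ip_comm (J3 *ᵥ f z) (J2 *ᵥ f z), ip_comm (J2 *ᵥ f z) (J1 *ᵥ f z),
    ip_comm (J3 *ᵥ f z) (J1 *ᵥ f z), ip_comm (f z) (J2 *ᵥ f z), ip_comm (f z) (J3 *ᵥ f z),
    ip_J2_self, ip_J3_self] at h1
  have hB' : B τ lam ν = ν ^ 2 * (τ ^ 2 - 1) - lam := rfl
  rw [hB', show √κ = 2 * (√κ / 2) by ring, show 2 * (√κ / 2) / 2 = √κ / 2 by ring]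
  generalize √κ / 2 * ip (n z) (J2 *ᵥ f z) = n₂ at *
  generalize √κ / 2 * ip (n z) (J3 *ᵥ f z) = n₃ at *
  generalize ip (f z) (f z) = G at *
  generalize √κ / 2 = k at *
  have h4 : (k ^ 2 * G) * (2 * τ * lam * ν ^ 2 * (n₂ ^ 2 + n₃ ^ 2)
      - 2 * (lam * (lam + ν ^ 2) / τ) * (n₂ ^ 2 + n₃ ^ 2))
      + k * G * (n₂ * L₃ v - n₃ * L₂ v - ν * (n₂ * L₂ w + n₃ * L₃ w)) = 0 := by
    linear_combination h1
  rw [hsqz, hconst] at h4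
  have h5 : n₂ * L₃ v - n₃ * L₂ v = -k * (2 * τ * lam * ν ^ 2 * (lam + ν ^ 2)
      - 2 * (lam * (lam + ν ^ 2) / τ) * (lam + ν ^ 2)) := by
    linear_combination -k * h4 + (n₂ * L₃ v - n₃ * L₂ v + k * (2 * τ * lam * ν ^ 2 * (lam + ν ^ 2)
      - 2 * (lam * (lam + ν ^ 2) / τ) * (lam + ν ^ 2))) * hg
  rw [h5]
  field_simp
  ring

end IsLocalHelix

/-! ### Flow-box coordinates -/

/-- A neighbourhood of a point of the plane contains an open rectangle around it. -/
lemma exists_rectangle {V : Set (ℝ × ℝ)} (hV : IsOpen V) {w : ℝ × ℝ} (hw : w ∈ V) :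
    ∃ x₀ x₁ y₀ y₁ : ℝ, w.1 ∈ Ioo x₀ x₁ ∧ w.2 ∈ Ioo y₀ y₁ ∧ Ioo x₀ x₁ ×ˢ Ioo y₀ y₁ ⊆ V := by
  obtain ⟨δ, hδ, hball⟩ := Metric.isOpen_iff.1 hV w hw
  rw [← ball_prod_same, Real.ball_eq_Ioo, Real.ball_eq_Ioo] at hball
  exact ⟨_, _, _, _, ⟨by linarith, by linarith⟩, ⟨by linarith, by linarith⟩, hball⟩

/-- Restriction of a local homeomorphism to an open subset of its target. -/
def restrTarget {X Y : Type*} [TopologicalSpace X] [TopologicalSpace Y]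
    (l : OpenPartialHomeomorph X Y) (W : Set Y) (hW : IsOpen W) : OpenPartialHomeomorph X Y :=
  (l.symm.restrOpen W hW).symm

section restrTarget

variable {X Y : Type*} [TopologicalSpace X] [TopologicalSpace Y]
  (l : OpenPartialHomeomorph X Y) {W : Set Y} (hW : IsOpen W)

lemma restrTarget_target : (restrTarget l W hW).target = l.target ∩ W := by
  simp [restrTarget]

lemma restrTarget_source : (restrTarget l W hW).source = l.source ∩ l ⁻¹' W := by
  simp [restrTarget]

end restrTarget

/-- The angle of the horizontal part of the normal, divided by its rate of change along `T`,
serves as the coordinate `x`. The first row `r` of the matrix mapping `γ(x)` to the position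
vector is constant along `T`, so that one of its entries serves as the second coordinate. -/
theorem IsLocalHelix.exists_flowBox {U : Set (ℝ × ℝ)} {f n : ℝ × ℝ → Fin 4 → ℝ}
    (h : IsLocalHelix κ τ lam ν U f n) (hκ : 0 < κ) (hτ : 0 < τ) (hlam : lam = 1 ∨ lam = -1)
    (hν : ν ≠ 0) (hB : 0 < B τ lam ν) (hc : 0 < lam + ν ^ 2) {z₀ : ℝ × ℝ} (hz₀ : z₀ ∈ U) :
    ∃ (l : OpenPartialHomeomorph (ℝ × ℝ) (ℝ × ℝ)) (x₀ x₁ y₀ y₁ : ℝ) (R : ℝ → Fin 4 → ℝ),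
      z₀ ∈ l.source ∧ l.source ⊆ U ∧ l.target = Ioo x₀ x₁ ×ˢ Ioo y₀ y₁ ∧
      ContDiffOn ℝ ∞ l l.source ∧ ContDiffOn ℝ ∞ l.symm l.target ∧
      ContDiffOn ℝ ∞ R (Ioo y₀ y₁) ∧
      (∀ z ∈ l.target, f (l.symm z) = act (R z.2) (γ κ τ lam ν z.1)) ∧
      ∀ z ∈ l.target, fderiv ℝ (fun z => f (l.symm z)) z (1, 0)
        = tanT κ τ ν (f (l.symm z)) (n (l.symm z)) := by
  have hl := lam_sq hlam
  have hl0 : lam ≠ 0 := by rcases hlam with h | h <;> simp [h]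
  have hk := sqrt_pos.2 hκ
  set c := √(lam + ν ^ 2) with hcdef
  have hc0 : 0 < c := sqrt_pos.2 hc
  have hc2 : c ^ 2 = lam + ν ^ 2 := sq_sqrt hc.le
  set P := -(lam * √κ * B τ lam ν / τ) with hP
  have hP0 : P ≠ 0 := by
    rw [hP]; exact neg_ne_zero.2 (by positivity)
  set ε := lam * |ν| / ν with hε
  have hεν : ε * ν = lam * |ν| := by rw [hε]; field_simp
  have hε2 : ε ^ 2 = 1 := by
    rw [hε, div_pow, mul_pow, sq_abs, hl]; field_simp
  set n₂ : ℝ × ℝ → ℝ := fun z => √κ / 2 * ip (n z) (J2 *ᵥ f z) with hn₂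
  set n₃ : ℝ × ℝ → ℝ := fun z => √κ / 2 * ip (n z) (J3 *ᵥ f z) with hn₃
  have hn₂s : ContDiffOn ℝ ∞ n₂ U :=
    contDiffOn_const.mul (contDiffOn_ip h.smooth_normal (contDiffOn_mulVec J2 h.smooth))
  have hn₃s : ContDiffOn ℝ ∞ n₃ U :=
    contDiffOn_const.mul (contDiffOn_ip h.smooth_normal (contDiffOn_mulVec J3 h.smooth))
  have hsq : ∀ z ∈ U, n₂ z ^ 2 + n₃ z ^ 2 = c ^ 2 := fun z hz => by
    rw [hc2]
    exact normal_horizontal_sq hκ hτ hlam (h.mem_AdS z hz) (h.tangent_AdS z hz) (h.unit z hz)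
      (h.angle z hz)
  have hε_sq : ∀ z ∈ U, (ε * n₂ z) ^ 2 + (ε * n₃ z) ^ 2 = c ^ 2 := fun z hz => by
    linear_combination (n₂ z ^ 2 + n₃ z ^ 2) * hε2 + hsq z hz
  have hsqε : ∀ z ∈ U, √((ε * n₂ z) ^ 2 + (ε * n₃ z) ^ 2) = c := fun z hz => by
    rw [hε_sq z hz, sqrt_sq hc0.le]
  obtain ⟨φ, S, hS, hz₀S, hSU, hφ, hang⟩ := exists_smooth_angle (a := fun z => ε * n₂ z)
    (b := fun z => ε * n₃ z) h.isOpen hz₀ (contDiffOn_const.mul hn₂s) (contDiffOn_const.mul hn₃s)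
    (by rw [hε_sq z₀ hz₀]; positivity)
  have hn₂φ : ∀ z ∈ S, n₂ z = ε * c * cos (φ z) := fun z hz => by
    have h1 := (hang z).1
    simp only [hsqε z (hSU hz)] at h1
    linear_combination (-n₂ z) * hε2 + ε * h1
  have hn₃φ : ∀ z ∈ S, n₃ z = ε * c * sin (φ z) := fun z hz => by
    have h1 := (hang z).2
    simp only [hsqε z (hSU hz)] at h1
    linear_combination (-n₃ z) * hε2 + ε * h1
  -- the first coordinate
  set x : ℝ × ℝ → ℝ := fun z => φ z / P with hx
  have hxs : ContDiffOn ℝ ∞ x S := hφ.div_const P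
  have hPx : ∀ z, P * x z = φ z := fun z => by rw [hx]; field_simp
  have hdiff : ∀ {E : Type} [NormedAddCommGroup E] [NormedSpace ℝ E] {g : ℝ × ℝ → E},
      ContDiffOn ℝ ∞ g S → ∀ z ∈ S, HasFDerivAt g (fderiv ℝ g z) z := fun hg z hz =>
    ((hg.contDiffAt (hS.mem_nhds hz)).differentiableAt (by simp)).hasFDerivAt
  choose! vT hvT using fun z (hz : z ∈ S) => (h.exists_fderiv_eq hκ hτ hlam hc (hSU hz)).1
  have hxT : ∀ z ∈ S, fderiv ℝ x z (vT z) = 1 := fun z hz => by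
    have hφ' := hdiff hφ z hz
    have h2 : HasFDerivAt n₂ _ z := (hφ'.cos.const_mul (ε * c)).congr_of_eventuallyEq (by
      filter_upwards [hS.mem_nhds hz] with y hy using hn₂φ y hy)
    have h3 : HasFDerivAt n₃ _ z := (hφ'.sin.const_mul (ε * c)).congr_of_eventuallyEq (by
      filter_upwards [hS.mem_nhds hz] with y hy using hn₃φ y hy)
    have h4 := h.rotation_rate hκ hτ hlam hc (hSU hz) h2 h3 (hvT z hz)
    have h5 : n₂ z * (ε * c * (cos (φ z) * fderiv ℝ φ z (vT z)))
        - n₃ z * (ε * c * (-sin (φ z) * fderiv ℝ φ z (vT z))) = (lam + ν ^ 2) * P := by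
      simp at h4 ⊢
      linear_combination h4
    rw [hn₂φ z hz, hn₃φ z hz] at h5
    have h6 : fderiv ℝ φ z (vT z) = P := by
      have h7 : c ^ 2 * fderiv ℝ φ z (vT z) = c ^ 2 * P := by
        rw [← hc2] at h5
        linear_combination h5 - c ^ 2 * fderiv ℝ φ z (vT z) * hε2
          - ε ^ 2 * c ^ 2 * fderiv ℝ φ z (vT z) * sin_sq_add_cos_sq (φ z)
      exact mul_left_cancel₀ (by positivity) h7
    have h8 : HasFDerivAt x (P⁻¹ • fderiv ℝ φ z) z := by
      have : x = fun z => P⁻¹ * φ z := by funext z; rw [hx]; field_simp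
      rw [this]
      exact hφ'.const_mul P⁻¹
    rw [h8.fderiv]
    simp [h6, hP0]
  -- the first row of the matrix
  set r : ℝ × ℝ → Fin 4 → ℝ := fun z =>
    (-(κ / 4)) • actSolve (f z) (γ κ τ lam ν (x z)) with hr
  have hγs : ContDiffOn ℝ ∞ (fun z => γ κ τ lam ν (x z)) S := contDiff_γ.comp_contDiffOn hxs
  have hfs : ContDiffOn ℝ ∞ f S := h.smooth.mono hSU
  have hrs : ContDiffOn ℝ ∞ r S := by
    refine ContDiffOn.const_smul (-(κ / 4)) ?_
    rw [contDiffOn_pi]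
    have h1 : ∀ i, ContDiffOn ℝ ∞ (fun z => f z i) S := fun i => contDiffOn_pi.1 hfs i
    have h2 : ∀ i, ContDiffOn ℝ ∞ (fun z => γ κ τ lam ν (x z) i) S :=
      fun i => contDiffOn_pi.1 hγs i
    intro i
    fin_cases i
    · exact ((((h1 0).mul (h2 0)).add ((h1 1).mul (h2 1))).add ((h1 3).mul (h2 2))).sub
        ((h1 2).mul (h2 3))
    · exact ((((h1 0).mul (h2 1)).sub ((h1 1).mul (h2 0))).sub ((h1 3).mul (h2 3))).sub
        ((h1 2).mul (h2 2))
    · exact ((((h1 2).mul (h2 1)).sub ((h1 3).mul (h2 0))).sub ((h1 0).mul (h2 2))).sub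
        ((h1 1).mul (h2 3))
    · exact ((((h1 1).mul (h2 2)).sub ((h1 0).mul (h2 3))).add ((h1 3).mul (h2 1))).add
        ((h1 2).mul (h2 0))
  have hipγ : ∀ y, ip (γ κ τ lam ν y) (γ κ τ lam ν y) ≠ 0 := fun y => by
    rw [ip_γ hκ hτ hlam hB hc]
    exact neg_ne_zero.2 (by positivity)
  have hfr : ∀ z, f z = act (r z) (γ κ τ lam ν (x z)) := fun z => by
    rw [hr, act_smul_left, act_actSolve, smul_smul, ip_γ hκ hτ hlam hB hc]
    rw [show -(κ / 4) * -(4 / κ) = 1 by field_simp, one_smul]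
  -- both `f` and `γ` solve the same linear equation along `T`
  have hT : ∀ z ∈ S, tanT κ τ ν (f z) (n z) = act (r z)
      (twistI (-lam * α₁ κ τ lam ν) (lam * α₂ κ τ lam ν) (γ κ τ lam ν (x z))) := fun z hz => by
    rw [tanT_eq hκ hτ hlam (h.mem_AdS z (hSU hz)) (h.tangent_AdS z (hSU hz))
      (h.angle z (hSU hz)), γ_ode hκ hτ hlam hB hc, act_sub_right, act_smul_right, act_smul_right,
      act_add_right, act_smul_right, act_smul_right, act_J1, act_J2, act_J3, ← hfr z,
      ← hP, hPx, ← hcdef]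
    have e2 : √κ / 2 * ip (n z) (J2 *ᵥ f z) = ε * c * cos (φ z) := hn₂φ z hz
    have e3 : √κ / 2 * ip (n z) (J3 *ᵥ f z) = ε * c * sin (φ z) := hn₃φ z hz
    rw [e2, e3, show √κ / 2 * lam * |ν| * c = √κ / 2 * c * (ε * ν) by rw [hεν]; ring]
    module
  have hfd : ∀ z ∈ S, ∀ v, fderiv ℝ f z v = fderiv ℝ x z v • act (r z)
      (twistI (-lam * α₁ κ τ lam ν) (lam * α₂ κ τ lam ν) (γ κ τ lam ν (x z)))
      + act (fderiv ℝ r z v) (γ κ τ lam ν (x z)) := fun z hz v => by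
    have h1 : HasFDerivAt (fun z => γ κ τ lam ν (x z)) _ z :=
      (hasDerivAt_γ hlam (x z)).hasFDerivAt.comp z (hdiff hxs z hz)
    obtain ⟨L, hL, hLv⟩ := exists_hasFDerivAt_act (hdiff hrs z hz) h1
    have h2 : HasFDerivAt f L z := by
      have : f = fun z => act (r z) (γ κ τ lam ν (x z)) := funext hfr
      rw [this]
      exact hL
    rw [h2.fderiv, hLv]
    simp [act_smul_right]
  have hrT : ∀ z ∈ S, fderiv ℝ r z (vT z) = 0 := fun z hz => by
    have h1 := hfd z hz (vT z)
    rw [hvT z hz, hxT z hz, one_smul, hT z hz] at h1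
    exact (act_eq_zero_iff (hipγ _)).1 (left_eq_add.1 h1)
  -- the second coordinate: an entry of `r` with nonzero derivative across the flow
  set v₀ : ℝ × ℝ := (-fderiv ℝ x z₀ (0, 1), fderiv ℝ x z₀ (1, 0)) with hv₀
  have hxv : ∀ v : ℝ × ℝ, fderiv ℝ x z₀ v
      = v.1 * fderiv ℝ x z₀ (1, 0) + v.2 * fderiv ℝ x z₀ (0, 1) := fun v => by
    have : v = v.1 • ((1, 0) : ℝ × ℝ) + v.2 • ((0, 1) : ℝ × ℝ) := by ext <;> simp
    conv_lhs => rw [this, map_add, map_smul, map_smul]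
    rfl
  have hxv₀ : fderiv ℝ x z₀ v₀ = 0 := by rw [hxv, hv₀]; ring
  have hv₀0 : v₀ ≠ 0 := fun h0 => by
    have h1 : -fderiv ℝ x z₀ (0, 1) = 0 := congrArg Prod.fst h0
    have h2 : fderiv ℝ x z₀ (1, 0) = 0 := congrArg Prod.snd h0
    have h3 := hxT z₀ hz₀S
    rw [hxv, h2, neg_eq_zero.1 h1] at h3
    simp at h3
  have hrv₀ : fderiv ℝ r z₀ v₀ ≠ 0 := fun h0 => by
    have h1 := hfd z₀ hz₀S v₀
    rw [h0, hxv₀, zero_smul, zero_add, (act_eq_zero_iff (hipγ _)).2 rfl] at h1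
    exact hv₀0 (h.immersion z₀ hz₀ (h1.trans (map_zero _).symm))
  obtain ⟨i, hi⟩ := Function.ne_iff.1 hrv₀
  set Φ : ℝ × ℝ → ℝ × ℝ := fun z => (x z, r z i) with hΦ
  have hΦs : ContDiffOn ℝ ∞ Φ S := hxs.prodMk (contDiffOn_pi.1 hrs i)
  have hΦd : ∀ z ∈ S, ∀ v, fderiv ℝ Φ z v = (fderiv ℝ x z v, fderiv ℝ r z v i) :=
    fun z hz v => by
      have h1 := (hdiff hxs z hz).prodMk (hasFDerivAt_pi'.1 (hdiff hrs z hz) i)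
      rw [h1.fderiv]
      rfl
  have hbij : Function.Bijective (fderiv ℝ Φ z₀) := by
    have hsurj : Function.Surjective (fderiv ℝ Φ z₀) := by
      rintro ⟨a, b⟩
      refine ⟨a • vT z₀ + (b / fderiv ℝ r z₀ v₀ i) • v₀, ?_⟩
      rw [map_add, map_smul, map_smul, hΦd z₀ hz₀S, hΦd z₀ hz₀S, hxT z₀ hz₀S, hrT z₀ hz₀S, hxv₀]
      have hi' : fderiv ℝ r z₀ v₀ i ≠ 0 := hi
      ext
      · simp
      · simp
        field_simp
    exact ⟨(LinearMap.injective_iff_surjective (f := (fderiv ℝ Φ z₀).toLinearMap)).2 hsurj, hsurj⟩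
  obtain ⟨l₀, hzl₀, hl₀S, hl₀Φ, hl₀s⟩ := exists_smooth_localInverse hS hz₀S hΦs hbij
  obtain ⟨x₀, x₁, y₀, y₁, hx₀, hy₀, hrect⟩ := exists_rectangle l₀.open_target
    (l₀.map_source hzl₀)
  have hWo : IsOpen (Ioo x₀ x₁ ×ˢ Ioo y₀ y₁) := isOpen_Ioo.prod isOpen_Ioo
  set l := restrTarget l₀ (Ioo x₀ x₁ ×ˢ Ioo y₀ y₁) hWo with hldef
  have hlt : l.target = Ioo x₀ x₁ ×ˢ Ioo y₀ y₁ := by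
    rw [hldef, restrTarget_target, inter_eq_right]; exact hrect
  have hls : l.source ⊆ S := by
    rw [hldef, restrTarget_source]; exact fun z hz => hl₀S hz.1
  have hlΦ : (l : ℝ × ℝ → ℝ × ℝ) = Φ := hl₀Φ
  have hlsymm : ContDiffOn ℝ ∞ l.symm l.target := by
    rw [hlt]; exact hl₀s.mono hrect
  have hsS : ∀ w ∈ l.target, l.symm w ∈ S := fun w hw => hls (l.map_target hw)
  have hΦsymm : ∀ w ∈ l.target, Φ (l.symm w) = w := fun w hw => by
    rw [← hlΦ]; exact l.right_inv hw
  -- `∂/∂x` is the field mapped to `T`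
  have hsd : ∀ w ∈ l.target, HasFDerivAt l.symm (fderiv ℝ l.symm w) w := fun w hw =>
    ((hlsymm.contDiffAt (l.open_target.mem_nhds hw)).differentiableAt (by simp)).hasFDerivAt
  have hsd1 : ∀ w ∈ l.target, fderiv ℝ l.symm w (1, 0) = vT (l.symm w) := fun w hw => by
    have hws := hsS w hw
    have h1 : HasFDerivAt (fun z => l.symm (Φ z)) _ (l.symm w) :=
      HasFDerivAt.comp (l.symm w) (by rw [hΦsymm w hw]; exact hsd w hw) (hdiff hΦs _ hws)
    have h2 : HasFDerivAt (fun z => l.symm (Φ z)) (ContinuousLinearMap.id ℝ (ℝ × ℝ))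
        (l.symm w) := (hasFDerivAt_id _).congr_of_eventuallyEq (by
      filter_upwards [l.open_source.mem_nhds (l.map_target hw)] with y hy
      rw [← hlΦ]
      exact l.left_inv hy)
    have h3 := congrArg (fun L => L (vT (l.symm w))) (h1.unique h2)
    simp only [ContinuousLinearMap.comp_apply, hΦd _ hws, hxT _ hws, hrT _ hws] at h3
    exact h3
  set R : ℝ → Fin 4 → ℝ := fun y => r (l.symm (x z₀, y)) with hR
  have hxz₀ : x z₀ ∈ Ioo x₀ x₁ := by rw [hl₀Φ] at hx₀; exact hx₀
  have hrR : ∀ w ∈ l.target, r (l.symm w) = R w.2 := fun w hw => by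
    have hw' : w.1 ∈ Ioo x₀ x₁ ∧ w.2 ∈ Ioo y₀ y₁ := by rw [hlt] at hw; exact hw
    have hder : ∀ t ∈ Ioo x₀ x₁, HasDerivAt (fun t => r (l.symm (t, w.2))) 0 t := fun t ht => by
      have htw : (t, w.2) ∈ l.target := by rw [hlt]; exact ⟨ht, hw'.2⟩
      have h1 : HasDerivAt (fun t : ℝ => (t, w.2)) ((1, 0) : ℝ × ℝ) t :=
        (hasDerivAt_id t).prodMk (hasDerivAt_const t w.2)
      have h2 := (hsd _ htw).comp_hasDerivAt t h1
      rw [hsd1 _ htw] at h2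
      have h3 := (hdiff hrs _ (hsS _ htw)).comp_hasDerivAt t h2
      rwa [hrT _ (hsS _ htw)] at h3
    have := isOpen_Ioo.is_const_of_deriv_eq_zero isPreconnected_Ioo
      (fun t ht => (hder t ht).differentiableAt.differentiableWithinAt)
      (fun t ht => (hder t ht).deriv) hw'.1 hxz₀
    exact this
  refine ⟨l, x₀, x₁, y₀, y₁, R, ?_, hls.trans hSU, hlt, by rw [hlΦ]; exact hΦs.mono hls, hlsymm,
    ?_, fun w hw => ?_, fun w hw => ?_⟩
  · rw [hldef, restrTarget_source]
    exact ⟨hzl₀, hx₀, hy₀⟩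
  · refine hrs.comp (hlsymm.comp (contDiff_const.prodMk contDiff_id).contDiffOn ?_) ?_
    · intro y hy
      rw [hlt]
      exact ⟨hxz₀, hy⟩
    · intro y hy
      exact hsS _ (by rw [hlt]; exact ⟨hxz₀, hy⟩)
  · rw [hfr, hrR w hw]
    have : x (l.symm w) = w.1 := congrArg Prod.fst (hΦsymm w hw)
    rw [this]
  · have hws := hsS w hw
    have h1 : HasFDerivAt (fun z => f (l.symm z)) _ w :=
      (h.hasFDerivAt (hSU hws)).comp w (hsd w hw)
    rw [h1.fderiv, ContinuousLinearMap.comp_apply, hsd1 w hw, hvT _ hws]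

/-! ### Charts of the surface -/

section charts

variable {M : Type*} [TopologicalSpace M] [ChartedSpace (ℝ × ℝ) M]
  {F N : M → Fin 4 → ℝ} {e : OpenPartialHomeomorph M (ℝ × ℝ)}

/-- A helix surface read in a chart of the maximal atlas. -/
lemma IsHelixSurface.isLocalHelix (h : IsHelixSurface κ τ lam ν F N)
    (he : e ∈ IsManifold.maximalAtlas 𝓘(ℝ, ℝ × ℝ) ∞ M) :
    IsLocalHelix κ τ lam ν e.target (fun z => F (e.symm z)) (fun z => N (e.symm z)) := by
  have hsymm : ContMDiffOn 𝓘(ℝ, ℝ × ℝ) 𝓘(ℝ, ℝ × ℝ) ∞ e.symm e.target :=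
    contMDiffOn_symm_of_mem_maximalAtlas he
  have hsd : ∀ z ∈ e.target, MDifferentiableAt 𝓘(ℝ, ℝ × ℝ) 𝓘(ℝ, ℝ × ℝ) e.symm z :=
    fun z hz => (contMDiffAt_symm_of_mem_maximalAtlas he hz).mdifferentiableAt (by simp)
  have hd : ∀ z ∈ e.target, ∀ v, fderiv ℝ (fun z => F (e.symm z)) z v
      = mfderiv 𝓘(ℝ, ℝ × ℝ) 𝓘(ℝ, Fin 4 → ℝ) F (e.symm z)
        (mfderiv 𝓘(ℝ, ℝ × ℝ) 𝓘(ℝ, ℝ × ℝ) e.symm z v) := fun z hz v => by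
    have h1 := mfderiv_comp z (I := 𝓘(ℝ, ℝ × ℝ)) (I' := 𝓘(ℝ, ℝ × ℝ)) (I'' := 𝓘(ℝ, Fin 4 → ℝ))
      (g := F) ((h.smooth (e.symm z)).mdifferentiableAt (by simp)) (hsd z hz)
    rw [mfderiv_eq_fderiv] at h1
    exact congrArg (fun A => A v) h1
  refine ⟨e.open_target, (h.smooth.comp_contMDiffOn hsymm).contDiffOn, fun z _ => h.mem_AdS _,
    fun z hz => ?_, (h.smooth_normal.comp_contMDiffOn hsymm).contDiffOn,
    fun z _ => h.tangent_AdS _, fun z hz v => ?_, fun z _ => h.unit _, fun z _ => h.angle _⟩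
  · intro u w huw
    rw [hd z hz, hd z hz] at huw
    have h1 := h.immersion _ huw
    have h2 := mfderiv_comp z (I := 𝓘(ℝ, ℝ × ℝ)) (I' := 𝓘(ℝ, ℝ × ℝ)) (I'' := 𝓘(ℝ, ℝ × ℝ))
      (g := e) ((contMDiffAt_of_mem_maximalAtlas he (e.map_target hz)).mdifferentiableAt (by simp))
      (hsd z hz)
    have h3 : mfderiv 𝓘(ℝ, ℝ × ℝ) 𝓘(ℝ, ℝ × ℝ) (e ∘ e.symm) z
        = ContinuousLinearMap.id ℝ (ℝ × ℝ) := by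
      have h4 : (e ∘ e.symm) =ᶠ[nhds z] id := by
        filter_upwards [e.open_target.mem_nhds hz] with y hy using e.right_inv hy
      rw [h4.mfderiv_eq, mfderiv_id]
      rfl
    rw [h3] at h2
    exact (congrArg (fun A => A u) h2).trans
      ((congrArg (mfderiv 𝓘(ℝ, ℝ × ℝ) 𝓘(ℝ, ℝ × ℝ) e (e.symm z)) h1).trans
        (congrArg (fun A => A w) h2).symm)
  · rw [hd z hz]
    exact h.normal _ _

lemma trans_mem_maximalAtlas [IsManifold 𝓘(ℝ, ℝ × ℝ) ∞ M]
    (he : e ∈ IsManifold.maximalAtlas 𝓘(ℝ, ℝ × ℝ) ∞ M)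
    {l : OpenPartialHomeomorph (ℝ × ℝ) (ℝ × ℝ)} (hl : ContDiffOn ℝ ∞ l l.source)
    (hl' : ContDiffOn ℝ ∞ l.symm l.target) :
    e.trans l ∈ IsManifold.maximalAtlas 𝓘(ℝ, ℝ × ℝ) ∞ M := by
  apply OpenPartialHomeomorph.mem_maximalAtlas_of_contMDiffOn
  · rw [OpenPartialHomeomorph.trans_source]
    exact hl.contMDiffOn.comp ((contMDiffOn_of_mem_maximalAtlas he).mono inter_subset_left)
      fun z hz => hz.2
  · rw [OpenPartialHomeomorph.trans_target]
    exact (contMDiffOn_symm_of_mem_maximalAtlas he).comp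
      (hl'.contMDiffOn.mono inter_subset_left) fun z hz => hz.2

end charts

/-! ### The curve of matrices -/

/-- A helix surface of the form `A(y) γ(x)`, with first row `R(y)` of `A(y)`: the constraints on
the curve `R`. -/
lemma IsLocalHelix.curve_constraints {x₀ x₁ y₀ y₁ : ℝ} {g m : ℝ × ℝ → Fin 4 → ℝ}
    (h : IsLocalHelix κ τ lam ν (Ioo x₀ x₁ ×ˢ Ioo y₀ y₁) g m) (hκ : 0 < κ) (hτ : 0 < τ)
    (hlam : lam = 1 ∨ lam = -1) (hB : 0 < B τ lam ν) (hc : 0 < lam + ν ^ 2)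
    (hx : x₀ < x₁) {R : ℝ → Fin 4 → ℝ} (hR : ContDiffOn ℝ ∞ R (Ioo y₀ y₁))
    (hg : ∀ z ∈ Ioo x₀ x₁ ×ˢ Ioo y₀ y₁, g z = act (R z.2) (γ κ τ lam ν z.1))
    (hgT : ∀ z ∈ Ioo x₀ x₁ ×ˢ Ioo y₀ y₁, fderiv ℝ g z (1, 0) = tanT κ τ ν (g z) (m z))
    {y : ℝ} (hy : y ∈ Ioo y₀ y₁) :
    ip (R y) (R y) = 1 ∧ ip (R y) (deriv R y) = 0 ∧ angSpeed (R y) (deriv R y) = 0 ∧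
      0 < offRe (R y) (deriv R y) ^ 2 + offIm (R y) (deriv R y) ^ 2 := by
  have hk := sqrt_pos.2 hκ
  obtain ⟨x, hxI⟩ := nonempty_Ioo.2 hx
  have hRR : ∀ y ∈ Ioo y₀ y₁, ip (R y) (R y) = 1 := fun y hy => by
    have h1 : ip (g (x, y)) (g (x, y)) = -(4 / κ) := h.mem_AdS _ ⟨hxI, hy⟩
    rw [hg (x, y) ⟨hxI, hy⟩, ip_act_act, ip_γ hκ hτ hlam hB hc] at h1
    have h2 : -(4 / κ) ≠ 0 := neg_ne_zero.2 (by positivity)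
    exact mul_right_cancel₀ h2 (h1.trans (one_mul _).symm)
  have hRd : HasDerivAt R (deriv R y) y :=
    ((hR.contDiffAt (isOpen_Ioo.mem_nhds hy)).differentiableAt (by simp)).hasDerivAt
  have hz : (x, y) ∈ Ioo x₀ x₁ ×ˢ Ioo y₀ y₁ := ⟨hxI, hy⟩
  have hperp : ip (R y) (deriv R y) = 0 := by
    obtain ⟨L, hL, hLv⟩ := exists_hasFDerivAt_ip hRd.hasFDerivAt hRd.hasFDerivAt
    have h0 : L = 0 := hL.unique ((hasFDerivAt_const (1 : ℝ) y).congr_of_eventuallyEq (by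
      filter_upwards [isOpen_Ioo.mem_nhds hy] with w hw using hRR w hw))
    have h1 := hLv 1
    rw [h0, ip_comm _ (R y)] at h1
    simp at h1
    linarith
  obtain ⟨L, hL, hLv⟩ := exists_hasFDerivAt_act_γ (κ := κ) (τ := τ) (lam := lam) (ν := ν) hlam
    (z := (x, y)) hRd
  have hgL : fderiv ℝ g (x, y) = L :=
    (hL.congr_of_eventuallyEq (by
      filter_upwards [h.isOpen.mem_nhds hz] with w hw using hg w hw)).fderiv
  have hTx := hgT _ hz
  rw [hgL, hLv] at hTx
  have hty : fderiv ℝ g (x, y) (0, 1) = act (deriv R y) (γ κ τ lam ν x) := by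
    rw [hgL, hLv]; simp
  have hang : angSpeed (R y) (deriv R y) = 0 := by
    have h1 := h.normal _ hz (0, 1)
    rw [hty] at h1
    have h2 := gBerger_normal_velocity hκ hτ hlam hB hc (hRR y hy) (deriv R y) x
    have h3 : E1 κ τ (g (x, y)) - act (R y) (twistI (-lam * α₁ κ τ lam ν) (lam * α₂ κ τ lam ν)
        (γ κ τ lam ν x)) = ν • m (x, y) := by
      rw [tanT] at hTx
      simp only [one_smul, zero_smul, add_zero] at hTx
      rw [hTx]
      abel
    rw [← hg _ hz, h3, gBerger_smul_left, h1, mul_zero] at h2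
    have hl0 : lam ≠ 0 := by rcases hlam with h | h <;> simp [h]
    have h4 : -(√κ / 2 * lam * B τ lam ν / τ) * (w₁₁ κ τ lam ν + -w₃₃ κ τ lam ν) ≠ 0 :=
      mul_ne_zero (neg_ne_zero.2 (by positivity))
        (add_pos (w₁₁_pos hκ hτ hB hc) (neg_w₃₃_pos hκ hτ hB)).ne'
    exact (mul_eq_zero.1 h2.symm).resolve_left h4
  refine ⟨hRR y hy, hperp, hang, ?_⟩
  by_contra hneg
  have h1 : offRe (R y) (deriv R y) = 0 := by
    nlinarith [sq_nonneg (offRe (R y) (deriv R y)), sq_nonneg (offIm (R y) (deriv R y))]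
  have h2 : offIm (R y) (deriv R y) = 0 := by
    nlinarith [sq_nonneg (offRe (R y) (deriv R y)), sq_nonneg (offIm (R y) (deriv R y))]
  have h3 := velocity_eq_zero (hRR y hy) hperp hang h1 h2
  rw [h3] at hty
  have h4 : act 0 (γ κ τ lam ν x) = 0 := by ext i; fin_cases i <;> simp [act]
  have h5 := h.immersion _ hz ((hty.trans h4).trans (map_zero _).symm)
  exact one_ne_zero (congrArg Prod.snd h5)

lemma contDiffOn_offRe {R S : ℝ → Fin 4 → ℝ} {J : Set ℝ} (hR : ContDiffOn ℝ ∞ R J)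
    (hS : ContDiffOn ℝ ∞ S J) : ContDiffOn ℝ ∞ (fun y => offRe (R y) (S y)) J := by
  have h1 := contDiffOn_pi.1 hR
  have h2 := contDiffOn_pi.1 hS
  exact ((((h1 0).mul (h2 2)).add ((h1 1).mul (h2 3))).sub ((h1 2).mul (h2 0))).sub
    ((h1 3).mul (h2 1))

lemma contDiffOn_offIm {R S : ℝ → Fin 4 → ℝ} {J : Set ℝ} (hR : ContDiffOn ℝ ∞ R J)
    (hS : ContDiffOn ℝ ∞ S J) : ContDiffOn ℝ ∞ (fun y => offIm (R y) (S y)) J := by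
  have h1 := contDiffOn_pi.1 hR
  have h2 := contDiffOn_pi.1 hS
  exact ((((h1 1).mul (h2 2)).sub ((h1 0).mul (h2 3))).sub ((h1 2).mul (h2 1))).add
    ((h1 3).mul (h2 0))

/-- A smooth function with a given smooth nonvanishing derivative is a local coordinate of the
line. -/
lemma exists_coordinate_of_deriv {y₀ y₁ y : ℝ} (hy : y ∈ Ioo y₀ y₁) {s : ℝ → ℝ}
    (hs : ContDiffOn ℝ ∞ s (Ioo y₀ y₁)) (hpos : ∀ t ∈ Ioo y₀ y₁, s t ≠ 0) :
    ∃ l : OpenPartialHomeomorph ℝ ℝ, y ∈ l.source ∧ l.source ⊆ Ioo y₀ y₁ ∧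
      ContDiffOn ℝ ∞ l l.source ∧ ContDiffOn ℝ ∞ l.symm l.target ∧
      ∀ w ∈ l.target, HasDerivAt l.symm (s (l.symm w))⁻¹ w := by
  set L : ℝ → ℝ := fun t => ∫ u in y..t, s u with hL
  have hLd : ∀ t ∈ Ioo y₀ y₁, HasDerivAt L (s t) t := fun t ht => by
    have hsub : uIcc y t ⊆ Ioo y₀ y₁ := ordConnected_Ioo.uIcc_subset hy ht
    exact intervalIntegral.integral_hasDerivAt_right
      (hs.continuousOn.mono hsub).intervalIntegrable
      (hs.continuousOn.stronglyMeasurableAtFilter isOpen_Ioo t ht)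
      (hs.continuousOn.continuousAt (isOpen_Ioo.mem_nhds ht))
  have hLs : ContDiffOn ℝ ∞ L (Ioo y₀ y₁) := by
    rw [contDiffOn_infty_iff_deriv_of_isOpen isOpen_Ioo]
    exact ⟨fun t ht => (hLd t ht).differentiableAt.differentiableWithinAt,
      hs.congr fun t ht => (hLd t ht).deriv⟩
  have hbij : Function.Bijective (fderiv ℝ L y) := by
    have h1 : ∀ v, fderiv ℝ L y v = v * s y := fun v => by
      rw [(hLd y hy).hasFDerivAt.fderiv]; simp
    constructor
    · intro a b hab
      rw [h1, h1] at hab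
      exact mul_right_cancel₀ (hpos y hy) hab
    · intro b
      exact ⟨b / s y, by rw [h1]; field_simp [hpos y hy]⟩
  obtain ⟨l, hyl, hlS, hlL, hls⟩ := exists_smooth_localInverse isOpen_Ioo hy hLs hbij
  refine ⟨l, hyl, hlS, by rw [hlL]; exact hLs.mono hlS, hls, fun w hw => ?_⟩
  have h1 := hlS (l.map_target hw)
  exact l.hasDerivAt_symm hw (hpos _ h1) (by rw [hlL]; exact hLd _ h1)

/-! ### The adapted coordinates -/

/-- The angle `η` in terms of the argument `χ` of the off-diagonal entry of `A⁻¹A'`. The case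
distinction, on the sign of `λν`, makes `sin (η - νt) = -sin (χ + λ|ν|t)` hold in both cases. -/
def etaOf (lam ν χ : ℝ) : ℝ := if lam * |ν| = ν then -χ else χ + π

lemma sin_etaOf (hlam : lam = 1 ∨ lam = -1) (χ t : ℝ) :
    sin (etaOf lam ν χ - ν * t) = -sin (χ + lam * |ν| * t) := by
  unfold etaOf
  split_ifs with h
  · rw [h, ← sin_neg]; ring_nf
  · have h1 : lam * |ν| = -ν := by
      rcases hlam with rfl | rfl <;> rcases abs_choice ν with h2 | h2 <;> simp_all
    rw [h1, show χ + π - ν * t = (χ + -ν * t) + π by ring, sin_add_pi]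

lemma cos_etaOf (hlam : lam = 1 ∨ lam = -1) (hν : ν ≠ 0) (χ t : ℝ) :
    cos (etaOf lam ν χ - ν * t) = lam * |ν| / ν * cos (χ + lam * |ν| * t) := by
  unfold etaOf
  split_ifs with h
  · rw [h, div_self hν, one_mul, ← cos_neg]; ring_nf
  · have h1 : lam * |ν| = -ν := by
      rcases hlam with rfl | rfl <;> rcases abs_choice ν with h2 | h2 <;> simp_all
    rw [h1, show χ + π - ν * t = (χ + -ν * t) + π by ring, cos_add_pi, neg_div, div_self hν]
    ring

/-- The real and imaginary parts of the product of the two complex coordinates of `γ`, which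
rotates with the sum of the two frequencies. -/
lemma γ_products (hlam : lam = 1 ∨ lam = -1) (x : ℝ) :
    γ κ τ lam ν x 2 * γ κ τ lam ν x 0 + γ κ τ lam ν x 3 * γ κ τ lam ν x 1
      = √(w₁₁ κ τ lam ν) * √(-w₃₃ κ τ lam ν)
        * cos (lam * (α₁ κ τ lam ν + α₂ κ τ lam ν) * x) ∧
    γ κ τ lam ν x 3 * γ κ τ lam ν x 0 - γ κ τ lam ν x 2 * γ κ τ lam ν x 1
      = √(w₁₁ κ τ lam ν) * √(-w₃₃ κ τ lam ν)
        * sin (lam * (α₁ κ τ lam ν + α₂ κ τ lam ν) * x) := by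
  simp only [γ, Matrix.cons_val]
  rcases hlam with h | h
  · rw [show lam * (α₁ κ τ lam ν + α₂ κ τ lam ν) * x
      = α₁ κ τ lam ν * x + α₂ κ τ lam ν * x by rw [h]; ring, cos_add, sin_add]
    constructor
    · linear_combination (-(√(w₁₁ κ τ lam ν) * √(-w₃₃ κ τ lam ν) * sin (α₁ κ τ lam ν * x)
        * sin (α₂ κ τ lam ν * x)) * (lam + 1)) * h
    · linear_combination (√(w₁₁ κ τ lam ν) * √(-w₃₃ κ τ lam ν) * (sin (α₂ κ τ lam ν * x)
        * cos (α₁ κ τ lam ν * x) + cos (α₂ κ τ lam ν * x) * sin (α₁ κ τ lam ν * x))) * h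
  · rw [show lam * (α₁ κ τ lam ν + α₂ κ τ lam ν) * x
      = -(α₁ κ τ lam ν * x + α₂ κ τ lam ν * x) by rw [h]; ring, cos_neg, sin_neg, cos_add, sin_add]
    constructor
    · linear_combination (-(√(w₁₁ κ τ lam ν) * √(-w₃₃ κ τ lam ν) * sin (α₁ κ τ lam ν * x)
        * sin (α₂ κ τ lam ν * x)) * (lam - 1)) * h
    · linear_combination (√(w₁₁ κ τ lam ν) * √(-w₃₃ κ τ lam ν) * (sin (α₂ κ τ lam ν * x)
        * cos (α₁ κ τ lam ν * x) + cos (α₂ κ τ lam ν * x) * sin (α₁ κ τ lam ν * x))) * h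

/-- Up to a multiple of the position vector, `ν JT` is `J₁T`. -/
lemma tanJT_eq_J1_tanT {q n : Fin 4 → ℝ} (hκ : 0 < κ) (hτ : 0 < τ) (hlam : lam = 1 ∨ lam = -1)
    (hq : q ∈ AdS κ) (hnq : ip n q = 0) (hangle : lam * gBerger κ τ q n (E1 κ τ q) = ν) :
    ν • tanJT κ τ ν q n = (√κ / 2 * (lam * (lam + ν ^ 2) / τ)) • q
      + J1 *ᵥ tanT κ τ ν q n := by
  rw [tanJT_eq hκ hτ hlam hq hnq hangle, tanT_eq hκ hτ hlam hq hnq hangle]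
  simp only [Matrix.mulVec_smul, Matrix.mulVec_sub, Matrix.mulVec_add, J1_J1, J1_J2, J1_J3]
  module

/-- The components of `∂_y` along `T` and `JT`, once the off-diagonal entry of `A⁻¹A'` has the
constant modulus `√κ √(λ + ν²) / 2`. -/
lemma velocity_eq_coef {q n r r' : Fin 4 → ℝ} {x χ : ℝ} (hκ : 0 < κ) (hτ : 0 < τ)
    (hlam : lam = 1 ∨ lam = -1) (hν : ν ≠ 0) (hB : 0 < B τ lam ν) (hc : 0 < lam + ν ^ 2)
    (hq : q ∈ AdS κ) (hnq : ip n q = 0) (hunit : gBerger κ τ q n n = lam)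
    (hangle : lam * gBerger κ τ q n (E1 κ τ q) = ν) (hqr : q = act r (γ κ τ lam ν x))
    (hT : tanT κ τ ν q n = act r (twistI (-lam * α₁ κ τ lam ν) (lam * α₂ κ τ lam ν)
      (γ κ τ lam ν x)))
    (hrr' : ip r r' = 0) (hang : angSpeed r r' = 0)
    (hre : offRe r r' = √(lam + ν ^ 2) * √κ / 2 * cos χ)
    (him : offIm r r' = √(lam + ν ^ 2) * √κ / 2 * sin χ)
    (hu : ip (act r' (γ κ τ lam ν x)) q = 0)
    (hun : gBerger κ τ q n (act r' (γ κ τ lam ν x)) = 0) :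
    act r' (γ κ τ lam ν x)
      = (lam * τ / √(B τ lam ν) * sin (etaOf lam ν χ - ν * √(κ * B τ lam ν) * x))
          • tanT κ τ ν q n
        + cos (etaOf lam ν χ - ν * √(κ * B τ lam ν) * x) • tanJT κ τ ν q n := by
  have hk := sqrt_pos.2 hκ
  have hb := sqrt_pos.2 hB
  have hc0 := sqrt_pos.2 hc
  have hc2 := sq_sqrt hc.le
  have hp := radii_mul hκ hτ hB hc
  have hk2 := sq_sqrt hκ.le
  -- the product of the radii with the modulus of the off-diagonal entry
  have hamp : √(w₁₁ κ τ lam ν) * √(-w₃₃ κ τ lam ν) * (√(lam + ν ^ 2) * √κ / 2)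
      = (lam + ν ^ 2) / (√κ * √(B τ lam ν)) := by
    rw [hp, ← hc2]
    conv_lhs => rw [← hk2, sqrt_sq hk.le]
    rw [sqrt_sq hc0.le]
    field_simp
  obtain ⟨g1, g2⟩ := γ_products (κ := κ) (τ := τ) (ν := ν) hlam x
  have hω : lam * (α₁ κ τ lam ν + α₂ κ τ lam ν) * x
      = lam * |ν| * (√(κ * B τ lam ν) * x) := by
    rw [α₁_add_α₂, sqrt_mul hκ.le]; ring
  rw [hω] at g1 g2
  have hW : offRe r r' * (γ κ τ lam ν x 3 * γ κ τ lam ν x 0 - γ κ τ lam ν x 2 * γ κ τ lam ν x 1)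
        + offIm r r' * (γ κ τ lam ν x 2 * γ κ τ lam ν x 0 + γ κ τ lam ν x 3 * γ κ τ lam ν x 1)
      = (lam + ν ^ 2) / (√κ * √(B τ lam ν))
        * sin (χ + lam * |ν| * (√(κ * B τ lam ν) * x)) := by
    rw [g1, g2, hre, him, ← hamp, sin_add]; ring
  have hV : offRe r r' * (γ κ τ lam ν x 2 * γ κ τ lam ν x 0 + γ κ τ lam ν x 3 * γ κ τ lam ν x 1)
        - offIm r r' * (γ κ τ lam ν x 3 * γ κ τ lam ν x 0 - γ κ τ lam ν x 2 * γ κ τ lam ν x 1)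
      = (lam + ν ^ 2) / (√κ * √(B τ lam ν))
        * cos (χ + lam * |ν| * (√(κ * B τ lam ν) * x)) := by
    rw [g1, g2, hre, him, ← hamp, cos_add]; ring
  have hdec := tangent_eq hκ hτ hlam hq hnq hunit hangle hc hu hun
  have h1 : ip (act r' (γ κ τ lam ν x)) (J1 *ᵥ q) = 2 * ((lam + ν ^ 2) / (√κ * √(B τ lam ν))
        * sin (χ + lam * |ν| * (√(κ * B τ lam ν) * x))) := by
    have h2 := ip_act_twistI r r' (γ κ τ lam ν x) 1 1
    have hJ : twistI 1 1 (γ κ τ lam ν x) = J1 *ᵥ γ κ τ lam ν x := by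
      rw [J1_mulVec]; simp [twistI]
    rw [hJ, act_J1, ← hqr, hang, hW] at h2
    rw [h2]; ring
  have h3 : ν * (√κ / 2 * (√κ / 2 * ip n (J3 *ᵥ q) * ip (act r' (γ κ τ lam ν x)) (J2 *ᵥ q)
        - √κ / 2 * ip n (J2 *ᵥ q) * ip (act r' (γ κ τ lam ν x)) (J3 *ᵥ q)))
      = lam * |ν| * (lam + ν ^ 2) * cos (χ + lam * |ν| * (√(κ * B τ lam ν) * x)) := by
    have h4 := congrArg (ip (act r' (γ κ τ lam ν x)))
      (tanJT_eq_J1_tanT hκ hτ hlam hq hnq hangle)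
    have h5 := ip_act_J1_twistI r r' (γ κ τ lam ν x) (-lam * α₁ κ τ lam ν) (lam * α₂ κ τ lam ν)
    rw [hrr', hV] at h5
    rw [hT, ← act_J1, ip_add_right, h5, ip_smul_right, ip_smul_right, hu,
      tanJT_eq hκ hτ hlam hq hnq hangle] at h4
    simp only [ip_smul_right, ip_sub_right] at h4
    have h6 : lam * (α₁ κ τ lam ν + α₂ κ τ lam ν) * ((lam + ν ^ 2) / (√κ * √(B τ lam ν)))
        = lam * |ν| * (lam + ν ^ 2) := by
      rw [α₁_add_α₂]; field_simp
    linear_combination h4 + cos (χ + lam * |ν| * (√(κ * B τ lam ν) * x)) * h6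
  rw [mul_assoc ν, sin_etaOf hlam, cos_etaOf hlam hν]
  rw [h1] at hdec
  have e1 : -(√κ / 2 * τ * lam / (lam + ν ^ 2) * (2 * ((lam + ν ^ 2) / (√κ * √(B τ lam ν))
        * sin (χ + lam * |ν| * (√(κ * B τ lam ν) * x)))))
      = lam * τ / √(B τ lam ν) * -sin (χ + lam * |ν| * (√(κ * B τ lam ν) * x)) := by
    field_simp
  have e2 : √κ / 2 * (√κ / 2 * ip n (J3 *ᵥ q) * ip (act r' (γ κ τ lam ν x)) (J2 *ᵥ q)
        - √κ / 2 * ip n (J2 *ᵥ q) * ip (act r' (γ κ τ lam ν x)) (J3 *ᵥ q)) / (lam + ν ^ 2)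
      = lam * |ν| / ν * cos (χ + lam * |ν| * (√(κ * B τ lam ν) * x)) := by
    generalize χ + lam * |ν| * (√(κ * B τ lam ν) * x) = θ at h3
    rw [div_eq_iff hc.ne']
    field_simp
    linear_combination 4 * h3
  rw [e1, e2] at hdec
  exact hdec

lemma offRe_smul_right (c : ℝ) (r r' : Fin 4 → ℝ) : offRe r (c • r') = c * offRe r r' := by
  simp [offRe]; ring

lemma offIm_smul_right (c : ℝ) (r r' : Fin 4 → ℝ) : offIm r (c • r') = c * offIm r r' := by
  simp [offIm]; ring

lemma angSpeed_smul_right (c : ℝ) (r r' : Fin 4 → ℝ) :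
    angSpeed r (c • r') = c * angSpeed r r' := by
  simp [angSpeed]; ring

/-- The differential equations satisfied, after a change of the parameter `y`, by the first row
`r` of `A(y)`: the diagonal entry of `A⁻¹A'` vanishes, and its off-diagonal entry has constant
modulus `K`. -/
structure IsNormalizedCurve (K : ℝ) (J : Set ℝ) (r : ℝ → Fin 4 → ℝ) : Prop where
  isOpen : IsOpen J
  smooth : ContDiffOn ℝ ∞ r J
  ip_self : ∀ y ∈ J, ip (r y) (r y) = 1
  ip_deriv : ∀ y ∈ J, ip (r y) (deriv r y) = 0
  angSpeed_eq : ∀ y ∈ J, angSpeed (r y) (deriv r y) = 0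
  off_sq : ∀ y ∈ J, offRe (r y) (deriv r y) ^ 2 + offIm (r y) (deriv r y) ^ 2 = K ^ 2

lemma IsNormalizedCurve.hasDerivAt {K : ℝ} {J : Set ℝ} {r : ℝ → Fin 4 → ℝ}
    (h : IsNormalizedCurve K J r) {y : ℝ} (hy : y ∈ J) : HasDerivAt r (deriv r y) y :=
  ((h.smooth.contDiffAt (h.isOpen.mem_nhds hy)).differentiableAt (by simp)).hasDerivAt

/-- The modulus of the off-diagonal entry of `A⁻¹A'` becomes constant when its integral is taken
as the parameter. -/
lemma exists_isNormalizedCurve {R : ℝ → Fin 4 → ℝ} {y₀ y₁ y K : ℝ} (hy : y ∈ Ioo y₀ y₁)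
    (hK : 0 < K) (hR : ContDiffOn ℝ ∞ R (Ioo y₀ y₁))
    (hRc : ∀ y ∈ Ioo y₀ y₁, ip (R y) (R y) = 1 ∧ ip (R y) (deriv R y) = 0 ∧
      angSpeed (R y) (deriv R y) = 0 ∧
      0 < offRe (R y) (deriv R y) ^ 2 + offIm (R y) (deriv R y) ^ 2) :
    ∃ l : OpenPartialHomeomorph ℝ ℝ, y ∈ l.source ∧ l.source ⊆ Ioo y₀ y₁ ∧
      ContDiffOn ℝ ∞ l l.source ∧ ContDiffOn ℝ ∞ l.symm l.target ∧
      IsNormalizedCurve K l.target (fun w => R (l.symm w)) := by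
  have hR' : ContDiffOn ℝ ∞ (deriv R) (Ioo y₀ y₁) :=
    ((contDiffOn_infty_iff_deriv_of_isOpen isOpen_Ioo).1 hR).2
  set m : ℝ → ℝ := fun y => offRe (R y) (deriv R y) ^ 2 + offIm (R y) (deriv R y) ^ 2 with hm
  have hms : ContDiffOn ℝ ∞ m (Ioo y₀ y₁) :=
    ((contDiffOn_offRe hR hR').pow 2).add ((contDiffOn_offIm hR hR').pow 2)
  have hmpos : ∀ y ∈ Ioo y₀ y₁, 0 < m y := fun y hy => (hRc y hy).2.2.2
  obtain ⟨l, hyl, hlS, hls, hls', hld⟩ := exists_coordinate_of_deriv hy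
    (s := fun y => √(m y) / K) ((hms.sqrt fun y hy => (hmpos y hy).ne').div_const K)
    (fun y hy => (div_pos (sqrt_pos.2 (hmpos y hy)) hK).ne')
  have hmem : ∀ w ∈ l.target, l.symm w ∈ Ioo y₀ y₁ := fun w hw => hlS (l.map_target hw)
  have hder : ∀ w ∈ l.target, deriv (fun w => R (l.symm w)) w
      = (√(m (l.symm w)) / K)⁻¹ • deriv R (l.symm w) := fun w hw => by
    have h1 : HasDerivAt R (deriv R (l.symm w)) (l.symm w) :=
      ((hR.contDiffAt (isOpen_Ioo.mem_nhds (hmem w hw))).differentiableAt (by simp)).hasDerivAt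
    exact (h1.scomp w (hld w hw)).deriv
  refine ⟨l, hyl, hlS, hls, hls', l.open_target, hR.comp hls' hmem,
    fun w hw => (hRc _ (hmem w hw)).1, fun w hw => ?_, fun w hw => ?_, fun w hw => ?_⟩
  · rw [hder w hw, ip_smul_right, (hRc _ (hmem w hw)).2.1, mul_zero]
  · rw [hder w hw, angSpeed_smul_right, (hRc _ (hmem w hw)).2.2.1, mul_zero]
  · rw [hder w hw, offRe_smul_right, offIm_smul_right, mul_pow, mul_pow, ← mul_add]
    have h1 := hmpos _ (hmem w hw)
    change _ * m (l.symm w) = _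
    rw [inv_pow, div_pow, sq_sqrt h1.le]
    field_simp

/-- Near a given parameter, the curve is the first row of a family `A(ξ, ξ₁, ξ₂, ξ₃)` with
admissible angles, and the off-diagonal entry of `A⁻¹A'` has a smooth argument `χ`. -/
lemma IsNormalizedCurve.exists_angles {K : ℝ} {J : Set ℝ} {r : ℝ → Fin 4 → ℝ}
    (h : IsNormalizedCurve K J r) (hK : 0 < K) {y : ℝ} (hy : y ∈ J) :
    ∃ (y₀ y₁ : ℝ) (χ ξ₁ ξ₂ ξ₃ : ℝ → ℝ), y ∈ Ioo y₀ y₁ ∧ Ioo y₀ y₁ ⊆ J ∧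
      ContDiffOn ℝ ∞ χ (Ioo y₀ y₁) ∧ AdmissibleAngles (Ioo y₀ y₁) ξ₁ ξ₂ ξ₃ ∧
      ∀ t ∈ Ioo y₀ y₁, r t = row1 (ξ₁ t) (ξ₂ t) (ξ₃ t) ∧
        offRe (r t) (deriv r t) = K * cos (χ t) ∧ offIm (r t) (deriv r t) = K * sin (χ t) := by
  have hr' : ContDiffOn ℝ ∞ (deriv r) J :=
    ((contDiffOn_infty_iff_deriv_of_isOpen h.isOpen).1 h.smooth).2
  have hK2 : 0 < K ^ 2 := by positivity
  obtain ⟨χ, J₁, hJ₁, hy₁, -, hχ, hχe⟩ := exists_smooth_angle h.isOpen hy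
    (contDiffOn_offRe h.smooth hr') (contDiffOn_offIm h.smooth hr')
    (by rw [h.off_sq y hy]; exact hK2.ne')
  obtain ⟨ξ₁, ξ₂, ξ₃, J₂, hJ₂, hy₂, hJ₂J, hξ₁, hξ₂, hξ₃, hrow⟩ := exists_row1 h.isOpen hy
    h.smooth h.ip_self (fun h2 h3 h4 => by
      have h5 : deriv r y 2 = 0 := by nlinarith [sq_nonneg (deriv r y 2), sq_nonneg (deriv r y 3)]
      have h6 : deriv r y 3 = 0 := by nlinarith [sq_nonneg (deriv r y 2), sq_nonneg (deriv r y 3)]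
      have h7 := h.off_sq y hy
      simp [offRe, offIm, h2, h3, h5, h6] at h7
      exact hK2.ne h7)
  obtain ⟨δ, hδ, hball⟩ := Metric.isOpen_iff.1 (hJ₁.inter hJ₂) y ⟨hy₁, hy₂⟩
  rw [Real.ball_eq_Ioo] at hball
  have hb₁ : Ioo (y - δ) (y + δ) ⊆ J₁ := fun t ht => (hball ht).1
  have hb₂ : Ioo (y - δ) (y + δ) ⊆ J₂ := fun t ht => (hball ht).2
  refine ⟨y - δ, y + δ, χ, ξ₁, ξ₂, ξ₃, ⟨by linarith, by linarith⟩, hb₂.trans hJ₂J,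
    hχ.mono hb₁, ⟨hξ₁.mono hb₂, hξ₂.mono hb₂, hξ₃.mono hb₂, fun t ht => ?_⟩, fun t ht => ?_⟩
  · have hd : ∀ {f : ℝ → ℝ}, ContDiffOn ℝ ∞ f J₂ → HasDerivAt f (deriv f t) t := fun hf =>
      ((hf.contDiffAt (hJ₂.mem_nhds (hb₂ ht))).differentiableAt (by simp)).hasDerivAt
    obtain ⟨r', hr1, ha⟩ := hasDerivAt_row1 (hd hξ₁) (hd hξ₂) (hd hξ₃)
    have h1 : HasDerivAt r r' t := hr1.congr_of_eventuallyEq (by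
      filter_upwards [hJ₂.mem_nhds (hb₂ ht)] with w hw using hrow w hw)
    rw [← ha, ← hrow t (hb₂ ht), ← h1.deriv]
    exact h.angSpeed_eq t (hJ₂J (hb₂ ht))
  · have h1 := hχe t
    rw [h.off_sq t (hJ₂J (hb₂ ht)), sqrt_sq hK.le] at h1
    exact ⟨hrow t (hb₂ ht), h1⟩

lemma contDiffOn_etaOf {χ : ℝ → ℝ} {J : Set ℝ} (hχ : ContDiffOn ℝ ∞ χ J) :
    ContDiffOn ℝ ∞ (fun y => etaOf lam ν (χ y)) J := by
  unfold etaOf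
  split_ifs
  · exact hχ.neg
  · exact hχ.add contDiffOn_const

/-- Adapted coordinates around a point of a helix surface. The constant `ξ` can be taken to be
zero, since `act r (γ x)` takes every value `v` with `ip v v = -4/κ` for a suitable first row `r`
with `ip r r = 1`. -/
theorem IsHelixSurface.exists_adapted {M : Type*} [TopologicalSpace M] [ChartedSpace (ℝ × ℝ) M]
    [IsManifold 𝓘(ℝ, ℝ × ℝ) ∞ M] {F N : M → Fin 4 → ℝ} (h : IsHelixSurface κ τ lam ν F N)
    (hκ : 0 < κ) (hτ : 0 < τ) (hlam : lam = 1 ∨ lam = -1) (hν : ν ≠ 0) (hB : 0 < B τ lam ν)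
    (hc : 0 < lam + ν ^ 2) (p : M) :
    ∃ (e : OpenPartialHomeomorph M (ℝ × ℝ)) (x₀ x₁ y₀ y₁ : ℝ) (η ξ₁ ξ₂ ξ₃ : ℝ → ℝ),
      p ∈ e.source ∧ IsAdaptedChart κ τ lam ν F N e (Ioo x₀ x₁) (Ioo y₀ y₁) η ∧
      AdmissibleAngles (Ioo y₀ y₁) ξ₁ ξ₂ ξ₃ ∧
      ∀ z ∈ Ioo x₀ x₁ ×ˢ Ioo y₀ y₁, F (e.symm z) = paramF κ τ lam ν 0 ξ₁ ξ₂ ξ₃ z := by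
  set e₀ := chartAt (ℝ × ℝ) p with he₀def
  have hp : p ∈ e₀.source := mem_chart_source _ p
  have he₀ : e₀ ∈ IsManifold.maximalAtlas 𝓘(ℝ, ℝ × ℝ) ∞ M := IsManifold.chart_mem_maximalAtlas p
  obtain ⟨l, x₀, x₁, a₀, a₁, R, hpl, hlS, hlt, hl, hl', hR, hFR, hT⟩ :=
    (h.isLocalHelix he₀).exists_flowBox hκ hτ hlam hν hB hc (e₀.map_source hp)
  -- the flow-box coordinates as a chart of the surface
  have ht₁ : (e₀.trans l).target = Ioo x₀ x₁ ×ˢ Ioo a₀ a₁ := by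
    rw [OpenPartialHomeomorph.trans_target, ← hlt, inter_eq_left]
    exact fun z hz => hlS (l.map_target hz)
  have h₁ := h.isLocalHelix (trans_mem_maximalAtlas he₀ hl hl')
  rw [ht₁] at h₁
  have hpt := l.map_source hpl
  rw [hlt] at hpt hFR hT
  have hx : x₀ < x₁ := hpt.1.1.trans hpt.1.2
  set K := √(lam + ν ^ 2) * √κ / 2 with hKdef
  have hK : 0 < K := by
    have := sqrt_pos.2 hc
    have := sqrt_pos.2 hκ
    positivity
  -- the change of the coordinate `y`
  obtain ⟨m, hym, hmS, hm, hm', hnc⟩ := exists_isNormalizedCurve hpt.2 hK hR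
    fun y hy => h₁.curve_constraints hκ hτ hlam hB hc hx hR hFR hT hy
  obtain ⟨y₀, y₁, χ, ξ₁, ξ₂, ξ₃, hy, hJ, hχ, hadm, hang⟩ :=
    hnc.exists_angles hK (m.map_source hym)
  set k := l.trans ((OpenPartialHomeomorph.refl ℝ).prod m) with hk
  have hWo : IsOpen (Ioo x₀ x₁ ×ˢ Ioo y₀ y₁) := isOpen_Ioo.prod isOpen_Ioo
  set j := restrTarget k (Ioo x₀ x₁ ×ˢ Ioo y₀ y₁) hWo with hj
  have hbox : ∀ z ∈ Ioo x₀ x₁ ×ˢ Ioo y₀ y₁, (z.1, m.symm z.2) ∈ Ioo x₀ x₁ ×ˢ Ioo a₀ a₁ :=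
    fun z hz => ⟨hz.1, hmS (m.map_target (hJ hz.2))⟩
  have hjt : j.target = Ioo x₀ x₁ ×ˢ Ioo y₀ y₁ := by
    rw [hj, restrTarget_target, inter_eq_right]
    intro z hz
    rw [hk, OpenPartialHomeomorph.trans_target]
    refine ⟨⟨mem_univ _, hJ hz.2⟩, ?_⟩
    change (z.1, m.symm z.2) ∈ l.target
    rw [hlt]
    exact hbox z hz
  have hjs : ∀ z ∈ j.source, z ∈ l.source ∧ (l z).2 ∈ m.source := fun z hz => by
    rw [hj, restrTarget_source, hk, OpenPartialHomeomorph.trans_source] at hz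
    exact ⟨hz.1.1, hz.1.2.2⟩
  have hjS : ContDiffOn ℝ ∞ j j.source := by
    have h1 : ContDiffOn ℝ ∞ l j.source := hl.mono fun z hz => (hjs z hz).1
    exact h1.fst.prodMk (hm.comp h1.snd fun z hz => (hjs z hz).2)
  have hjS' : ContDiffOn ℝ ∞ j.symm j.target := by
    rw [hjt]
    refine hl'.comp (contDiff_fst.contDiffOn.prodMk
      (hm'.comp contDiff_snd.contDiffOn fun z hz => hJ hz.2)) fun z hz => hlt.ge (hbox z hz)
  have he := trans_mem_maximalAtlas he₀ hjS hjS'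
  set e := e₀.trans j with hedef
  have het : e.target = Ioo x₀ x₁ ×ˢ Ioo y₀ y₁ := by
    rw [hedef, OpenPartialHomeomorph.trans_target, ← hjt, inter_eq_left]
    exact fun z hz => hlS (hjs _ (j.map_target hz)).1
  have h₂ := h.isLocalHelix he
  rw [het] at h₂
  have hFe : ∀ z ∈ Ioo x₀ x₁ ×ˢ Ioo y₀ y₁,
      F (e.symm z) = act (R (m.symm z.2)) (γ κ τ lam ν z.1) := fun z hz => hFR _ (hbox z hz)
  -- the coordinate fields
  have hfd : ∀ z ∈ Ioo x₀ x₁ ×ˢ Ioo y₀ y₁, ∀ v, fderiv ℝ (fun z => F (e.symm z)) z v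
      = v.1 • act (R (m.symm z.2)) (twistI (-lam * α₁ κ τ lam ν) (lam * α₂ κ τ lam ν)
          (γ κ τ lam ν z.1))
        + v.2 • act (deriv (fun w => R (m.symm w)) z.2) (γ κ τ lam ν z.1) := fun z hz v => by
    obtain ⟨L, hL, hLv⟩ := exists_hasFDerivAt_act_γ (κ := κ) (τ := τ) (ν := ν) hlam
      (hnc.hasDerivAt (hJ hz.2))
    rw [(hL.congr_of_eventuallyEq (by
      filter_upwards [hWo.mem_nhds hz] with w hw using hFe w hw)).fderiv, hLv]
  have hTz : ∀ z ∈ Ioo x₀ x₁ ×ˢ Ioo y₀ y₁, tanT κ τ ν (F (e.symm z)) (N (e.symm z))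
      = act (R (m.symm z.2)) (twistI (-lam * α₁ κ τ lam ν) (lam * α₂ κ τ lam ν)
        (γ κ τ lam ν z.1)) := fun z hz => by
    have h1 := hT _ (hbox z hz)
    have hRd : HasDerivAt R (deriv R (m.symm z.2)) (m.symm z.2) := ((hR.contDiffAt
      (isOpen_Ioo.mem_nhds (hbox z hz).2)).differentiableAt (by simp)).hasDerivAt
    obtain ⟨L, hL, hLv⟩ := exists_hasFDerivAt_act_γ (κ := κ) (τ := τ) (lam := lam) (ν := ν) hlam
      (z := (z.1, m.symm z.2)) hRd
    rw [(hL.congr_of_eventuallyEq (by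
      filter_upwards [(isOpen_Ioo.prod isOpen_Ioo).mem_nhds (hbox z hz)] with w hw
        using hFR w hw)).fderiv, hLv] at h1
    simp only [one_smul, zero_smul, add_zero] at h1
    exact h1.symm
  refine ⟨e, x₀, x₁, y₀, y₁, fun y => etaOf lam ν (χ y), ξ₁, ξ₂, ξ₃, ?_,
    ⟨he, het, contDiffOn_etaOf hχ, fun z hz => ?_, fun z hz => ?_⟩, hadm, fun z hz => ?_⟩
  · rw [hedef, OpenPartialHomeomorph.trans_source]
    refine ⟨hp, ?_⟩
    change e₀ p ∈ j.source
    rw [hj, restrTarget_source, hk, OpenPartialHomeomorph.trans_source]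
    exact ⟨⟨hpl, mem_univ _, hym⟩, hpt.1, hy⟩
  · rw [het] at hz
    rw [hfd z hz, hTz z hz]
    simp
  · rw [het] at hz
    have h1 : fderiv ℝ (fun z => F (e.symm z)) z (0, 1)
        = act (deriv (fun w => R (m.symm w)) z.2) (γ κ τ lam ν z.1) := by
      rw [hfd z hz]; simp
    have hu := h₂.ip_fderiv hz (0, 1)
    have hun := h₂.normal z hz (0, 1)
    rw [h1] at hu hun ⊢
    obtain ⟨-, hre, him⟩ := hang z.2 hz.2
    exact velocity_eq_coef hκ hτ hlam hν hB hc (h₂.mem_AdS z hz) (h₂.tangent_AdS z hz)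
      (h₂.unit z hz) (h₂.angle z hz) (hFe z hz) (hTz z hz) (hnc.ip_deriv _ (hJ hz.2))
      (hnc.angSpeed_eq _ (hJ hz.2)) hre him hu hun
  · rw [hFe z hz, paramF, matA_mulVec, rot_zero, ← (hang z.2 hz.2).1]

end BergerAdS

end

theorem theorem6p2 (κ τ lam ν : ℝ) (hκ : 0 < κ) (hτ : 0 < τ) (hlam : lam = 1 ∨ lam = -1)
    (hν : ν ≠ 0) (hB : 0 < BergerAdS.B τ lam ν) :
    (∀ (M : Type*) [TopologicalSpace M] [ChartedSpace (ℝ × ℝ) M]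
        [IsManifold 𝓘(ℝ, ℝ × ℝ) ∞ M] (F N : M → Fin 4 → ℝ),
        BergerAdS.IsHelixSurface κ τ lam ν F N → ∀ p : M,
          BergerAdS.IsTwistedGeodesicOfLorentzTorus κ τ (√(BergerAdS.w₁₁ κ τ lam ν))
            (√(-BergerAdS.w₃₃ κ τ lam ν)) (BergerAdS.γ κ τ lam ν) ∧
          ∃ (e : OpenPartialHomeomorph M (ℝ × ℝ)) (x₀ x₁ y₀ y₁ : ℝ) (η : ℝ → ℝ)
            (ξ : ℝ) (ξ₁ ξ₂ ξ₃ : ℝ → ℝ),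
            p ∈ e.source ∧
            BergerAdS.IsAdaptedChart κ τ lam ν F N e (Ioo x₀ x₁) (Ioo y₀ y₁) η ∧
            BergerAdS.AdmissibleAngles (Ioo y₀ y₁) ξ₁ ξ₂ ξ₃ ∧
            (∀ y ∈ Ioo y₀ y₁,
              BergerAdS.IsPseudoOrthogonal (BergerAdS.matA ξ (ξ₁ y) (ξ₂ y) (ξ₃ y)) ∧
              Commute (BergerAdS.matA ξ (ξ₁ y) (ξ₂ y) (ξ₃ y)) BergerAdS.J1) ∧
            ∀ z ∈ Ioo x₀ x₁ ×ˢ Ioo y₀ y₁,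
              F (e.symm z) = BergerAdS.paramF κ τ lam ν ξ ξ₁ ξ₂ ξ₃ z) ∧
    (0 < lam + ν ^ 2 →
      BergerAdS.IsTwistedGeodesicOfLorentzTorus κ τ (√(BergerAdS.w₁₁ κ τ lam ν))
        (√(-BergerAdS.w₃₃ κ τ lam ν)) (BergerAdS.γ κ τ lam ν) ∧
      ∀ (J : Set ℝ) (ξ : ℝ) (ξ₁ ξ₂ ξ₃ : ℝ → ℝ), IsOpen J →
        BergerAdS.AdmissibleAngles J ξ₁ ξ₂ ξ₃ →
        ∀ Ω : TopologicalSpace.Opens (ℝ × ℝ), (Ω : Set (ℝ × ℝ)) ⊆ univ ×ˢ J →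
          (∀ z ∈ Ω, Function.Injective
            (fderiv ℝ (BergerAdS.paramF κ τ lam ν ξ ξ₁ ξ₂ ξ₃) z)) →
          ∃ N : Ω → Fin 4 → ℝ, BergerAdS.IsHelixSurface κ τ lam ν
            (fun z : Ω => BergerAdS.paramF κ τ lam ν ξ ξ₁ ξ₂ ξ₃ z) N) := by
  refine ⟨fun M _ _ _ F N h p => ?_, fun hc => ⟨BergerAdS.isTwistedGeodesic_γ hκ hτ hlam hB hc,
    fun J ξ ξ₁ ξ₂ ξ₃ hJ hξ Ω hΩ himm =>
      BergerAdS.exists_isHelixSurface_paramF hκ hτ hlam hν hB hc hJ hξ hΩ himm⟩⟩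
  have hc : 0 < lam + ν ^ 2 :=
    (h.isLocalHelix (IsManifold.chart_mem_maximalAtlas p)).add_sq_pos hκ hτ hlam hν
      ((chartAt (ℝ × ℝ) p).map_source (mem_chart_source _ p))
  obtain ⟨e, x₀, x₁, y₀, y₁, η, ξ₁, ξ₂, ξ₃, hp, hchart, hadm, hF⟩ :=
    h.exists_adapted hκ hτ hlam hν hB hc p
  exact ⟨BergerAdS.isTwistedGeodesic_γ hκ hτ hlam hB hc, e, x₀, x₁, y₀, y₁, η, 0, ξ₁, ξ₂, ξ₃, hp,
    hchart, hadm, fun y _ => ⟨BergerAdS.isPseudoOrthogonal_matA _ _ _ _,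
      BergerAdS.commute_matA_J1 _ _ _ _⟩, hF⟩
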